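/- \textbf{Setting.} Let $d\in\mathbb N$, $T>0$, let $\mathbb T^d=\mathbb R^d/\mathbb Z^d$ be the flat torus with its geodesic distance $|x-y|$, and for $x,y\in\mathbb T^d$ let the vector $y-x\in\mathbb R^d$ be the shortest displacement from $x$ to $y$, with coordinates in $(-\tfrac12,\tfrac12]$. Let $\mathscr P(\mathbb T^d)$ be the set of Borel probability measures on $\mathbb T^d$ and $W_2$ the $2$-Wasserstein distance. Let $F(t,x,\theta)\subseteq\mathbb R^d$ and $G(t,x,y,\theta)\subseteq\mathbb R^d$ ($t\in[0,T]$, $x,y\in\mathbb T^d$, $\theta\in\mathscr P(\mathbb T^d)$) be set-valued maps with nonempty compact convex values such that, for some $k\in L^1([0,T])$ (real-valued at every time) and all arguments, \[d_H(F(t,x_1,\theta_1),F(s,x_2,\theta_2))\le k(t)\,(|t-s|+|x_1-x_2|+W_2(\theta_1,\theta_2)),\] \[d_H(G(t,x_1,y_1,\theta_1),G(s,x_2,y_2,\theta_2))\le k(t)\,(|t-s|+|x_1-x_2|+|y_1-y_2|+W_2(\theta_1,\theta_2)),\] where $d_H$ is the Hausdorff distance. Let $\mathscr L:\mathbb T^d\times\mathscr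 P(\mathbb T^d)\to\mathbb R$ be bounded and Lipschitz continuous. For $p_x\in\mathbb R^d$ and $p_\mu\in L^2_\mu(\mathbb T^d;\mathbb R^d)$ define the Hamiltonian \[H(t,x,\mu,p_x,p_\mu)=\inf\Big\{\mathscr L(x,\mu)+\langle v,p_x\rangle+\int\langle p_\mu(y),w(y)\rangle\,d\mu(y):\ v\in F(t,x,\mu),\ w\in L^2_\mu,\ w(y)\in G(t,x,y,\mu)\ \text{for }\mu\text{-a.e. }y\Big\}.\] \textbf{Admissible variations.} A Borel family $(\pi_h)_{h\in[0,1]}$ of probability measures on $\mathbb T^d\times\mathbb T^d$ is a family of admissible variations from $\mu$ if $\mathrm{pr}_1\sharp\pi_h=\mu$ for all $h$, $\pi_h\rightharpoonup(\mathrm{Id},\mathrm{Id})\sharp\mu$ as $h\to0^+$, and $\limsup_{h\to0^+}\frac1h\big(\iint|x-y|^2\,d\pi_h\big)^{1/2}\le C$ for some constant $C>0$. \textbf{Sub/superdifferentials and solutions.} For $U:[0,T]\times\mathbb T^d\times\mathscr P(\mathbb T^d)\to\mathbb R$ and $t\in[0,T)$, the superdifferential $\partial^+U(t,x,\mu)$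 is the set of $(p_t,p_x,p_\mu)\in\mathbb R\times\mathbb R^d\times L^2_\mu$ such that \[\limsup_{h\to0^+,\ |y|\to0}\frac{U(t+h,x+y,\mathrm{pr}_2\sharp\pi_h)-U(t,x,\mu)-p_th-\langle p_x,y\rangle-\iint\langle p_\mu(\zeta),\zeta'-\zeta\rangle\,d\pi_h(\zeta,\zeta')}{h+|y|}\le0\] for every family $(\pi_h)_{h\in[0,1]}$ of admissible variations from $\mu$; the subdifferential $\partial^-U(t,x,\mu)$ is defined in the same way with $\liminf\ge0$. $U$ is a subsolution (resp. supersolution) of \[\partial_tw+H(t,x,\mu,D_xw,D_\mu w)=0\] if $p_t+H(t,x,\mu,p_x,p_\mu)\ge0$ for all $(t,x,\mu)\in[0,T)\times\mathbb T^d\times\mathscr P(\mathbb T^d)$ and $(p_t,p_x,p_\mu)\in\partial^+U(t,x,\mu)$ (resp. $p_t+H(t,x,\mu,p_x,p_\mu)\le0$ for all such $(t,x,\mu)$ and all $(p_t,p_x,p_\mu)\in\partial^-U(t,x,\mu)$). \textbf{Theorem (Comparison Principle).} Let $V_1,V_2:[0,T]\times\mathbb T^d\times\mathscr P(\mathbb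 T^d)\to\mathbb R$ be bounded and Lipschitz continuous (with respect to $|t-s|+|x-y|+W_2(\mu,\nu)$), $V_1$ a subsolution and $V_2$ a supersolution of this equation. If $V_1(T,\cdot,\cdot)=V_2(T,\cdot,\cdot)$, then $V_1\le V_2$ on $[0,T]\times\mathbb T^d\times\mathscr P(\mathbb T^d)$. -/

import Mathlib

open MeasureTheory Filter Topology

namespace WassersteinHJB

/-- The Euclidean space `ℝᵈ` of velocities and covectors. -/
abbrev Vec (d : ℕ) : Type := EuclideanSpace ℝ (Fin d)

/-- The flat torus `𝕋ᵈ = ℝᵈ / ℤᵈ`. -/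
abbrev Torus (d : ℕ) : Type := UnitAddTorus (Fin d)

instance instSecondCountableUnitAddCircle : SecondCountableTopology UnitAddCircle :=
  UniformSpace.secondCountable_of_separable UnitAddCircle

theorem borelSpace_torus (d : ℕ) : BorelSpace (Torus d) := inferInstance

theorem borelSpace_torus_prod (d : ℕ) : BorelSpace (Torus d × Torus d) := inferInstance

/-- The space `𝒫(𝕋ᵈ)` of Borel probability measures on the torus, with the narrow topology. -/
abbrev Prob (d : ℕ) : Type := ProbabilityMeasure (Torus d)

/-- Plans: Borel probability measures on `𝕋ᵈ × 𝕋ᵈ`, with the narrow topology. -/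
abbrev Plan (d : ℕ) : Type := ProbabilityMeasure (Torus d × Torus d)

/-- The point `x + v` of the torus, for `x ∈ 𝕋ᵈ` and `v ∈ ℝᵈ`. -/
def translate {d : ℕ} (x : Torus d) (v : Vec d) : Torus d :=
  fun i => x i + ((v i : ℝ) : UnitAddCircle)

/-- The vector `y - x ∈ ℝᵈ` for two points of the torus: the shortest displacement from `x` to `y`,
with coordinates in `(-1/2, 1/2]`. -/
noncomputable def disp {d : ℕ} (x y : Torus d) : Vec d :=
  WithLp.toLp 2 fun i => ((AddCircle.equivIoc (1 : ℝ) (-(1 / 2)) (y i - x i) : ℝ))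

/-- The geodesic (flat Euclidean) distance of `𝕋ᵈ = ℝᵈ / ℤᵈ`. -/
noncomputable def torusDist {d : ℕ} (x y : Torus d) : ℝ :=
  Real.sqrt (∑ i, ‖y i - x i‖ ^ 2)

theorem translate_disp {d : ℕ} (x y : Torus d) : translate x (disp x y) = y := by
  funext i
  simp only [translate, disp]
  rw [AddCircle.coe_equivIoc]
  abel

theorem norm_disp {d : ℕ} (x y : Torus d) : ‖disp x y‖ = torusDist x y := by
  rw [EuclideanSpace.norm_eq, torusDist]
  congr 1
  refine Finset.sum_congr rfl fun i _ => ?_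
  congr 1
  set r := AddCircle.equivIoc (1 : ℝ) (-(1 / 2)) (y i - x i) with hr
  have h1 : ((r : ℝ) : UnitAddCircle) = y i - x i := AddCircle.coe_equivIoc
  have h2 := r.2
  have h3 : ‖((r : ℝ) : UnitAddCircle)‖ = |(r : ℝ)| := by
    rw [AddCircle.norm_coe_eq_abs_iff (p := (1 : ℝ)) one_ne_zero, abs_le]
    rcases h2 with ⟨ha, hb⟩
    constructor <;> norm_num <;> linarith
  rw [← h1, h3]
  rfl

/-! ### Transport plans and the Wasserstein distance -/

/-- The first marginal `pr₁♯π`. -/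
noncomputable def fstMarginal {d : ℕ} (π : Plan d) : Prob d :=
  π.map (f := Prod.fst) measurable_fst.aemeasurable

/-- The second marginal `pr₂♯π`. -/
noncomputable def sndMarginal {d : ℕ} (π : Plan d) : Prob d :=
  π.map (f := Prod.snd) measurable_snd.aemeasurable

/-- The plan `(Id, Id)♯μ`. -/
noncomputable def diagPlan {d : ℕ} (μ : Prob d) : Plan d :=
  μ.map (f := fun x => (x, x)) (measurable_id.prodMk measurable_id).aemeasurable

/-- `W_q^π = (∬ d(x,y)^q dπ(x,y))^{1/q}`. -/
noncomputable def planCost {d : ℕ} (q : ℝ) (π : Plan d) : ℝ :=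
  (∫ z, torusDist z.1 z.2 ^ q ∂(π : Measure (Torus d × Torus d))) ^ (1 / q)

/-- The set `Π(μ, ν)` of transport plans between `μ` and `ν`. -/
def couplings {d : ℕ} (μ ν : Prob d) : Set (Plan d) :=
  {π | fstMarginal π = μ ∧ sndMarginal π = ν}

/-- The `q`-Wasserstein distance on `𝒫(𝕋ᵈ)`. -/
noncomputable def wassersteinDist {d : ℕ} (q : ℝ) (μ ν : Prob d) : ℝ :=
  sInf (planCost q '' couplings μ ν)

/-! ### Admissible variations, sub- and superdifferentials -/

/-- `{π_h}_{h ∈ [0, τ]}` is a family of admissible `q`-variations from `μ`. -/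
structure IsAdmissibleVariation {d : ℕ} (q τ : ℝ) (μ : Prob d) (π : ℝ → Plan d) : Prop where
  borel : Measurable fun h : Set.Icc (0 : ℝ) τ => (π h : Measure (Torus d × Torus d))
  fst_eq : ∀ h ∈ Set.Icc (0 : ℝ) τ, fstMarginal (π h) = μ
  tendsto_diag : Tendsto π (𝓝[>] 0) (𝓝 (diagPlan μ))
  rate : ∃ C : ℝ, 0 < C ∧
    limsup (fun h : ℝ => ((planCost q (π h) / h : ℝ) : EReal)) (𝓝[>] 0) ≤ (C : EReal)

/-- The difference quotient
`[U(t+h, x+y, pr₂♯π_h) - U(t,x,μ) - p_t h - ⟨p_x, y⟩ - ∬ ⟨p_μ(ζ), ζ' - ζ⟩ dπ_h(ζ,ζ')] / (h + |y|)`. -/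
noncomputable def diffQuot {d : ℕ} (U : ℝ → Torus d → Prob d → ℝ) (t : ℝ) (x : Torus d)
    (μ : Prob d) (pt : ℝ) (px : Vec d) (pμ : Torus d → Vec d) (π : ℝ → Plan d)
    (h : ℝ) (y : Vec d) : ℝ :=
  (U (t + h) (translate x y) (sndMarginal (π h)) - U t x μ - pt * h - inner ℝ px y
    - ∫ z, inner ℝ (pμ z.1) (disp z.1 z.2) ∂(π h : Measure (Torus d × Torus d))) / (h + ‖y‖)

/-- `(p_t, p_x, p_μ) ∈ ∂⁺U(t, x, μ)`: `p_μ ∈ L²_μ(𝕋ᵈ; ℝᵈ)` and the `limsup` of the difference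
quotient as `h → 0⁺`, `|y| → 0` is `≤ 0` along every family of admissible `2`-variations from `μ`. -/
def IsSuperdifferential {d : ℕ} (U : ℝ → Torus d → Prob d → ℝ) (t : ℝ) (x : Torus d)
    (μ : Prob d) (pt : ℝ) (px : Vec d) (pμ : Torus d → Vec d) : Prop :=
  MemLp pμ 2 (μ : Measure (Torus d)) ∧
    ∀ π : ℝ → Plan d, IsAdmissibleVariation 2 1 μ π →
      limsup (fun z : ℝ × Vec d => ((diffQuot U t x μ pt px pμ π z.1 z.2 : ℝ) : EReal))
        (𝓝[>] 0 ×ˢ 𝓝 0) ≤ 0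

/-- `(p_t, p_x, p_μ) ∈ ∂⁻U(t, x, μ)`: `p_μ ∈ L²_μ(𝕋ᵈ; ℝᵈ)` and the `liminf` of the difference
quotient as `h → 0⁺`, `|y| → 0` is `≥ 0` along every family of admissible `2`-variations from `μ`. -/
def IsSubdifferential {d : ℕ} (U : ℝ → Torus d → Prob d → ℝ) (t : ℝ) (x : Torus d)
    (μ : Prob d) (pt : ℝ) (px : Vec d) (pμ : Torus d → Vec d) : Prop :=
  MemLp pμ 2 (μ : Measure (Torus d)) ∧
    ∀ π : ℝ → Plan d, IsAdmissibleVariation 2 1 μ π →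
      0 ≤ liminf (fun z : ℝ × Vec d => ((diffQuot U t x μ pt px pμ π z.1 z.2 : ℝ) : EReal))
        (𝓝[>] 0 ×ˢ 𝓝 0)

/-! ### Sub- and supersolutions of `∂_t w + H(t, x, μ, D_x w, D_μ w) = 0`

Functions on `[0,T] × 𝕋ᵈ × 𝒫(𝕋ᵈ)` are written as functions on `ℝ × 𝕋ᵈ × 𝒫(𝕋ᵈ)`; only their values
at times in `[0,T]` matter below. -/

def IsSubsolution {d : ℕ} (T : ℝ) (H : ℝ → Torus d → Prob d → Vec d → (Torus d → Vec d) → ℝ)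
    (U : ℝ → Torus d → Prob d → ℝ) : Prop :=
  ∀ t ∈ Set.Ico (0 : ℝ) T, ∀ (x : Torus d) (μ : Prob d) (pt : ℝ) (px : Vec d)
    (pμ : Torus d → Vec d), IsSuperdifferential U t x μ pt px pμ → 0 ≤ pt + H t x μ px pμ

def IsSupersolution {d : ℕ} (T : ℝ) (H : ℝ → Torus d → Prob d → Vec d → (Torus d → Vec d) → ℝ)
    (U : ℝ → Torus d → Prob d → ℝ) : Prop :=
  ∀ t ∈ Set.Ico (0 : ℝ) T, ∀ (x : Torus d) (μ : Prob d) (pt : ℝ) (px : Vec d)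
    (pμ : Torus d → Vec d), IsSubdifferential U t x μ pt px pμ → pt + H t x μ px pμ ≤ 0

/-! ### The control problem -/

/-- Assumption on the leader's dynamics `F(t, x, θ)` on the time interval `[0, T]`. -/
structure LeaderAssumption {d : ℕ} (T : ℝ) (k : ℝ → ℝ)
    (F : ℝ → Torus d → Prob d → Set (Vec d)) : Prop where
  nonempty : ∀ t ∈ Set.Icc (0 : ℝ) T, ∀ x θ, (F t x θ).Nonempty
  isCompact : ∀ t ∈ Set.Icc (0 : ℝ) T, ∀ x θ, IsCompact (F t x θ)
  convex : ∀ t ∈ Set.Icc (0 : ℝ) T, ∀ x θ, Convex ℝ (F t x θ)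
  lipschitz : ∀ t ∈ Set.Icc (0 : ℝ) T, ∀ s ∈ Set.Icc (0 : ℝ) T, ∀ x₁ x₂ θ₁ θ₂,
    Metric.hausdorffDist (F t x₁ θ₁) (F s x₂ θ₂) ≤
      k t * (|t - s| + torusDist x₁ x₂ + wassersteinDist 2 θ₁ θ₂)

/-- Assumption on the followers' dynamics `G(t, x, y, θ)` on the time interval `[0, T]`, where `x` is
the position of the leader and `y` the position of the follower. -/
structure FollowerAssumption {d : ℕ} (T : ℝ) (k : ℝ → ℝ)
    (G : ℝ → Torus d → Torus d → Prob d → Set (Vec d)) : Prop where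
  nonempty : ∀ t ∈ Set.Icc (0 : ℝ) T, ∀ x y θ, (G t x y θ).Nonempty
  isCompact : ∀ t ∈ Set.Icc (0 : ℝ) T, ∀ x y θ, IsCompact (G t x y θ)
  convex : ∀ t ∈ Set.Icc (0 : ℝ) T, ∀ x y θ, Convex ℝ (G t x y θ)
  lipschitz : ∀ t ∈ Set.Icc (0 : ℝ) T, ∀ s ∈ Set.Icc (0 : ℝ) T, ∀ x₁ x₂ y₁ y₂ θ₁ θ₂,
    Metric.hausdorffDist (G t x₁ y₁ θ₁) (G s x₂ y₂ θ₂) ≤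
      k t * (|t - s| + torusDist x₁ x₂ + torusDist y₁ y₂ + wassersteinDist 2 θ₁ θ₂)

/-- The running cost `L(x, θ)` is bounded and Lipschitz continuous. -/
structure CostAssumption {d : ℕ} (L : Torus d → Prob d → ℝ) : Prop where
  bounded : ∃ M : ℝ, ∀ x θ, |L x θ| ≤ M
  lipschitz : ∃ K : ℝ, ∀ x₁ x₂ θ₁ θ₂,
    |L x₁ θ₁ - L x₂ θ₂| ≤ K * (torusDist x₁ x₂ + wassersteinDist 2 θ₁ θ₂)

/-- The Hamiltonian
`H(t,x,μ,p_x,p_μ) = inf {L(x,μ) + ⟨v,p_x⟩ + ⟨p_μ,w⟩_{L²_μ} : v ∈ F(t,x,μ), w(·) ∈ G(t,x,·,μ) μ-a.e.}`,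
the infimum being over `v ∈ ℝᵈ` and `w ∈ L²_μ(𝕋ᵈ; ℝᵈ)`. -/
noncomputable def hamiltonian {d : ℕ} (F : ℝ → Torus d → Prob d → Set (Vec d))
    (G : ℝ → Torus d → Torus d → Prob d → Set (Vec d)) (L : Torus d → Prob d → ℝ)
    (t : ℝ) (x : Torus d) (μ : Prob d) (px : Vec d) (pμ : Torus d → Vec d) : ℝ :=
  sInf {r : ℝ | ∃ (v : Vec d) (w : Torus d → Vec d), v ∈ F t x μ ∧
    MemLp w 2 (μ : Measure (Torus d)) ∧ (∀ᵐ y ∂(μ : Measure (Torus d)), w y ∈ G t x y μ) ∧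
    r = L x μ + inner ℝ v px + ∫ y, inner ℝ (pμ y) (w y) ∂(μ : Measure (Torus d))}

/-- `V` is bounded and Lipschitz continuous on `[0,T] × 𝕋ᵈ × 𝒫(𝕋ᵈ)`. -/
structure BoundedLipschitz {d : ℕ} (T : ℝ) (V : ℝ → Torus d → Prob d → ℝ) : Prop where
  bounded : ∃ M : ℝ, ∀ t ∈ Set.Icc (0 : ℝ) T, ∀ x μ, |V t x μ| ≤ M
  lipschitz : ∃ K : ℝ, ∀ t ∈ Set.Icc (0 : ℝ) T, ∀ s ∈ Set.Icc (0 : ℝ) T, ∀ x₁ x₂ μ₁ μ₂,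
    |V t x₁ μ₁ - V s x₂ μ₂| ≤ K * (|t - s| + torusDist x₁ x₂ + wassersteinDist 2 μ₁ μ₂)

end WassersteinHJB

/-!
The difficulty of doubling the variables on `𝒫(𝕋ᵈ)` is that optimal plans may split mass. A plan `γ`
between `μ` and `ν` produces an element of the superdifferential at `μ` only through its barycentric
projection (`isSuperdifferential_of_touching`), while the velocity field that the supersolution
selects at `ν`, pulled back by `γ`, assigns several velocities to the same point of `μ`. The
subsolution inequality at `μ` cannot be tested with such a multivalued field.

Therefore the subsolution is first shown to satisfy a suboptimality principle
(`suboptimality_principle`): if the mass of `μ₀` is moved along straight lines with admissible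
velocities, different portions of the mass at one point being allowed different velocities, then to
first order in time a subsolution does not decrease faster than the running cost. By approximation it
suffices to treat finitely many pairs (position, velocity), that is, a particle system. While the
particles are at different places, the velocity is a function of the position, and doubling the
variables between a point of `[0, T] × 𝕋ᵈ × 𝒫(𝕋ᵈ)` and the moving configuration gives the claim
(`particles_monotone`). Two particles with different positions or velocities meet at most once in a
short time, so that only finitely many times are excluded, and these are recovered by continuity
(`particles_suboptimal`).

For the comparison, suppose that `V₁ - V₂` is positive somewhere and maximize
`V₁(t, x, pr₂♯γ) - V₂(s, y, pr₁♯γ) + lam t - (A/2) (|t - s|² + |x - y|² + ∬ |z₁ - z₂|² dγ)` over all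
points and all plans `γ`. The supersolution inequality at `(s, y, pr₁♯γ)` yields an almost minimizing
velocity `v'` of the leader and a field `w'` of the followers. Projecting `w'(z₁)` onto the admissible
velocities at `z₂` gives an admissible motion of `pr₂♯γ` in which mass may split, to which the
suboptimality principle for `V₁` applies (`doubled_suboptimal`). As `A → ∞` the two sides differ by a
vanishing error, because `A` times the distance of the two configurations remains bounded; this
contradicts `lam > 0` (`gain_le_of_doubled_max`).

About the dynamics only uniform continuity and boundedness are used (`RegularField`); they follow from
the finiteness of `k` at each time and the compactness of `[0, T]`. Maxima exist because `𝒫(𝕋ᵈ)` is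
compact for the narrow topology, for which functions that are Lipschitz in the Wasserstein distance
are continuous (`continuous_of_wassersteinDist_le`).
-/

namespace WassersteinHJB

/-! ### The torus, its distance and the Wasserstein distance -/

theorem continuous_torusDist {d : ℕ} :
    Continuous fun z : Torus d × Torus d => torusDist z.1 z.2 := by
  unfold torusDist
  fun_prop

theorem _root_.Continuous.torusDist {d : ℕ} {S : Type*} [TopologicalSpace S] {f g : S → Torus d}
    (hf : Continuous f) (hg : Continuous g) : Continuous fun s => torusDist (f s) (g s) := by
  have h := (continuous_torusDist (d := d)).comp (hf.prodMk hg)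
  exact h

theorem _root_.Measurable.torusDist {d : ℕ} {S : Type*} [MeasurableSpace S] {f g : S → Torus d}
    (hf : Measurable f) (hg : Measurable g) : Measurable fun s => torusDist (f s) (g s) := by
  have h := (continuous_torusDist (d := d)).measurable.comp (hf.prodMk hg)
  exact h

theorem continuous_translate {d : ℕ} :
    Continuous fun z : Torus d × Vec d => translate z.1 z.2 := by
  refine continuous_pi fun i => ?_
  have h : Continuous fun r : ℝ => (r : UnitAddCircle) := AddCircle.continuous_mk' 1
  have h2 : Continuous fun z : Torus d × Vec d => z.2 i := by fun_prop
  exact ((continuous_apply i).comp continuous_fst).add (h.comp h2)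

theorem _root_.Continuous.translate {d : ℕ} {S : Type*} [TopologicalSpace S] {f : S → Torus d}
    {g : S → Vec d} (hf : Continuous f) (hg : Continuous g) :
    Continuous fun s => translate (f s) (g s) := by
  have h := (continuous_translate (d := d)).comp (hf.prodMk hg)
  exact h

theorem _root_.Measurable.translate {d : ℕ} {S : Type*} [MeasurableSpace S] {f : S → Torus d}
    {g : S → Vec d} (hf : Measurable f) (hg : Measurable g) :
    Measurable fun s => translate (f s) (g s) := by
  have h := (continuous_translate (d := d)).measurable.comp (hf.prodMk hg)
  exact h

theorem measurable_disp {d : ℕ} :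
    Measurable fun z : Torus d × Torus d => disp z.1 z.2 := by
  have h : Measurable fun z : Torus d × Torus d =>
      fun i => ((AddCircle.equivIoc (1 : ℝ) (-(1 / 2)) (z.2 i - z.1 i) : ℝ)) := by
    refine measurable_pi_lambda _ fun i => ?_
    have h1 : Measurable fun z : Torus d × Torus d => z.2 i - z.1 i :=
      (((continuous_apply i).comp continuous_snd).sub
        ((continuous_apply i).comp continuous_fst)).measurable
    exact measurable_subtype_coe.comp
      ((AddCircle.measurableEquivIoc (1 : ℝ) (-(1 / 2))).measurable.comp h1)
  exact (WithLp.measurable_toLp 2 _).comp h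

theorem translate_add {d : ℕ} (x : Torus d) (u v : Vec d) :
    translate x (u + v) = translate (translate x u) v := by
  funext i
  simp [translate, add_assoc]

theorem translate_zero {d : ℕ} (x : Torus d) : translate x (0 : Vec d) = x := by
  funext i
  simp [translate]

theorem torusDist_nonneg {d : ℕ} (x y : Torus d) : 0 ≤ torusDist x y := Real.sqrt_nonneg _

theorem torusDist_comm {d : ℕ} (x y : Torus d) : torusDist x y = torusDist y x := by
  unfold torusDist
  simp_rw [norm_sub_rev]

theorem torusDist_self {d : ℕ} (x : Torus d) : torusDist x x = 0 := by
  simp [torusDist]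

theorem torusDist_translate_le {d : ℕ} (x : Torus d) (u : Vec d) :
    torusDist x (translate x u) ≤ ‖u‖ := by
  rw [torusDist, EuclideanSpace.norm_eq]
  refine Real.sqrt_le_sqrt (Finset.sum_le_sum fun i _ => ?_)
  have : translate x u i - x i = ((u i : ℝ) : UnitAddCircle) := by simp [translate]
  rw [this]
  gcongr
  exact QuotientAddGroup.norm_mk_le_norm

theorem torusDist_triangle {d : ℕ} (x y z : Torus d) :
    torusDist x z ≤ torusDist x y + torusDist y z := by
  have h : z = translate x (disp x y + disp y z) := by
    rw [translate_add, translate_disp, translate_disp]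
  calc torusDist x z = torusDist x (translate x (disp x y + disp y z)) := by rw [← h]
    _ ≤ ‖disp x y + disp y z‖ := torusDist_translate_le _ _
    _ ≤ ‖disp x y‖ + ‖disp y z‖ := norm_add_le _ _
    _ = _ := by rw [norm_disp, norm_disp]

theorem eq_of_torusDist_eq_zero {d : ℕ} {x y : Torus d} (h : torusDist x y = 0) : x = y := by
  rw [← norm_disp, norm_eq_zero] at h
  rw [← translate_disp x y, h, translate_zero]

/-- The squared distance is semiconcave in its second argument, even at the cut locus: for the
shortest displacement `disp x y` chosen there, whichever it is, this inequality holds. -/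
theorem torusDist_translate_right_sq {d : ℕ} (x y : Torus d) (u : Vec d) :
    torusDist x (translate y u) ^ 2 ≤
      torusDist x y ^ 2 + 2 * inner ℝ (disp x y) u + ‖u‖ ^ 2 := by
  rw [← norm_disp x y, ← norm_add_sq_real]
  have h : translate y u = translate x (disp x y + u) := by rw [translate_add, translate_disp]
  rw [h]
  exact pow_le_pow_left₀ (torusDist_nonneg _ _) (torusDist_translate_le _ _) 2

/-- The same choice of `disp x y` gives the semiconcavity of the squared distance in its first
argument. -/
theorem torusDist_translate_left_sq {d : ℕ} (x y : Torus d) (u : Vec d) :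
    torusDist (translate x u) y ^ 2 ≤
      torusDist x y ^ 2 - 2 * inner ℝ (disp x y) u + ‖u‖ ^ 2 := by
  rw [← norm_disp x y, ← norm_sub_sq_real]
  have h : y = translate (translate x u) (disp x y - u) := by
    rw [← translate_add, add_sub_cancel, translate_disp]
  refine pow_le_pow_left₀ (torusDist_nonneg _ _) ?_ 2
  calc torusDist (translate x u) y
      = torusDist (translate x u) (translate (translate x u) (disp x y - u)) := by rw [← h]
    _ ≤ _ := torusDist_translate_le _ _

/-- An upper bound for the diameter of the torus. -/
noncomputable def torusDiam (d : ℕ) : ℝ := Real.sqrt d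

theorem torusDiam_nonneg (d : ℕ) : 0 ≤ torusDiam d := Real.sqrt_nonneg _

theorem torusDist_le_torusDiam {d : ℕ} (x y : Torus d) : torusDist x y ≤ torusDiam d := by
  unfold torusDist torusDiam
  refine Real.sqrt_le_sqrt ?_
  calc ∑ i, ‖y i - x i‖ ^ 2 ≤ ∑ _i : Fin d, (1 : ℝ) := by
        refine Finset.sum_le_sum fun i _ => ?_
        have h := AddCircle.norm_le_half_period (1 : ℝ) one_ne_zero (x := y i - x i)
        have h0 := norm_nonneg (y i - x i)
        norm_num at h
        nlinarith
    _ = d := by simp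

theorem norm_disp_le {d : ℕ} (x y : Torus d) : ‖disp x y‖ ≤ torusDiam d :=
  (norm_disp x y).trans_le (torusDist_le_torusDiam x y)

theorem planCost_two {d : ℕ} (π : Plan d) :
    planCost 2 π = Real.sqrt (∫ z, torusDist z.1 z.2 ^ 2 ∂(π : Measure (Torus d × Torus d))) := by
  rw [planCost, Real.sqrt_eq_rpow]
  norm_num

theorem planCost_nonneg {d : ℕ} (π : Plan d) : 0 ≤ planCost 2 π := by
  rw [planCost_two]; exact Real.sqrt_nonneg _

theorem planCost_sq {d : ℕ} (π : Plan d) :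
    planCost 2 π ^ 2 = ∫ z, torusDist z.1 z.2 ^ 2 ∂(π : Measure (Torus d × Torus d)) := by
  rw [planCost_two, Real.sq_sqrt (integral_nonneg fun z => by positivity)]

theorem wassersteinDist_le_planCost {d : ℕ} {μ ν : Prob d} {π : Plan d} (h : π ∈ couplings μ ν) :
    wassersteinDist 2 μ ν ≤ planCost 2 π :=
  csInf_le ⟨0, by rintro _ ⟨ρ, -, rfl⟩; exact planCost_nonneg ρ⟩ ⟨π, h, rfl⟩

theorem wassersteinDist_nonneg {d : ℕ} (μ ν : Prob d) : 0 ≤ wassersteinDist 2 μ ν :=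
  Real.sInf_nonneg (by rintro _ ⟨ρ, -, rfl⟩; exact planCost_nonneg ρ)

section Law

variable {d : ℕ} {Ω : Type*} [MeasurableSpace Ω]

/-- The law of a random variable with values in the torus. -/
noncomputable def law (P : ProbabilityMeasure Ω) (f : Ω → Torus d) (hf : Measurable f) : Prob d :=
  P.map hf.aemeasurable

/-- The Wasserstein distance is controlled by any realization of the two measures as laws of random
variables on a common probability space. -/
theorem wassersteinDist_law_le (P : ProbabilityMeasure Ω) {f g : Ω → Torus d}
    (hf : Measurable f) (hg : Measurable g) :
    wassersteinDist 2 (law P f hf) (law P g hg) ≤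
      Real.sqrt (∫ ω, torusDist (f ω) (g ω) ^ 2 ∂(P : Measure Ω)) := by
  have hfg := hf.prodMk hg
  let π : Plan d := P.map hfg.aemeasurable
  have hπ : π ∈ couplings (law P f hf) (law P g hg) := by
    constructor <;> apply Subtype.ext
    · exact Measure.map_map measurable_fst hfg
    · exact Measure.map_map measurable_snd hfg
  refine (wassersteinDist_le_planCost hπ).trans_eq ?_
  rw [planCost_two]
  congr 1
  exact integral_map hfg.aemeasurable
    (continuous_torusDist.pow 2).measurable.aestronglyMeasurable

theorem integrable_torusDist_sq (P : ProbabilityMeasure Ω) {f g : Ω → Torus d}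
    (hf : Measurable f) (hg : Measurable g) :
    Integrable (fun ω => torusDist (f ω) (g ω) ^ 2) (P : Measure Ω) := by
  refine Integrable.of_bound (C := torusDiam d ^ 2)
    ((continuous_torusDist.pow 2).measurable.comp (hf.prodMk hg)).aestronglyMeasurable
    (ae_of_all _ fun ω => ?_)
  rw [Real.norm_of_nonneg (by positivity)]
  exact pow_le_pow_left₀ (torusDist_nonneg _ _) (torusDist_le_torusDiam _ _) 2

theorem wassersteinDist_law_le_of_forall (P : ProbabilityMeasure Ω) {f g : Ω → Torus d}
    (hf : Measurable f) (hg : Measurable g) {r : ℝ} (hr : 0 ≤ r)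
    (h : ∀ ω, torusDist (f ω) (g ω) ≤ r) :
    wassersteinDist 2 (law P f hf) (law P g hg) ≤ r := by
  refine (wassersteinDist_law_le P hf hg).trans ?_
  rw [Real.sqrt_le_left hr]
  calc ∫ ω, torusDist (f ω) (g ω) ^ 2 ∂(P : Measure Ω) ≤ ∫ _, r ^ 2 ∂(P : Measure Ω) :=
        integral_mono (integrable_torusDist_sq P hf hg) (integrable_const _)
          fun ω => pow_le_pow_left₀ (torusDist_nonneg _ _) (h ω) 2
    _ = r ^ 2 := by simp

end Law

theorem law_id {d : ℕ} (μ : Prob d) : law μ id measurable_id = μ :=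
  Subtype.ext Measure.map_id

theorem wassersteinDist_self {d : ℕ} (μ : Prob d) : wassersteinDist 2 μ μ = 0 := by
  refine le_antisymm ?_ (wassersteinDist_nonneg _ _)
  have h := wassersteinDist_law_le_of_forall μ measurable_id measurable_id le_rfl
    (fun x : Torus d => (torusDist_self x).le)
  rwa [law_id] at h

theorem planCost_swap {d : ℕ} (π : Plan d) :
    planCost 2 (π.map measurable_swap.aemeasurable) = planCost 2 π := by
  rw [planCost_two, planCost_two]
  congr 1
  refine (integral_map measurable_swap.aemeasurable
    (measurable_fst.torusDist measurable_snd |>.pow_const 2).aestronglyMeasurable).trans ?_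
  simp only [Prod.fst_swap, Prod.snd_swap, torusDist_comm]

theorem wassersteinDist_comm {d : ℕ} (μ ν : Prob d) :
    wassersteinDist 2 μ ν = wassersteinDist 2 ν μ := by
  have key : ∀ (μ ν : Prob d), planCost 2 '' couplings μ ν ⊆ planCost 2 '' couplings ν μ := by
    rintro μ ν _ ⟨π, ⟨h1, h2⟩, rfl⟩
    refine ⟨π.map measurable_swap.aemeasurable, ⟨?_, ?_⟩, planCost_swap π⟩
    · rw [← h2]
      exact Subtype.ext (Measure.map_map measurable_fst measurable_swap)
    · rw [← h1]
      exact Subtype.ext (Measure.map_map measurable_snd measurable_swap)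
  rw [wassersteinDist, wassersteinDist, (key μ ν).antisymm (key ν μ)]

theorem wassersteinDist_le_torusDiam {d : ℕ} (μ ν : Prob d) :
    wassersteinDist 2 μ ν ≤ torusDiam d := by
  let P : Plan d := ⟨(μ : Measure (Torus d)).prod ν, inferInstance⟩
  have h1 : law P Prod.fst measurable_fst = μ := Subtype.ext (by
    change ((μ : Measure (Torus d)).prod (ν : Measure (Torus d))).map Prod.fst = μ
    simp)
  have h2 : law P Prod.snd measurable_snd = ν := Subtype.ext (by
    change ((μ : Measure (Torus d)).prod (ν : Measure (Torus d))).map Prod.snd = ν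
    simp)
  have h := wassersteinDist_law_le_of_forall P measurable_fst measurable_snd (torusDiam_nonneg d)
    fun ω => torusDist_le_torusDiam ω.1 ω.2
  rwa [h1, h2] at h

/-! ### Narrow continuity of functions that are Lipschitz for the Wasserstein distance -/

theorem planCost_le_of_ae {d : ℕ} (π : Plan d) {r : ℝ} (hr : 0 ≤ r)
    (h : ∀ᵐ z ∂(π : Measure (Torus d × Torus d)), torusDist z.1 z.2 ≤ r) : planCost 2 π ≤ r := by
  rw [planCost_two, Real.sqrt_le_left hr]
  calc ∫ z, torusDist z.1 z.2 ^ 2 ∂(π : Measure (Torus d × Torus d))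
      ≤ ∫ _, r ^ 2 ∂(π : Measure (Torus d × Torus d)) :=
        integral_mono_ae (integrable_torusDist_sq π measurable_fst measurable_snd)
          (integrable_const _) (h.mono fun z hz => pow_le_pow_left₀ (torusDist_nonneg _ _) hz 2)
    _ = r ^ 2 := by simp

/-- Two probability measures with a common part are coupled by leaving the common part in place and
transporting the remainders independently. -/
theorem wassersteinDist_le_of_common_part {d : ℕ} (μ ν : Prob d) (ρ μ' ν' : Measure (Torus d))
    (hμ : (μ : Measure (Torus d)) = ρ + μ') (hν : (ν : Measure (Torus d)) = ρ + ν') :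
    wassersteinDist 2 μ ν ≤ torusDiam d * Real.sqrt (μ' Set.univ).toReal := by
  have h1 : ρ Set.univ + μ' Set.univ = 1 := by
    rw [← Measure.add_apply, ← hμ]; exact measure_univ
  have h2 : ρ Set.univ + ν' Set.univ = 1 := by
    rw [← Measure.add_apply, ← hν]; exact measure_univ
  have hρ : ρ Set.univ ≠ ⊤ := fun h => by simp [h] at h1
  have hm : μ' Set.univ ≠ ⊤ := fun h => by simp [h] at h1
  have heq : μ' Set.univ = ν' Set.univ :=
    (ENNReal.add_right_inj hρ).1 (h1.trans h2.symm)
  have : IsFiniteMeasure ρ := ⟨hρ.lt_top⟩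
  have : IsFiniteMeasure μ' := ⟨hm.lt_top⟩
  have : IsFiniteMeasure ν' := ⟨heq ▸ hm.lt_top⟩
  by_cases h0 : μ' Set.univ = 0
  · have : μ = ν := by
      apply Subtype.ext
      change (μ : Measure (Torus d)) = ν
      have h3 : μ' = 0 := Measure.measure_univ_eq_zero.1 h0
      have h4 : ν' = 0 := Measure.measure_univ_eq_zero.1 (heq ▸ h0)
      rw [hμ, hν, h3, h4]
    rw [this, wassersteinDist_self]
    exact mul_nonneg (torusDiam_nonneg d) (Real.sqrt_nonneg _)
  have hdiag : Measurable fun x : Torus d => (x, x) := measurable_id.prodMk measurable_id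
  set P : Measure (Torus d × Torus d) :=
    ρ.map (fun x => (x, x)) + (μ' Set.univ)⁻¹ • μ'.prod ν' with hP
  have hfst : P.map Prod.fst = μ := by
    rw [hP, Measure.map_add _ _ measurable_fst, Measure.map_map measurable_fst hdiag,
      Measure.map_smul, Measure.map_fst_prod, ← heq, smul_smul, ENNReal.inv_mul_cancel h0 hm,
      one_smul, hμ]
    congr 1
    exact Measure.map_id
  have hsnd : P.map Prod.snd = ν := by
    rw [hP, Measure.map_add _ _ measurable_snd, Measure.map_map measurable_snd hdiag,
      Measure.map_smul, Measure.map_snd_prod, smul_smul, ENNReal.inv_mul_cancel h0 hm,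
      one_smul, hν]
    congr 1
    exact Measure.map_id
  have hPp : IsProbabilityMeasure P := by
    constructor
    have : P.map Prod.fst Set.univ = 1 := by rw [hfst]; exact measure_univ
    rwa [Measure.map_apply measurable_fst MeasurableSet.univ] at this
  let π : Plan d := ⟨P, hPp⟩
  refine (wassersteinDist_le_planCost (π := π)
    ⟨Subtype.ext hfst, Subtype.ext hsnd⟩).trans ?_
  rw [planCost_two, ← Real.sqrt_sq (torusDiam_nonneg d), ← Real.sqrt_mul (sq_nonneg _)]
  refine Real.sqrt_le_sqrt ?_
  have hcont : Continuous fun z : Torus d × Torus d => torusDist z.1 z.2 ^ 2 :=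
    continuous_torusDist.pow 2
  have hint : ∀ (Q : Measure (Torus d × Torus d)) [IsFiniteMeasure Q],
      Integrable (fun z : Torus d × Torus d => torusDist z.1 z.2 ^ 2) Q := fun Q _ =>
    Integrable.of_bound (C := torusDiam d ^ 2) hcont.measurable.aestronglyMeasurable
      (ae_of_all _ fun z => by
        rw [Real.norm_of_nonneg (by positivity)]
        exact pow_le_pow_left₀ (torusDist_nonneg _ _) (torusDist_le_torusDiam _ _) 2)
  change ∫ z, torusDist z.1 z.2 ^ 2 ∂P ≤ _
  rw [hP, integral_add_measure (hint _) ((hint _).smul_measure (by simp [h0])),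
    integral_map hdiag.aemeasurable hcont.measurable.aestronglyMeasurable, integral_smul_measure]
  simp only [torusDist_self]
  have hle : ∫ z, torusDist z.1 z.2 ^ 2 ∂(μ'.prod ν') ≤
      torusDiam d ^ 2 * ((μ' Set.univ).toReal * (μ' Set.univ).toReal) := by
    calc _ ≤ ∫ _, torusDiam d ^ 2 ∂(μ'.prod ν') := integral_mono (hint _) (integrable_const _)
            fun z => pow_le_pow_left₀ (torusDist_nonneg _ _) (torusDist_le_torusDiam _ _) 2
      _ = _ := by
        rw [integral_const, measureReal_def, ← Set.univ_prod_univ, Measure.prod_prod,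
          ENNReal.toReal_mul, ← heq, smul_eq_mul, mul_comm]
  have hpos : 0 < (μ' Set.univ).toReal := ENNReal.toReal_pos h0 hm
  rw [ENNReal.toReal_inv, smul_eq_mul]
  calc _ ≤ (0 : ℝ) + ((μ' Set.univ).toReal)⁻¹ *
        (torusDiam d ^ 2 * ((μ' Set.univ).toReal * (μ' Set.univ).toReal)) := by
        gcongr
        simp
    _ = _ := by field_simp; ring

theorem ofReal_integral_eq_withDensity_univ {d : ℕ} (μ : Prob d) {χ : Torus d → ℝ}
    (hχ : Continuous χ) (h0 : ∀ z, 0 ≤ χ z) :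
    (μ : Measure (Torus d)).withDensity (fun z => ENNReal.ofReal (χ z)) Set.univ =
      ENNReal.ofReal (∫ z, χ z ∂(μ : Measure (Torus d))) := by
  rw [withDensity_apply _ MeasurableSet.univ, Measure.restrict_univ,
    ofReal_integral_eq_lintegral_ofReal _ (ae_of_all _ h0)]
  exact (BoundedContinuousFunction.mkOfCompact ⟨χ, hχ⟩).integrable _

section Discretization

variable {d : ℕ} {ι : Type*} [Fintype ι]

/-- The finitely supported measure that puts the weights `a i` on the points `x i`. -/
noncomputable def atomic (x : ι → Torus d) (a : ι → ℝ) : Measure (Torus d) :=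
  ∑ i, ENNReal.ofReal (a i) • Measure.dirac (x i)

theorem atomic_univ (x : ι → Torus d) (a : ι → ℝ) :
    atomic x a Set.univ = ∑ i, ENNReal.ofReal (a i) := by
  simp [atomic]

theorem isProbabilityMeasure_atomic (x : ι → Torus d) (a : ι → ℝ) (ha : ∀ i, 0 ≤ a i)
    (h1 : ∑ i, a i = 1) : IsProbabilityMeasure (atomic x a) :=
  ⟨by rw [atomic_univ, ← ENNReal.ofReal_sum_of_nonneg fun i _ => ha i, h1, ENNReal.ofReal_one]⟩

theorem atomic_add (x : ι → Torus d) {a b : ι → ℝ} (ha : ∀ i, 0 ≤ a i) (hb : ∀ i, 0 ≤ b i) :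
    atomic x (fun i => a i + b i) = atomic x a + atomic x b := by
  simp only [atomic]
  rw [← Finset.sum_add_distrib]
  refine Finset.sum_congr rfl fun i _ => ?_
  rw [ENNReal.ofReal_add (ha i) (hb i), add_smul]

/-- Two measures on the same finitely many points are close for the Wasserstein distance if their
weights are close: the common part of the weights stays in place. -/
theorem wassersteinDist_atomic_le (x : ι → Torus d) {a b : ι → ℝ} (ha : ∀ i, 0 ≤ a i)
    (hb : ∀ i, 0 ≤ b i) (ha1 : ∑ i, a i = 1) (hb1 : ∑ i, b i = 1) :
    wassersteinDist 2 (⟨atomic x a, isProbabilityMeasure_atomic x a ha ha1⟩ : Prob d)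
        ⟨atomic x b, isProbabilityMeasure_atomic x b hb hb1⟩ ≤
      torusDiam d * Real.sqrt (∑ i, (a i - min (a i) (b i))) := by
  have hm : ∀ i, 0 ≤ min (a i) (b i) := fun i => le_min (ha i) (hb i)
  have hm1 : ∀ i, 0 ≤ a i - min (a i) (b i) := fun i => sub_nonneg.2 (min_le_left _ _)
  have hm2 : ∀ i, 0 ≤ b i - min (a i) (b i) := fun i => sub_nonneg.2 (min_le_right _ _)
  refine (wassersteinDist_le_of_common_part _ _ (atomic x fun i => min (a i) (b i))
    (atomic x fun i => a i - min (a i) (b i)) (atomic x fun i => b i - min (a i) (b i))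
    ?_ ?_).trans_eq ?_
  · rw [← atomic_add x hm hm1]; simp
  · rw [← atomic_add x hm hm2]; simp
  · rw [atomic_univ, ← ENNReal.ofReal_sum_of_nonneg fun i _ => hm1 i,
      ENNReal.toReal_ofReal (Finset.sum_nonneg fun i _ => hm1 i)]

theorem sum_integral_eq_one (μ : Prob d) {χ : ι → Torus d → ℝ} (hχ : ∀ i, Continuous (χ i))
    (h1 : ∀ z, ∑ i, χ i z = 1) : ∑ i, ∫ z, χ i z ∂(μ : Measure (Torus d)) = 1 := by
  have hint : ∀ i, Integrable (χ i) (μ : Measure (Torus d)) := fun i =>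
    (BoundedContinuousFunction.mkOfCompact ⟨χ i, hχ i⟩).integrable _
  rw [← integral_finsetSum _ fun i _ => hint i]
  simp [h1]

/-- Sending the part `χ i • μ` of `μ` to `x i`, for a partition of unity `χ` subordinate to the
balls of radius `r` about the points `x i`, costs at most `r`. -/
theorem wassersteinDist_discretization_le (μ : Prob d) (x : ι → Torus d) {χ : ι → Torus d → ℝ}
    (hχ : ∀ i, Continuous (χ i)) (h0 : ∀ i z, 0 ≤ χ i z) (h1 : ∀ z, ∑ i, χ i z = 1) {r : ℝ}
    (hr : 0 ≤ r) (hsupp : ∀ i z, χ i z ≠ 0 → torusDist z (x i) ≤ r) :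
    wassersteinDist 2 μ ⟨atomic x fun i => ∫ z, χ i z ∂(μ : Measure (Torus d)),
      isProbabilityMeasure_atomic x _ (fun i => integral_nonneg (h0 i))
        (sum_integral_eq_one μ hχ h1)⟩ ≤ r := by
  have hmeas : ∀ i, Measurable fun z => ENNReal.ofReal (χ i z) := fun i =>
    (hχ i).measurable.ennreal_ofReal
  have hpair : ∀ i, Measurable fun z : Torus d => (z, x i) := fun i =>
    measurable_id.prodMk measurable_const
  set P : Measure (Torus d × Torus d) := ∑ i,
    ((μ : Measure (Torus d)).withDensity fun z => ENNReal.ofReal (χ i z)).map fun z => (z, x i)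
    with hP
  have hfst : P.map Prod.fst = μ := by
    rw [hP, Measure.map_finset_sum' measurable_fst.aemeasurable]
    have : ∀ i, (((μ : Measure (Torus d)).withDensity fun z => ENNReal.ofReal (χ i z)).map
        fun z => (z, x i)).map Prod.fst =
        (μ : Measure (Torus d)).withDensity fun z => ENNReal.ofReal (χ i z) := fun i => by
      rw [Measure.map_map measurable_fst (hpair i)]
      exact Measure.map_id
    simp_rw [this]
    ext s hs
    rw [Measure.finsetSum_apply]
    simp_rw [withDensity_apply _ hs]
    rw [← lintegral_finsetSum _ fun i _ => hmeas i]
    have : ∀ z, ∑ i, ENNReal.ofReal (χ i z) = 1 := fun z => by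
      rw [← ENNReal.ofReal_sum_of_nonneg fun i _ => h0 i z, h1, ENNReal.ofReal_one]
    simp [this]
  have hsnd : P.map Prod.snd = atomic x fun i => ∫ z, χ i z ∂(μ : Measure (Torus d)) := by
    rw [hP, Measure.map_finset_sum' measurable_snd.aemeasurable, atomic]
    refine Finset.sum_congr rfl fun i _ => ?_
    rw [Measure.map_map measurable_snd (hpair i), ← ofReal_integral_eq_withDensity_univ μ (hχ i)
      (h0 i)]
    exact Measure.map_const _ _
  have hPp : IsProbabilityMeasure P := by
    constructor
    have : P.map Prod.fst Set.univ = 1 := by rw [hfst]; exact measure_univ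
    rwa [Measure.map_apply measurable_fst MeasurableSet.univ] at this
  refine (wassersteinDist_le_planCost (π := ⟨P, hPp⟩) (ν := ⟨_, _⟩)
    ⟨Subtype.ext hfst, Subtype.ext hsnd⟩).trans (planCost_le_of_ae _ hr ?_)
  change ∀ᵐ z ∂P, _
  rw [hP, ae_iff, Measure.finsetSum_apply]
  refine Finset.sum_eq_zero fun i _ => ?_
  rw [← ae_iff, ae_map_iff (hpair i).aemeasurable
    (measurableSet_le continuous_torusDist.measurable measurable_const),
    ae_withDensity_iff (hmeas i)]
  refine ae_of_all _ fun z hz => hsupp i z fun h => ?_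
  simp [h] at hz

end Discretization

/-- A finite continuous partition of unity with supports in balls of radius `r`. It is the
normalization of the functions `max 0 (r - torusDist z y)`, for `y` in a finite net. -/
theorem exists_partition_of_unity (d : ℕ) {r : ℝ} (hr : 0 < r) :
    ∃ (s : Finset (Torus d)) (χ : s → Torus d → ℝ), (∀ i, Continuous (χ i)) ∧
      (∀ i z, 0 ≤ χ i z) ∧ (∀ z, ∑ i, χ i z = 1) ∧
      ∀ i z, χ i z ≠ 0 → torusDist z i ≤ r := by
  have hc : ∀ y : Torus d, Continuous fun z : Torus d => torusDist z y := fun y =>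
    continuous_id.torusDist continuous_const
  let U : Torus d → Set (Torus d) := fun y => {z | torusDist z y < r}
  have hU : ∀ y, IsOpen (U y) := fun y => isOpen_lt (hc y) continuous_const
  have hUcov : Set.univ ⊆ ⋃ y, U y := fun z _ =>
    Set.mem_iUnion.2 ⟨z, (torusDist_self z).trans_lt hr⟩
  obtain ⟨s, hs⟩ := isCompact_univ.elim_finite_subcover U hU hUcov
  let f : s → Torus d → ℝ := fun i z => max 0 (r - torusDist z i)
  have hf : ∀ i, Continuous (f i) := fun i =>
    continuous_const.max (continuous_const.sub (hc i))
  have hf0 : ∀ i z, 0 ≤ f i z := fun i z => le_max_left _ _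
  have hS : ∀ z, 0 < ∑ i, f i z := fun z => by
    obtain ⟨y, hy⟩ := Set.mem_iUnion.1 (hs (Set.mem_univ z))
    obtain ⟨hys, hy⟩ := Set.mem_iUnion.1 hy
    refine Finset.sum_pos' (fun i _ => hf0 i z) ⟨⟨y, hys⟩, Finset.mem_univ _, ?_⟩
    exact lt_max_of_lt_right (sub_pos.2 hy)
  refine ⟨s, fun i z => f i z / ∑ j, f j z, fun i => ?_, fun i z => ?_, fun z => ?_,
    fun i z h => ?_⟩
  · exact (hf i).div (continuous_finsetSum _ fun j _ => hf j) fun z => (hS z).ne'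
  · exact div_nonneg (hf0 i z) (hS z).le
  · rw [← Finset.sum_div, div_self (hS z).ne']
  · by_contra! hlt
    exact h (by simp [f, max_eq_left (sub_nonpos.2 hlt.le)])

/-- A function which is Lipschitz for the Wasserstein distance is continuous for the narrow
topology. -/
theorem continuous_of_wassersteinDist_le {d : ℕ} {f : Prob d → ℝ} {K : ℝ}
    (hf : ∀ μ ν, |f μ - f ν| ≤ K * wassersteinDist 2 μ ν) : Continuous f := by
  wlog hK : 0 ≤ K generalizing K
  · refine this (K := 0) (fun μ ν => (hf μ ν).trans ?_) le_rfl
    exact mul_le_mul_of_nonneg_right (not_le.1 hK).le (wassersteinDist_nonneg _ _)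
  rw [continuous_iff_continuousAt]
  intro μ
  refine Metric.tendsto_nhds.2 fun ε hε => ?_
  obtain ⟨r, hr, hKr⟩ : ∃ r : ℝ, 0 < r ∧ K * r ≤ ε / 4 := by
    refine ⟨ε / (4 * (K + 1)), by positivity, ?_⟩
    rw [mul_div_assoc', div_le_div_iff₀ (by positivity) (by positivity)]
    nlinarith
  obtain ⟨s, χ, hχ, h0, h1, hsupp⟩ := exists_partition_of_unity d hr
  let a : Prob d → s → ℝ := fun ν i => ∫ z, χ i z ∂(ν : Measure (Torus d))
  have ha0 : ∀ ν i, 0 ≤ a ν i := fun ν i => integral_nonneg (h0 i)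
  have ha1 : ∀ ν, ∑ i, a ν i = 1 := fun ν => sum_integral_eq_one ν hχ h1
  have hac : ∀ i, Continuous fun ν => a ν i := fun i =>
    ProbabilityMeasure.continuous_integral_boundedContinuousFunction
      (BoundedContinuousFunction.mkOfCompact ⟨χ i, hχ i⟩)
  let D : Prob d → Prob d := fun ν =>
    ⟨atomic (fun i : s => (i : Torus d)) (a ν), isProbabilityMeasure_atomic _ _ (ha0 ν) (ha1 ν)⟩
  have hD : ∀ ν, |f ν - f (D ν)| ≤ ε / 4 := fun ν =>
    (hf _ _).trans ((mul_le_mul_of_nonneg_left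
      (wassersteinDist_discretization_le ν _ hχ h0 h1 hr.le hsupp) hK).trans hKr)
  have hlim : Tendsto (fun ν => K * (torusDiam d *
      Real.sqrt (∑ i, (a ν i - min (a ν i) (a μ i))))) (𝓝 μ) (𝓝 0) := by
    have : Continuous fun ν => K * (torusDiam d *
        Real.sqrt (∑ i, (a ν i - min (a ν i) (a μ i)))) := by
      refine continuous_const.mul (continuous_const.mul (Real.continuous_sqrt.comp ?_))
      exact continuous_finsetSum _ fun i _ => (hac i).sub ((hac i).min continuous_const)
    simpa using this.tendsto μ
  filter_upwards [hlim.eventually (gt_mem_nhds (show (0 : ℝ) < ε / 4 by positivity))] with ν hν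
  have h2 : |f (D ν) - f (D μ)| ≤ ε / 4 :=
    (hf _ _).trans ((mul_le_mul_of_nonneg_left
      (wassersteinDist_atomic_le _ (ha0 ν) (ha0 μ) (ha1 ν) (ha1 μ)) hK).trans hν.le)
  rw [Real.dist_eq]
  have e1 := abs_le.1 (hD ν)
  have e2 := abs_le.1 (hD μ)
  have e3 := abs_le.1 h2
  rw [abs_lt]
  constructor <;> linarith [e1.1, e1.2, e2.1, e2.2, e3.1, e3.2]

/-- The integral of a jointly continuous function depends jointly continuously on the parameter and
on the measure, for the narrow topology. -/
theorem continuous_integral_param {S X : Type*} [TopologicalSpace S] [TopologicalSpace X]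
    [CompactSpace X] [MeasurableSpace X] [OpensMeasurableSpace X] {c : S → X → ℝ}
    (hc : Continuous fun z : S × X => c z.1 z.2) :
    Continuous fun z : S × ProbabilityMeasure X => ∫ x, c z.1 x ∂(z.2 : Measure X) := by
  let C : C(S, C(X, ℝ)) := ContinuousMap.curry ⟨fun z : S × X => c z.1 z.2, hc⟩
  let b : C(X, ℝ) → BoundedContinuousFunction X ℝ := BoundedContinuousFunction.mkOfCompact
  rw [continuous_iff_continuousAt]
  rintro ⟨s, γ⟩
  refine Metric.tendsto_nhds.2 fun ε hε => ?_
  have h1 : ∀ᶠ z : S × ProbabilityMeasure X in 𝓝 (s, γ), dist (C z.1) (C s) < ε / 2 :=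
    (C.continuous.comp continuous_fst).tendsto (s, γ) (Metric.ball_mem_nhds _ (half_pos hε))
  have h2 : ∀ᶠ z : S × ProbabilityMeasure X in 𝓝 (s, γ),
      dist (∫ x, c s x ∂(z.2 : Measure X)) (∫ x, c s x ∂(γ : Measure X)) < ε / 2 :=
    ((ProbabilityMeasure.continuous_integral_boundedContinuousFunction (b (C s))).comp
      continuous_snd).tendsto (s, γ) (Metric.ball_mem_nhds _ (half_pos hε))
  filter_upwards [h1, h2] with z hz1 hz2
  refine (dist_triangle _ (∫ x, c s x ∂(z.2 : Measure X)) _).trans_lt ?_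
  refine lt_of_le_of_lt (add_le_add_left ?_ _) (by linarith : dist (C z.1) (C s) +
    dist (∫ x, c s x ∂(z.2 : Measure X)) (∫ x, c s x ∂(γ : Measure X)) < ε)
  have i1 : Integrable (fun x => c z.1 x) (z.2 : Measure X) := (b (C z.1)).integrable _
  have i2 : Integrable (fun x => c s x) (z.2 : Measure X) := (b (C s)).integrable _
  rw [dist_eq_norm, ← integral_sub i1 i2]
  refine (norm_integral_le_of_norm_le_const (C := dist (C z.1) (C s))
    (ae_of_all _ fun x => ?_)).trans_eq (by simp)
  rw [← dist_eq_norm]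
  exact ContinuousMap.dist_apply_le_dist (f := C z.1) (g := C s) x

/-! ### Superdifferentials from couplings -/

section Touching

open ProbabilityTheory

variable {d : ℕ} {Y : Type*} [MeasurableSpace Y] [StandardBorelSpace Y] [Nonempty Y]

/-- The barycentric projection `ζ ↦ ∫ D(ζ, y) γ(dy | ζ)` of a vector field `D` along the
disintegration of `γ` with respect to its first marginal. -/
noncomputable def bary (γ : ProbabilityMeasure (Torus d × Y)) (D : Torus d × Y → Vec d)
    (ζ : Torus d) : Vec d :=
  ∫ y, D (ζ, y) ∂((γ : Measure (Torus d × Y)).condKernel ζ)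

theorem measurable_bary (γ : ProbabilityMeasure (Torus d × Y)) {D : Torus d × Y → Vec d}
    (hD : Measurable D) : Measurable (bary γ D) :=
  (hD.stronglyMeasurable.integral_kernel_prod_right'
    (κ := (γ : Measure (Torus d × Y)).condKernel)).measurable

theorem norm_bary_le (γ : ProbabilityMeasure (Torus d × Y)) {D : Torus d × Y → Vec d} {B : ℝ}
    (hB : ∀ z, ‖D z‖ ≤ B) (ζ : Torus d) : ‖bary γ D ζ‖ ≤ B :=
  (norm_integral_le_of_norm_le_const (ae_of_all _ fun y => hB (ζ, y))).trans_eq (by simp)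

variable {Ω : Type*} [MeasurableSpace Ω]

/-- The extension of a probability space `(Ω, P)` by a `Y`-valued variable whose conditional law
given `ω` is the conditional law of `γ` given `ζ = h ω`. -/
noncomputable def glue (γ : ProbabilityMeasure (Torus d × Y)) (P : ProbabilityMeasure Ω)
    {h : Ω → Torus d} (hh : Measurable h) : Measure (Ω × Y) :=
  (P : Measure Ω) ⊗ₘ ((γ : Measure (Torus d × Y)).condKernel.comap h hh)

instance (γ : ProbabilityMeasure (Torus d × Y)) (P : ProbabilityMeasure Ω)
    {h : Ω → Torus d} (hh : Measurable h) : IsProbabilityMeasure (glue γ P hh) := by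
  unfold glue; infer_instance

theorem glue_map_fst (γ : ProbabilityMeasure (Torus d × Y)) (P : ProbabilityMeasure Ω)
    {h : Ω → Torus d} (hh : Measurable h) : (glue γ P hh).map Prod.fst = P :=
  Measure.fst_compProd _ _

theorem glue_map (γ : ProbabilityMeasure (Torus d × Y)) (P : ProbabilityMeasure Ω)
    {h : Ω → Torus d} (hh : Measurable h)
    (hP : (P : Measure Ω).map h = (γ : Measure (Torus d × Y)).map Prod.fst) :
    (glue γ P hh).map (fun z => (h z.1, z.2)) = γ := by
  have hm : Measurable fun z : Ω × Y => (h z.1, z.2) :=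
    (hh.comp measurable_fst).prodMk measurable_snd
  conv_rhs => rw [← (γ : Measure (Torus d × Y)).disintegrate
    (γ : Measure (Torus d × Y)).condKernel]
  ext s hs
  rw [Measure.map_apply hm hs, glue, Measure.compProd_apply (hm hs), Measure.compProd_apply hs,
    Measure.fst, ← hP, lintegral_map (Kernel.measurable_kernel_prodMk_left hs) hh]
  rfl

theorem integral_glue_comp (γ : ProbabilityMeasure (Torus d × Y)) (P : ProbabilityMeasure Ω)
    {h : Ω → Torus d} (hh : Measurable h)
    (hP : (P : Measure Ω).map h = (γ : Measure (Torus d × Y)).map Prod.fst)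
    {f : Torus d × Y → ℝ} (hf : Measurable f) :
    ∫ z, f z ∂(γ : Measure (Torus d × Y)) = ∫ z, f (h z.1, z.2) ∂glue γ P hh := by
  conv_lhs => rw [← glue_map γ P hh hP]
  exact integral_map ((hh.comp measurable_fst).prodMk measurable_snd).aemeasurable
    hf.aestronglyMeasurable

/-- Integrating against the barycentric projection amounts to integrating against the field itself
on the glued probability space. -/
theorem integral_inner_bary (γ : ProbabilityMeasure (Torus d × Y)) (P : ProbabilityMeasure Ω)
    {h : Ω → Torus d} (hh : Measurable h) {D : Torus d × Y → Vec d} (hD : Measurable D) {B : ℝ}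
    (hB : ∀ z, ‖D z‖ ≤ B) {w : Ω → Vec d} (hw : Measurable w) {R : ℝ} (hR : ∀ ω, ‖w ω‖ ≤ R) :
    ∫ ω, inner ℝ (bary γ D (h ω)) (w ω) ∂(P : Measure Ω) =
      ∫ z, inner ℝ (D (h z.1, z.2)) (w z.1) ∂glue γ P hh := by
  have hm : Measurable fun z : Ω × Y => D (h z.1, z.2) :=
    hD.comp ((hh.comp measurable_fst).prodMk measurable_snd)
  have hint : Integrable (fun z : Ω × Y => inner ℝ (D (h z.1, z.2)) (w z.1)) (glue γ P hh) := by
    refine Integrable.of_bound (C := B * R)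
      (hm.inner (hw.comp measurable_fst)).aestronglyMeasurable (ae_of_all _ fun z => ?_)
    exact (norm_inner_le_norm _ _).trans (mul_le_mul (hB _) (hR _) (norm_nonneg _)
      ((norm_nonneg _).trans (hB (h z.1, z.2))))
  rw [glue, Measure.integral_compProd hint]
  refine integral_congr_ae (ae_of_all _ fun ω => ?_)
  have h1 : Integrable (fun y => D (h ω, y)) ((γ : Measure (Torus d × Y)).condKernel (h ω)) :=
    Integrable.of_bound (C := B) (hD.comp measurable_prodMk_left).aestronglyMeasurable
      (ae_of_all _ fun y => hB _)
  simp only [Kernel.comap_apply]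
  rw [real_inner_comm, bary, ← integral_inner h1]
  simp_rw [real_inner_comm]

theorem integral_inner_bary_law (γ : ProbabilityMeasure (Torus d × Y)) {D : Torus d × Y → Vec d}
    (hD : Measurable D) {B : ℝ} (hB : ∀ z, ‖D z‖ ≤ B) {w : Torus d → Vec d} (hw : Measurable w)
    {R : ℝ} (hR : ∀ ζ, ‖w ζ‖ ≤ R) :
    ∫ ζ, inner ℝ (bary γ D ζ) (w ζ) ∂(law γ Prod.fst measurable_fst : Measure (Torus d)) =
      ∫ z, inner ℝ (D z) (w z.1) ∂(γ : Measure (Torus d × Y)) := by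
  have hP : (law γ Prod.fst measurable_fst : Measure (Torus d)).map id =
      (γ : Measure (Torus d × Y)).map Prod.fst := Measure.map_id
  refine (integral_inner_bary γ (law γ Prod.fst measurable_fst) measurable_id hD hB hw hR).trans ?_
  exact (integral_glue_comp γ _ measurable_id hP (hD.inner (hw.comp measurable_fst))).symm

/-- **Superdifferential from a coupling.** Let `U` be touched from above, at `(t, x, pr₁♯γ)`, by a
function that depends on a measure `θ` through the cost `∫ c` of couplings with a fixed second
marginal, where `c(·, y)` is semiconcave with superdifferential `-2 D(·, y)`. Then the barycentric
projection of `-A D` belongs to the superdifferential. Any plan issuing from `pr₁♯γ` is glued to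
`γ` along the common marginal in order to transport the variation to `γ`. -/
theorem isSuperdifferential_of_touching (U : ℝ → Torus d → Prob d → ℝ) (t : ℝ) (x : Torus d)
    (γ : ProbabilityMeasure (Torus d × Y)) {D : Torus d × Y → Vec d} (hD : Measurable D) {B : ℝ}
    (hB : ∀ z, ‖D z‖ ≤ B) {c : Torus d × Y → ℝ} (hcm : Measurable c) {Bc : ℝ}
    (hBc : ∀ z, ‖c z‖ ≤ Bc)
    (hc : ∀ ζ y u, c (translate ζ u, y) ≤ c (ζ, y) - 2 * inner ℝ (D (ζ, y)) u + ‖u‖ ^ 2)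
    {pt : ℝ} {px : Vec d} {A C h₀ : ℝ} (hA : 0 ≤ A) (hC : 0 ≤ C) (hh₀ : 0 < h₀)
    (htouch : ∀ h, 0 < h → h < h₀ → ∀ (u : Vec d) (γ' : ProbabilityMeasure (Torus d × Y)),
      (γ' : Measure (Torus d × Y)).map Prod.snd = (γ : Measure (Torus d × Y)).map Prod.snd →
      U (t + h) (translate x u) (law γ' Prod.fst measurable_fst) -
          U t x (law γ Prod.fst measurable_fst) ≤
        pt * h + inner ℝ px u + C * (h ^ 2 + ‖u‖ ^ 2) +
          A / 2 * (∫ z, c z ∂(γ' : Measure (Torus d × Y)) -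
            ∫ z, c z ∂(γ : Measure (Torus d × Y)))) :
    IsSuperdifferential U t x (law γ Prod.fst measurable_fst) pt px fun ζ => -(A • bary γ D ζ) := by
  have hpm : Measurable fun ζ => -(A • bary γ D ζ) := ((measurable_bary γ hD).const_smul A).neg
  refine ⟨MemLp.of_bound hpm.aestronglyMeasurable (A * B) (ae_of_all _ fun ζ => ?_),
    fun π hπ => ?_⟩
  · rw [norm_neg, norm_smul, Real.norm_of_nonneg hA]
    exact mul_le_mul_of_nonneg_left (norm_bary_le γ hB ζ) hA
  obtain ⟨C₁, hC₁, hrate⟩ := hπ.rate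
  have hrate' : ∀ᶠ h : ℝ in 𝓝[>] 0, planCost 2 (π h) / h < C₁ + 1 := by
    have := eventually_lt_of_limsup_lt (hrate.trans_lt
      (EReal.coe_lt_coe_iff.2 (lt_add_one C₁)))
    filter_upwards [this] with h hh using EReal.coe_lt_coe_iff.1 hh
  have hsmall : ∀ᶠ h : ℝ in 𝓝[>] 0, h < min h₀ 1 :=
    nhdsWithin_le_nhds (gt_mem_nhds (lt_min hh₀ one_pos))
  have hpos : ∀ᶠ h : ℝ in 𝓝[>] 0, 0 < h := eventually_mem_nhdsWithin
  -- The numerator of the difference quotient is at most `C₂ (h + ‖u‖) ^ 2`: the terms of first order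
  -- cancel, and `C₁` bounds the rate of the variation.
  set C₂ : ℝ := C + A / 2 * (C₁ + 1) ^ 2 with hC₂
  have hC₂0 : 0 ≤ C₂ := by positivity
  have key : ∀ᶠ z : ℝ × Vec d in 𝓝[>] 0 ×ˢ 𝓝 0,
      ((diffQuot U t x (law γ Prod.fst measurable_fst) pt px (fun ζ => -(A • bary γ D ζ)) π
        z.1 z.2 : ℝ) : EReal) ≤ ((C₂ * (z.1 + ‖z.2‖) : ℝ) : EReal) := by
    filter_upwards [(hpos.and (hsmall.and hrate')).prod_inl (𝓝 0)] with z hz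
    obtain ⟨h, u⟩ := z
    obtain ⟨h0, h1, h2⟩ : 0 < h ∧ h < min h₀ 1 ∧ planCost 2 (π h) / h < C₁ + 1 := hz
    rw [div_lt_iff₀ h0] at h2
    have hmem : h ∈ Set.Icc (0 : ℝ) 1 := ⟨h0.le, (h1.trans_le (min_le_right _ _)).le⟩
    have hfst : ((π h : Plan d) : Measure (Torus d × Torus d)).map Prod.fst =
        (γ : Measure (Torus d × Y)).map Prod.fst := congrArg Subtype.val (hπ.fst_eq h hmem)
    set Q := glue γ (π h) measurable_fst with hQ
    have hsm : Measurable fun z : (Torus d × Torus d) × Y => (z.1.2, z.2) :=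
      (measurable_snd.comp measurable_fst).prodMk measurable_snd
    have hfm : Measurable fun z : (Torus d × Torus d) × Y => (z.1.1, z.2) :=
      (measurable_fst.comp measurable_fst).prodMk measurable_snd
    let γ' : ProbabilityMeasure (Torus d × Y) :=
      ⟨Q.map fun z => (z.1.2, z.2), Measure.isProbabilityMeasure_map hsm.aemeasurable⟩
    have hγ'1 : law γ' Prod.fst measurable_fst = sndMarginal (π h) := by
      apply Subtype.ext
      change (Q.map fun z => (z.1.2, z.2)).map Prod.fst =
        ((π h : Plan d) : Measure (Torus d × Torus d)).map Prod.snd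
      rw [Measure.map_map measurable_fst hsm, ← glue_map_fst γ (π h) measurable_fst,
        Measure.map_map measurable_snd measurable_fst]
      rfl
    have hγ'2 : (γ' : Measure (Torus d × Y)).map Prod.snd =
        (γ : Measure (Torus d × Y)).map Prod.snd := by
      change (Q.map fun z => (z.1.2, z.2)).map Prod.snd = _
      rw [Measure.map_map measurable_snd hsm, ← glue_map γ (π h) measurable_fst hfst,
        Measure.map_map measurable_snd hfm]
      rfl
    have ht := htouch h h0 (h1.trans_le (min_le_left _ _)) u γ' hγ'2
    rw [hγ'1] at ht
    have e1 : ∫ z, c z ∂(γ' : Measure (Torus d × Y)) = ∫ z, c (z.1.2, z.2) ∂Q :=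
      integral_map hsm.aemeasurable hcm.aestronglyMeasurable
    have e2 : ∫ z, c z ∂(γ : Measure (Torus d × Y)) = ∫ z, c (z.1.1, z.2) ∂Q :=
      integral_glue_comp γ (π h) measurable_fst hfst hcm
    have e3 : ∫ z, inner ℝ (-(A • bary γ D z.1)) (disp z.1 z.2)
        ∂((π h : Plan d) : Measure (Torus d × Torus d)) =
        -(A * ∫ z, inner ℝ (D (z.1.1, z.2)) (disp z.1.1 z.1.2) ∂Q) := by
      rw [hQ, ← integral_inner_bary γ (π h) measurable_fst hD hB measurable_disp
        fun ω => norm_disp_le ω.1 ω.2, ← integral_const_mul, ← integral_neg]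
      simp_rw [inner_neg_left, real_inner_smul_left]
    have e4 : planCost 2 (π h) ^ 2 = ∫ z, torusDist z.1.1 z.1.2 ^ 2 ∂Q := by
      rw [planCost_sq, ← glue_map_fst γ (π h) measurable_fst]
      exact integral_map measurable_fst.aemeasurable
        ((measurable_fst.torusDist measurable_snd).pow_const 2).aestronglyMeasurable
    have i1 : Integrable (fun z : (Torus d × Torus d) × Y => c (z.1.2, z.2)) Q :=
      Integrable.of_bound (C := Bc) (hcm.comp hsm).aestronglyMeasurable
        (ae_of_all _ fun z => hBc _)
    have i2 : Integrable (fun z : (Torus d × Torus d) × Y => c (z.1.1, z.2)) Q :=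
      Integrable.of_bound (C := Bc) (hcm.comp hfm).aestronglyMeasurable
        (ae_of_all _ fun z => hBc _)
    have i3 : Integrable (fun z : (Torus d × Torus d) × Y =>
        inner ℝ (D (z.1.1, z.2)) (disp z.1.1 z.1.2)) Q := by
      refine Integrable.of_bound (C := B * torusDiam d)
        ((hD.comp hfm).inner (measurable_disp.comp measurable_fst)).aestronglyMeasurable
        (ae_of_all _ fun z => ?_)
      exact (norm_inner_le_norm _ _).trans (mul_le_mul (hB _) (norm_disp_le _ _) (norm_nonneg _)
        ((norm_nonneg _).trans (hB (z.1.1, z.2))))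
    have i4 : Integrable (fun z : (Torus d × Torus d) × Y => torusDist z.1.1 z.1.2 ^ 2) Q :=
      integrable_torusDist_sq ⟨Q, inferInstance⟩ (measurable_fst.comp measurable_fst)
        (measurable_snd.comp measurable_fst)
    have e5 : ∫ z, c z ∂(γ' : Measure (Torus d × Y)) - ∫ z, c z ∂(γ : Measure (Torus d × Y)) ≤
        -2 * (∫ z, inner ℝ (D (z.1.1, z.2)) (disp z.1.1 z.1.2) ∂Q) + planCost 2 (π h) ^ 2 := by
      rw [e1, e2, e4, ← integral_sub i1 i2, ← integral_const_mul,
        ← integral_add (i3.const_mul _) i4]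
      refine integral_mono (i1.sub i2) ((i3.const_mul _).add i4) fun z => ?_
      have := hc z.1.1 z.2 (disp z.1.1 z.1.2)
      rw [translate_disp, norm_disp] at this
      beta_reduce
      linarith
    have e6 : planCost 2 (π h) ^ 2 ≤ (C₁ + 1) ^ 2 * h ^ 2 := by
      rw [← mul_pow]
      exact pow_le_pow_left₀ (planCost_nonneg _) h2.le 2
    rw [EReal.coe_le_coe_iff]
    change diffQuot _ _ _ _ _ _ _ _ h u ≤ C₂ * (h + ‖u‖)
    have hpos' : 0 < h + ‖u‖ := add_pos_of_pos_of_nonneg h0 (norm_nonneg _)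
    rw [diffQuot, div_le_iff₀ hpos', e3]
    have e7 := mul_le_mul_of_nonneg_left e5 (show 0 ≤ A / 2 by positivity)
    have e8 := mul_le_mul_of_nonneg_left e6 (show 0 ≤ A / 2 by positivity)
    have e9 : C * (h ^ 2 + ‖u‖ ^ 2) + A / 2 * ((C₁ + 1) ^ 2 * h ^ 2) ≤
        C₂ * (h + ‖u‖) * (h + ‖u‖) := by
      have hu := norm_nonneg u
      have p1 : 0 ≤ A / 2 * (C₁ + 1) ^ 2 := by positivity
      have p2 : h ^ 2 ≤ (h + ‖u‖) ^ 2 := pow_le_pow_left₀ h0.le (by linarith) 2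
      have p3 : h ^ 2 + ‖u‖ ^ 2 ≤ (h + ‖u‖) ^ 2 := by nlinarith
      have p4 := mul_le_mul_of_nonneg_left p3 hC
      have p5 := mul_le_mul_of_nonneg_left p2 p1
      rw [hC₂]
      linarith
    linarith
  refine (limsup_le_limsup key).trans_eq (Tendsto.limsup_eq ?_)
  rw [show (0 : EReal) = ((0 : ℝ) : EReal) from rfl]
  refine EReal.tendsto_coe.2 ?_
  have hcont : Continuous fun z : ℝ × Vec d => C₂ * (z.1 + ‖z.2‖) := by fun_prop
  have := hcont.tendsto (0, 0)
  simp only [norm_zero, add_zero, mul_zero] at this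
  refine this.mono_left ?_
  rw [nhds_prod_eq]
  exact prod_mono nhdsWithin_le_nhds le_rfl

end Touching

theorem diffQuot_neg {d : ℕ} (U : ℝ → Torus d → Prob d → ℝ) (t : ℝ) (x : Torus d) (μ : Prob d)
    (pt : ℝ) (px : Vec d) (pμ : Torus d → Vec d) (π : ℝ → Plan d) (h : ℝ) (y : Vec d) :
    diffQuot (fun t x μ => -U t x μ) t x μ (-pt) (-px) (fun ζ => -pμ ζ) π h y =
      -diffQuot U t x μ pt px pμ π h y := by
  simp only [diffQuot, inner_neg_left, integral_neg]
  ring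

/-- The subdifferential of `U` is the negative of the superdifferential of `-U`. -/
theorem IsSuperdifferential.isSubdifferential {d : ℕ} {U : ℝ → Torus d → Prob d → ℝ} {t : ℝ}
    {x : Torus d} {μ : Prob d} {pt : ℝ} {px : Vec d} {pμ : Torus d → Vec d}
    (h : IsSuperdifferential (fun t x μ => -U t x μ) t x μ (-pt) (-px) fun ζ => -pμ ζ) :
    IsSubdifferential U t x μ pt px pμ := by
  have h1 := h.1.neg
  rw [show (-fun ζ => -pμ ζ) = pμ from funext fun ζ => neg_neg _] at h1
  refine ⟨h1, fun π hπ => ?_⟩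
  have h2 := h.2 π hπ
  simp_rw [diffQuot_neg, EReal.coe_neg] at h2
  have h3 := EReal.limsup_neg (f := 𝓝[>] (0 : ℝ) ×ˢ 𝓝 (0 : Vec d))
    (v := fun z : ℝ × Vec d => ((diffQuot U t x μ pt px pμ π z.1 z.2 : ℝ) : EReal))
  have h4 := h3.symm.trans_le h2
  rwa [EReal.neg_le, neg_zero] at h4

instance (d : ℕ) : StandardBorelSpace (Torus d) := by
  have : PolishSpace UnitAddCircle := inferInstance
  have : PolishSpace (Torus d) := inferInstance
  infer_instance

/-! ### Metric projections, regular velocity fields and the Hamiltonian -/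

section Projection

variable {E : Type*} [NormedAddCommGroup E] [InnerProductSpace ℝ E]

open Classical in
/-- The metric projection of `u` onto the set `K` (a point of `K` nearest to `u`, and `0` if there
is none). -/
noncomputable def metricProj (K : Set E) (u : E) : E :=
  if h : ∃ v ∈ K, ‖u - v‖ = ⨅ w : K, ‖u - w‖ then h.choose else 0

variable {K K' : Set E}

theorem metricProj_spec (hne : K.Nonempty) (hK : IsCompact K) (hc : Convex ℝ K) (u : E) :
    metricProj K u ∈ K ∧ ‖u - metricProj K u‖ = ⨅ w : K, ‖u - w‖ := by
  have h := exists_norm_eq_iInf_of_complete_convex hne hK.isComplete hc u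
  rw [metricProj, dif_pos h]
  exact h.choose_spec

theorem metricProj_inner_le (hne : K.Nonempty) (hK : IsCompact K) (hc : Convex ℝ K) (u : E) {w : E}
    (hw : w ∈ K) : inner ℝ (u - metricProj K u) (w - metricProj K u) ≤ 0 :=
  have h := metricProj_spec hne hK hc u
  (norm_eq_iInf_iff_real_inner_le_zero hc h.1).1 h.2 w hw

theorem norm_sub_metricProj_le (hne : K.Nonempty) (hK : IsCompact K) (hc : Convex ℝ K) (u : E)
    {w : E} (hw : w ∈ K) : ‖u - metricProj K u‖ ≤ ‖u - w‖ := by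
  rw [(metricProj_spec hne hK hc u).2]
  exact ciInf_le ⟨0, by rintro _ ⟨v, rfl⟩; exact norm_nonneg _⟩ (⟨w, hw⟩ : K)

theorem metricProj_eq_self (hne : K.Nonempty) (hK : IsCompact K) (hc : Convex ℝ K) {u : E}
    (hu : u ∈ K) : metricProj K u = u := by
  have := norm_sub_metricProj_le hne hK hc u hu
  rw [sub_self, norm_zero, norm_le_zero_iff, sub_eq_zero] at this
  exact this.symm

/-- The metric projection depends continuously on the point and, in the Hausdorff distance, on the
convex set. -/
theorem norm_metricProj_sub_sq_le (hne : K.Nonempty) (hK : IsCompact K) (hc : Convex ℝ K)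
    (hne' : K'.Nonempty) (hK' : IsCompact K') (hc' : Convex ℝ K') {R η : ℝ}
    (hR : ∀ a ∈ K, ‖a‖ ≤ R) (hR' : ∀ a ∈ K', ‖a‖ ≤ R)
    (h1 : ∀ a ∈ K, ∃ b ∈ K', ‖a - b‖ ≤ η) (h2 : ∀ b ∈ K', ∃ a ∈ K, ‖b - a‖ ≤ η) (u u' : E) :
    ‖metricProj K u - metricProj K' u'‖ ^ 2 ≤
      η * (‖u‖ + ‖u'‖ + 2 * R) + 2 * R * ‖u - u'‖ := by
  have ha := (metricProj_spec hne hK hc u).1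
  have hb := (metricProj_spec hne' hK' hc' u').1
  have i1 := fun w (hw : w ∈ K) => metricProj_inner_le hne hK hc u hw
  have i2 := fun w (hw : w ∈ K') => metricProj_inner_le hne' hK' hc' u' hw
  generalize metricProj K u = a at *
  generalize metricProj K' u' = b at *
  obtain ⟨b', hb', hab⟩ := h1 a ha
  obtain ⟨a', ha', hba⟩ := h2 b hb
  have hη : 0 ≤ η := (norm_nonneg _).trans hab
  have e1 : inner ℝ (u - a) (b - a) ≤ (‖u‖ + R) * η := by
    have : inner ℝ (u - a) (b - a) = inner ℝ (u - a) (b - a') + inner ℝ (u - a) (a' - a) := by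
      rw [← inner_add_right, sub_add_sub_cancel]
    rw [this]
    have h3 := real_inner_le_norm (u - a) (b - a')
    have h4 : ‖u - a‖ * ‖b - a'‖ ≤ (‖u‖ + R) * η :=
      mul_le_mul ((norm_sub_le _ _).trans (by linarith [hR a ha])) hba (norm_nonneg _)
        (add_nonneg (norm_nonneg _) ((norm_nonneg _).trans (hR a ha)))
    linarith [i1 a' ha']
  have e2 : inner ℝ (u' - b) (a - b) ≤ (‖u'‖ + R) * η := by
    have : inner ℝ (u' - b) (a - b) = inner ℝ (u' - b) (a - b') + inner ℝ (u' - b) (b' - b) := by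
      rw [← inner_add_right, sub_add_sub_cancel]
    rw [this]
    have h3 := real_inner_le_norm (u' - b) (a - b')
    have h4 : ‖u' - b‖ * ‖a - b'‖ ≤ (‖u'‖ + R) * η :=
      mul_le_mul ((norm_sub_le _ _).trans (by linarith [hR' b hb])) hab (norm_nonneg _)
        (add_nonneg (norm_nonneg _) ((norm_nonneg _).trans (hR' b hb)))
    linarith [i2 b' hb']
  have e3 : inner ℝ (u - a) (b - a) + inner ℝ (u' - b) (a - b) =
      ‖a - b‖ ^ 2 - inner ℝ (u - u') (a - b) := by
    rw [← real_inner_self_eq_norm_sq, ← inner_sub_left, ← neg_sub a b, inner_neg_right,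
      ← inner_neg_left, ← inner_add_left]
    congr 1
    abel
  have e4 : inner ℝ (u - u') (a - b) ≤ 2 * R * ‖u - u'‖ := by
    refine (real_inner_le_norm _ _).trans ?_
    rw [mul_comm]
    refine mul_le_mul_of_nonneg_right ?_ (norm_nonneg _)
    linarith [norm_sub_le a b, hR a ha, hR' b hb]
  nlinarith

end Projection

/-- What the proof uses about a set-valued velocity field on `[0, T]`: nonempty compact convex
values in a fixed ball, and uniform continuity for the Hausdorff distance. The leader's dynamics is
regarded as a field that does not depend on the second position. -/
structure RegularField {d : ℕ} (T R : ℝ) (G : ℝ → Torus d → Torus d → Prob d → Set (Vec d)) :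
    Prop where
  nonempty : ∀ t ∈ Set.Icc (0 : ℝ) T, ∀ x y θ, (G t x y θ).Nonempty
  isCompact : ∀ t ∈ Set.Icc (0 : ℝ) T, ∀ x y θ, IsCompact (G t x y θ)
  convex : ∀ t ∈ Set.Icc (0 : ℝ) T, ∀ x y θ, Convex ℝ (G t x y θ)
  bound : ∀ t ∈ Set.Icc (0 : ℝ) T, ∀ x y θ, ∀ a ∈ G t x y θ, ‖a‖ ≤ R
  unif : ∀ η > 0, ∃ ρ > 0, ∀ t ∈ Set.Icc (0 : ℝ) T, ∀ s ∈ Set.Icc (0 : ℝ) T, ∀ x x' y y' θ θ',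
    |t - s| < ρ → torusDist x x' < ρ → torusDist y y' < ρ → wassersteinDist 2 θ θ' < ρ →
      ∀ a ∈ G t x y θ, ∃ b ∈ G s x' y' θ', ‖a - b‖ ≤ η

/-- Every point of `A` has a point of `B` within the Hausdorff distance, the infimum being attained. -/
theorem exists_norm_sub_le_hausdorffDist {E : Type*} [NormedAddCommGroup E] {A B : Set E}
    (hA : IsCompact A) (hB : IsCompact B) (hB' : B.Nonempty) {a : E} (ha : a ∈ A) :
    ∃ b ∈ B, ‖a - b‖ ≤ Metric.hausdorffDist A B := by
  obtain ⟨b, hb, hab⟩ := hB.exists_infDist_eq_dist hB' a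
  refine ⟨b, hb, ?_⟩
  rw [← dist_eq_norm, ← hab]
  exact Metric.infDist_le_hausdorffDist_of_mem ha
    (Metric.hausdorffEDist_ne_top_of_nonempty_of_bounded ⟨a, ha⟩ hB' hA.isBounded hB.isBounded)

theorem FollowerAssumption.exists_norm_sub_le {d : ℕ} {T : ℝ} {k : ℝ → ℝ}
    {G : ℝ → Torus d → Torus d → Prob d → Set (Vec d)} (hG : FollowerAssumption T k G)
    {t s : ℝ} (ht : t ∈ Set.Icc (0 : ℝ) T) (hs : s ∈ Set.Icc (0 : ℝ) T) {x x' y y' : Torus d}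
    {θ θ' : Prob d} {a : Vec d} (ha : a ∈ G t x y θ) :
    ∃ b ∈ G s x' y' θ',
      ‖a - b‖ ≤ k t * (|t - s| + torusDist x x' + torusDist y y' + wassersteinDist 2 θ θ') := by
  obtain ⟨b, hb, hab⟩ := exists_norm_sub_le_hausdorffDist (hG.isCompact t ht x y θ)
    (hG.isCompact s hs x' y' θ') (hG.nonempty s hs x' y' θ') ha
  exact ⟨b, hb, hab.trans (hG.lipschitz t ht s hs _ _ _ _ _ _)⟩

/-- Only the finiteness of `k` at each time matters: comparing two nearby times with a third one, at
which `k` is bounded, and covering the compact interval `[0, T]` gives uniform continuity. -/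
theorem FollowerAssumption.regularField {d : ℕ} {T : ℝ} (hT : 0 < T) {k : ℝ → ℝ}
    {G : ℝ → Torus d → Torus d → Prob d → Set (Vec d)} (hG : FollowerAssumption T k G)
    (hk : ∀ t, 0 ≤ k t) : ∃ R, 0 ≤ R ∧ RegularField T R G := by
  have h0 : (0 : ℝ) ∈ Set.Icc (0 : ℝ) T := ⟨le_rfl, hT.le⟩
  let θ₀ : Prob d := ⟨Measure.dirac 0, inferInstance⟩
  obtain ⟨R₀, hR₀⟩ := (hG.isCompact 0 h0 0 0 θ₀).isBounded.exists_norm_le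
  refine ⟨max 0 (R₀ + k 0 * (T + 3 * torusDiam d)), le_max_left _ _, hG.nonempty, hG.isCompact,
    hG.convex, fun t ht x y θ a ha => le_max_of_le_right ?_, fun η hη => ?_⟩
  · obtain ⟨b, hb, hab⟩ := exists_norm_sub_le_hausdorffDist (hG.isCompact t ht x y θ)
      (hG.isCompact 0 h0 0 0 θ₀) (hG.nonempty 0 h0 0 0 θ₀) ha
    rw [Metric.hausdorffDist_comm] at hab
    have h1 := hab.trans (hG.lipschitz 0 h0 t ht _ _ _ _ _ _)
    have h2 : k 0 * (|0 - t| + torusDist 0 x + torusDist 0 y + wassersteinDist 2 θ₀ θ) ≤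
        k 0 * (T + 3 * torusDiam d) := by
      refine mul_le_mul_of_nonneg_left ?_ (hk 0)
      have e1 : |0 - t| ≤ T := by rw [zero_sub, abs_neg, abs_of_nonneg ht.1]; exact ht.2
      linarith [torusDist_le_torusDiam 0 x, torusDist_le_torusDiam 0 y,
        wassersteinDist_le_torusDiam θ₀ θ]
    calc ‖a‖ = ‖b + (a - b)‖ := by rw [add_sub_cancel]
      _ ≤ ‖b‖ + ‖a - b‖ := norm_add_le _ _
      _ ≤ _ := add_le_add (hR₀ b hb) (h1.trans h2)
  -- The times `t` are restricted to a set `S`, and compactness reduces the claim to small balls.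
  · refine isCompact_Icc.induction_on (s := Set.Icc (0 : ℝ) T) (p := fun S => ∃ ρ > 0, ∀ t ∈ S,
      t ∈ Set.Icc (0 : ℝ) T → ∀ s ∈ Set.Icc (0 : ℝ) T, ∀ x x' y y' θ θ',
      |t - s| < ρ → torusDist x x' < ρ → torusDist y y' < ρ → wassersteinDist 2 θ θ' < ρ →
        ∀ a ∈ G t x y θ, ∃ b ∈ G s x' y' θ', ‖a - b‖ ≤ η) ?_ ?_ ?_ ?_ |>.imp
      fun ρ h => ⟨h.1, fun t ht => h.2 t ht ht⟩
    · exact ⟨1, one_pos, fun t ht => ht.elim⟩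
    · rintro S S' hS ⟨ρ, hρ, h⟩
      exact ⟨ρ, hρ, fun t ht => h t (hS ht)⟩
    · rintro S S' ⟨ρ, hρ, h⟩ ⟨ρ', hρ', h'⟩
      refine ⟨min ρ ρ', lt_min hρ hρ', ?_⟩
      rintro t (ht | ht) ht' s hs x x' y y' θ θ' h1 h2 h3 h4
      · exact h t ht ht' s hs x x' y y' θ θ' (h1.trans_le (min_le_left _ _))
          (h2.trans_le (min_le_left _ _)) (h3.trans_le (min_le_left _ _))
          (h4.trans_le (min_le_left _ _))
      · exact h' t ht ht' s hs x x' y y' θ θ' (h1.trans_le (min_le_right _ _))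
          (h2.trans_le (min_le_right _ _)) (h3.trans_le (min_le_right _ _))
          (h4.trans_le (min_le_right _ _))
    · intro r hr
      set ρ := η / (6 * (k r + 1)) with hρ
      have hkr := hk r
      have hρ0 : 0 < ρ := by positivity
      have hkρ : k r * (6 * ρ) ≤ η := by
        have : (k r + 1) * (6 * ρ) = η := by rw [hρ]; field_simp
        nlinarith
      refine ⟨Metric.ball r ρ, mem_nhdsWithin_of_mem_nhds (Metric.ball_mem_nhds r hρ0), ρ, hρ0,
        fun t htr ht s hs x x' y y' θ θ' h1 h2 h3 h4 a ha => ?_⟩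
      rw [Metric.mem_ball, dist_comm, Real.dist_eq] at htr
      obtain ⟨c, hc, hac⟩ := exists_norm_sub_le_hausdorffDist (hG.isCompact t ht x y θ)
        (hG.isCompact r hr x y θ) (hG.nonempty r hr x y θ) ha
      rw [Metric.hausdorffDist_comm] at hac
      replace hac := hac.trans (hG.lipschitz r hr t ht _ _ _ _ _ _)
      rw [torusDist_self, torusDist_self, wassersteinDist_self] at hac
      obtain ⟨b, hb, hcb⟩ := hG.exists_norm_sub_le hr hs (x' := x') (y' := y') (θ' := θ') hc
      refine ⟨b, hb, ?_⟩
      have e1 : |r - s| < 2 * ρ := by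
        have := abs_sub_le r t s
        linarith
      have e2 := mul_le_mul_of_nonneg_left htr.le hkr
      have e3 : k r * (|r - s| + torusDist x x' + torusDist y y' + wassersteinDist 2 θ θ') ≤
          k r * (5 * ρ) := mul_le_mul_of_nonneg_left (by linarith) hkr
      have e4 := norm_sub_le_norm_sub_add_norm_sub a c b
      linarith

theorem LeaderAssumption.regularField {d : ℕ} {T : ℝ} (hT : 0 < T) {k : ℝ → ℝ}
    {F : ℝ → Torus d → Prob d → Set (Vec d)} (hF : LeaderAssumption T k F)
    (hk : ∀ t, 0 ≤ k t) : ∃ R, 0 ≤ R ∧ RegularField T R fun t x _ θ => F t x θ := by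
  refine FollowerAssumption.regularField hT (k := k) ⟨fun t ht x _ θ => hF.nonempty t ht x θ,
    fun t ht x _ θ => hF.isCompact t ht x θ, fun t ht x _ θ => hF.convex t ht x θ,
    fun t ht s hs x₁ x₂ y₁ y₂ θ₁ θ₂ => (hF.lipschitz t ht s hs x₁ x₂ θ₁ θ₂).trans ?_⟩ hk
  exact mul_le_mul_of_nonneg_left (by linarith [torusDist_nonneg y₁ y₂]) (hk t)

namespace RegularField

variable {d : ℕ} {T R : ℝ} {G : ℝ → Torus d → Torus d → Prob d → Set (Vec d)}

theorem mono (hG : RegularField T R G) {R' : ℝ} (h : R ≤ R') : RegularField T R' G :=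
  ⟨hG.nonempty, hG.isCompact, hG.convex, fun t ht x y θ a ha => (hG.bound t ht x y θ a ha).trans h,
    hG.unif⟩

theorem proj_mem (hG : RegularField T R G) {t : ℝ} (ht : t ∈ Set.Icc (0 : ℝ) T) (x y : Torus d)
    (θ : Prob d) (u : Vec d) : metricProj (G t x y θ) u ∈ G t x y θ :=
  (metricProj_spec (hG.nonempty t ht x y θ) (hG.isCompact t ht x y θ) (hG.convex t ht x y θ) u).1

theorem norm_sub_proj_le (hG : RegularField T R G) {t : ℝ} (ht : t ∈ Set.Icc (0 : ℝ) T)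
    (x y : Torus d) (θ : Prob d) (u : Vec d) {a : Vec d} (ha : a ∈ G t x y θ) :
    ‖u - metricProj (G t x y θ) u‖ ≤ ‖u - a‖ :=
  norm_sub_metricProj_le (hG.nonempty t ht x y θ) (hG.isCompact t ht x y θ)
    (hG.convex t ht x y θ) u ha

theorem proj_eq_self (hG : RegularField T R G) {t : ℝ} (ht : t ∈ Set.Icc (0 : ℝ) T)
    (x y : Torus d) (θ : Prob d) {u : Vec d} (hu : u ∈ G t x y θ) :
    metricProj (G t x y θ) u = u :=
  metricProj_eq_self (hG.nonempty t ht x y θ) (hG.isCompact t ht x y θ) (hG.convex t ht x y θ) hu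

/-- The projection onto `G t x ζ θ` depends continuously on `ζ`; this yields measurable selections
without a measurable selection theorem. -/
theorem continuous_proj (hG : RegularField T R G) {t : ℝ} (ht : t ∈ Set.Icc (0 : ℝ) T)
    (x : Torus d) (θ : Prob d) :
    Continuous fun z : Torus d × Vec d => metricProj (G t x z.1 θ) z.2 := by
  rw [continuous_iff_continuousAt]
  rintro ⟨ζ, u⟩
  have hR : 0 ≤ R := by
    obtain ⟨a, ha⟩ := hG.nonempty t ht x x θ
    exact (norm_nonneg a).trans (hG.bound t ht x x θ a ha)
  refine Metric.tendsto_nhds.2 fun ε hε => ?_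
  have hden : 0 < ‖u‖ + 1 + ‖u‖ + 2 * R := by positivity
  obtain ⟨ρ, hρ, hunif⟩ := hG.unif (ε ^ 2 / (2 * (‖u‖ + 1 + ‖u‖ + 2 * R))) (by positivity)
  have h1 : ∀ᶠ z : Torus d × Vec d in 𝓝 (ζ, u), torusDist z.1 ζ < ρ := by
    have hc : Continuous fun z : Torus d × Vec d => torusDist z.1 ζ :=
      continuous_fst.torusDist continuous_const
    refine hc.continuousAt.eventually (gt_mem_nhds ?_)
    simpa [torusDist_self] using hρ
  have h2 : ∀ᶠ z : Torus d × Vec d in 𝓝 (ζ, u),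
      2 * R * ‖z.2 - u‖ < ε ^ 2 / 2 ∧ ‖z.2 - u‖ < 1 := by
    have hc : Continuous fun z : Torus d × Vec d => 2 * R * ‖z.2 - u‖ := by fun_prop
    have hc' : Continuous fun z : Torus d × Vec d => ‖z.2 - u‖ := by fun_prop
    refine (hc.continuousAt.eventually (gt_mem_nhds ?_)).and
      (hc'.continuousAt.eventually (gt_mem_nhds ?_))
    · simp only [sub_self, norm_zero, mul_zero]; positivity
    · simp
  filter_upwards [h1, h2] with z hz1 hz2
  have hz1' : torusDist ζ z.1 < ρ := by rwa [torusDist_comm]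
  have e0 : |t - t| < ρ := by simpa using hρ
  have e1 : torusDist x x < ρ := by simpa [torusDist_self] using hρ
  have e2 : wassersteinDist 2 θ θ < ρ := by simpa [wassersteinDist_self] using hρ
  have key := norm_metricProj_sub_sq_le (hG.nonempty t ht x z.1 θ) (hG.isCompact t ht x z.1 θ)
    (hG.convex t ht x z.1 θ) (hG.nonempty t ht x ζ θ) (hG.isCompact t ht x ζ θ)
    (hG.convex t ht x ζ θ) (hG.bound t ht x z.1 θ) (hG.bound t ht x ζ θ)
    (hunif t ht t ht x x z.1 ζ θ θ e0 e1 hz1 e2) (hunif t ht t ht x x ζ z.1 θ θ e0 e1 hz1' e2)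
    z.2 u
  have h3 : ‖z.2‖ ≤ ‖u‖ + 1 := by
    have := norm_add_le u (z.2 - u)
    rw [add_sub_cancel] at this
    linarith [hz2.2]
  rw [dist_eq_norm]
  refine lt_of_pow_lt_pow_left₀ 2 hε.le (key.trans_lt ?_)
  have h4 : ε ^ 2 / (2 * (‖u‖ + 1 + ‖u‖ + 2 * R)) * (‖z.2‖ + ‖u‖ + 2 * R) ≤ ε ^ 2 / 2 := by
    calc _ ≤ ε ^ 2 / (2 * (‖u‖ + 1 + ‖u‖ + 2 * R)) * (‖u‖ + 1 + ‖u‖ + 2 * R) := by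
          gcongr
      _ = ε ^ 2 / 2 := by field_simp
  linarith [hz2.1]

theorem measurable_proj (hG : RegularField T R G) {t : ℝ} (ht : t ∈ Set.Icc (0 : ℝ) T)
    (x : Torus d) (θ : Prob d) {Ω : Type*} [MeasurableSpace Ω] {h : Ω → Torus d} {u : Ω → Vec d}
    (hh : Measurable h) (hu : Measurable u) :
    Measurable fun ω => metricProj (G t x (h ω) θ) (u ω) := by
  have := (hG.continuous_proj ht x θ).measurable.comp (hh.prodMk hu)
  exact this

end RegularField

section Hamiltonian

variable {d : ℕ} {T R : ℝ} {F : ℝ → Torus d → Prob d → Set (Vec d)}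
  {G : ℝ → Torus d → Torus d → Prob d → Set (Vec d)} {L : Torus d → Prob d → ℝ}

/-- The set whose infimum defines the Hamiltonian is bounded below, so that every measurable selection
gives an upper bound. -/
theorem hamiltonian_le (hF : RegularField T R fun t x _ θ => F t x θ) (hG : RegularField T R G)
    {t : ℝ} (ht : t ∈ Set.Icc (0 : ℝ) T) {x : Torus d} {μ : Prob d} {px v : Vec d}
    {pμ w : Torus d → Vec d} {B : ℝ} (hB : ∀ ζ, ‖pμ ζ‖ ≤ B)
    (hv : v ∈ F t x μ) (hw : Measurable w) (hwG : ∀ y, w y ∈ G t x y μ) :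
    hamiltonian F G L t x μ px pμ ≤
      L x μ + inner ℝ v px + ∫ y, inner ℝ (pμ y) (w y) ∂(μ : Measure (Torus d)) := by
  refine csInf_le ⟨L x μ - R * ‖px‖ - B * R, ?_⟩ ⟨v, w, hv, MemLp.of_bound hw.aestronglyMeasurable R
    (ae_of_all _ fun y => hG.bound t ht x y μ _ (hwG y)), ae_of_all _ hwG, rfl⟩
  rintro _ ⟨v', w', hv', -, hw', rfl⟩
  have h1 : |inner ℝ v' px| ≤ R * ‖px‖ := (abs_real_inner_le_norm _ _).trans
    (mul_le_mul_of_nonneg_right (hF.bound t ht x x μ _ hv') (norm_nonneg _))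
  have h2 : ‖∫ y, inner ℝ (pμ y) (w' y) ∂(μ : Measure (Torus d))‖ ≤ B * R := by
    refine (norm_integral_le_of_norm_le_const (C := B * R) ?_).trans_eq (by simp)
    filter_upwards [hw'] with y hy
    exact (norm_inner_le_norm _ _).trans (mul_le_mul (hB y) (hG.bound t ht x y μ _ hy)
      (norm_nonneg _) ((norm_nonneg _).trans (hB y)))
  rw [Real.norm_eq_abs] at h2
  linarith [(abs_le.1 h1).1, (abs_le.1 h2).1]

/-- An almost minimizing control whose followers' velocity is Borel measurable and admissible
everywhere, not just almost everywhere: one projects a measurable representative onto the values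
of `G`. -/
theorem exists_of_hamiltonian_lt (hF : RegularField T R fun t x _ θ => F t x θ)
    (hG : RegularField T R G) {t : ℝ} (ht : t ∈ Set.Icc (0 : ℝ) T) {x : Torus d} {μ : Prob d}
    {px : Vec d} {pμ : Torus d → Vec d} {r : ℝ} (h : hamiltonian F G L t x μ px pμ < r) :
    ∃ v ∈ F t x μ, ∃ w : Torus d → Vec d, Measurable w ∧ (∀ y, w y ∈ G t x y μ) ∧
      L x μ + inner ℝ v px + ∫ y, inner ℝ (pμ y) (w y) ∂(μ : Measure (Torus d)) < r := by
  have hproj : ∀ u : Torus d → Vec d, Measurable u →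
      Measurable fun y => metricProj (G t x y μ) (u y) := fun u hu =>
    hG.measurable_proj ht x μ measurable_id hu
  obtain ⟨_, ⟨v, w, hv, hw, hwG, rfl⟩, hr⟩ := exists_lt_of_csInf_lt (by
    obtain ⟨v, hv⟩ := hF.nonempty t ht x x μ
    refine ⟨_, v, fun y => metricProj (G t x y μ) 0, hv, ?_,
      ae_of_all _ fun y => hG.proj_mem ht x y μ 0, rfl⟩
    exact MemLp.of_bound (hproj _ measurable_const).aestronglyMeasurable R
      (ae_of_all _ fun y => hG.bound t ht x y μ _ (hG.proj_mem ht x y μ 0))) h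
  have hm := hw.1.stronglyMeasurable_mk.measurable
  refine ⟨v, hv, fun y => metricProj (G t x y μ) (hw.1.mk w y), hproj _ hm,
    fun y => hG.proj_mem ht x y μ _, ?_⟩
  rwa [integral_congr_ae (g := fun y => inner ℝ (pμ y) (w y))]
  filter_upwards [hw.1.ae_eq_mk, hwG] with y hy hyG
  rw [← hy, hG.proj_eq_self ht x y μ hyG]

end Hamiltonian

/-! ### Doubling of variables along a particle system -/

/-- The Cauchy-Schwarz inequality in `L²`, for bounded fields. -/
theorem abs_integral_inner_le {Ω : Type*} [MeasurableSpace Ω] (P : ProbabilityMeasure Ω) {d : ℕ}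
    {f g : Ω → Vec d} (hf : Measurable f) (hg : Measurable g) {B B' : ℝ}
    (hB : ∀ ω, ‖f ω‖ ≤ B) (hB' : ∀ ω, ‖g ω‖ ≤ B') {α β : ℝ} (hα : 0 ≤ α) (hβ : 0 ≤ β)
    (h1 : ∫ ω, ‖f ω‖ ^ 2 ∂(P : Measure Ω) ≤ α ^ 2)
    (h2 : ∫ ω, ‖g ω‖ ^ 2 ∂(P : Measure Ω) ≤ β ^ 2) :
    |∫ ω, inner ℝ (f ω) (g ω) ∂(P : Measure Ω)| ≤ α * β := by
  have hmf : MemLp f (ENNReal.ofReal 2) (P : Measure Ω) :=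
    MemLp.of_bound hf.aestronglyMeasurable B (ae_of_all _ hB)
  have hmg : MemLp g (ENNReal.ofReal 2) (P : Measure Ω) :=
    MemLp.of_bound hg.aestronglyMeasurable B' (ae_of_all _ hB')
  have h := integral_mul_norm_le_Lp_mul_Lq (μ := (P : Measure Ω)) (f := f) (g := g)
    (p := 2) (q := 2) (Real.HolderConjugate.two_two) hmf hmg
  simp only [Real.rpow_two] at h
  rw [← Real.sqrt_eq_rpow, ← Real.sqrt_eq_rpow] at h
  calc |∫ ω, inner ℝ (f ω) (g ω) ∂(P : Measure Ω)|
      ≤ ∫ ω, ‖f ω‖ * ‖g ω‖ ∂(P : Measure Ω) := by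
        rw [← Real.norm_eq_abs]
        refine norm_integral_le_of_norm_le ?_ (ae_of_all _ fun ω => norm_inner_le_norm _ _)
        refine Integrable.of_bound (C := B * B')
          (hf.norm.mul hg.norm).aestronglyMeasurable (ae_of_all _ fun ω => ?_)
        rw [Real.norm_of_nonneg (by positivity)]
        exact mul_le_mul (hB ω) (hB' ω) (norm_nonneg _) ((norm_nonneg _).trans (hB ω))
    _ ≤ _ := h
    _ ≤ α * β := mul_le_mul (Real.sqrt_le_iff.2 ⟨hα, h1⟩) (Real.sqrt_le_iff.2 ⟨hβ, h2⟩)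
        (Real.sqrt_nonneg _) hα

/-- `V` is Lipschitz on `[0, T] × 𝕋ᵈ × 𝒫(𝕋ᵈ)` with the constant `K`. -/
def LipWith {d : ℕ} (T K : ℝ) (V : ℝ → Torus d → Prob d → ℝ) : Prop :=
  ∀ t ∈ Set.Icc (0 : ℝ) T, ∀ s ∈ Set.Icc (0 : ℝ) T, ∀ x₁ x₂ μ₁ μ₂,
    |V t x₁ μ₁ - V s x₂ μ₂| ≤ K * (|t - s| + torusDist x₁ x₂ + wassersteinDist 2 μ₁ μ₂)

theorem BoundedLipschitz.exists_lipWith {d : ℕ} {T : ℝ} {V : ℝ → Torus d → Prob d → ℝ}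
    (h : BoundedLipschitz T V) : ∃ K, 0 ≤ K ∧ LipWith T K V := by
  obtain ⟨K, hK⟩ := h.lipschitz
  refine ⟨max K 0, le_max_right _ _, fun t ht s hs x₁ x₂ μ₁ μ₂ => (hK t ht s hs _ _ _ _).trans ?_⟩
  exact mul_le_mul_of_nonneg_right (le_max_left _ _) (add_nonneg (add_nonneg (abs_nonneg _)
    (torusDist_nonneg _ _)) (wassersteinDist_nonneg _ _))

theorem LipWith.mono {d : ℕ} {T K K' : ℝ} {V : ℝ → Torus d → Prob d → ℝ} (h : LipWith T K V)
    (hK : K ≤ K') : LipWith T K' V := fun t ht s hs x₁ x₂ μ₁ μ₂ =>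
  (h t ht s hs x₁ x₂ μ₁ μ₂).trans (mul_le_mul_of_nonneg_right hK (add_nonneg (add_nonneg
    (abs_nonneg _) (torusDist_nonneg _ _)) (wassersteinDist_nonneg _ _)))

/-- Continuity for the narrow topology on measures, not only for the Wasserstein distance. -/
theorem LipWith.continuousOn {d : ℕ} {T K : ℝ} {V : ℝ → Torus d → Prob d → ℝ}
    (h : LipWith T K V) {S : Type*} [TopologicalSpace S] {D : Set S} {τ : S → ℝ}
    {f : S → Torus d} {θ : S → Prob d} (hτ : Continuous τ) (hf : Continuous f) (hθ : Continuous θ)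
    (hD : ∀ s ∈ D, τ s ∈ Set.Icc (0 : ℝ) T) :
    ContinuousOn (fun s => V (τ s) (f s) (θ s)) D := by
  intro s hs
  have h1 : Continuous fun μ => V (τ s) (f s) μ :=
    continuous_of_wassersteinDist_le (K := K) fun μ ν => by
      simpa [torusDist_self] using h _ (hD s hs) _ (hD s hs) (f s) (f s) μ ν
  have h2 : Tendsto (fun r => K * (|τ r - τ s| + torusDist (f r) (f s)) +
      |V (τ s) (f s) (θ r) - V (τ s) (f s) (θ s)|) (𝓝[D] s) (𝓝 0) := by
    have hc : Continuous fun r => K * (|τ r - τ s| + torusDist (f r) (f s)) +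
        |V (τ s) (f s) (θ r) - V (τ s) (f s) (θ s)| :=
      (continuous_const.mul (((hτ.sub continuous_const).abs).add
        (hf.torusDist continuous_const))).add ((h1.comp hθ).sub continuous_const).abs
    have := (hc.tendsto s).mono_left (nhdsWithin_le_nhds (s := D))
    simpa [torusDist_self] using this
  rw [ContinuousWithinAt, tendsto_iff_dist_tendsto_zero]
  refine squeeze_zero' (Eventually.of_forall fun _ => dist_nonneg) ?_ h2
  filter_upwards [self_mem_nhdsWithin] with r hr
  rw [Real.dist_eq]
  have h3 := h _ (hD r hr) _ (hD s hs) (f r) (f s) (θ r) (θ r)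
  rw [wassersteinDist_self, add_zero] at h3
  have h4 := abs_sub_le (V (τ r) (f r) (θ r)) (V (τ s) (f s) (θ r)) (V (τ s) (f s) (θ s))
  linarith

theorem continuous_law {d : ℕ} {X : Type*} [TopologicalSpace X] [MeasurableSpace X]
    [OpensMeasurableSpace X] {f : X → Torus d} (hf : Continuous f) :
    Continuous fun γ : ProbabilityMeasure X => law γ f hf.measurable :=
  ProbabilityMeasure.continuous_map hf

theorem translate_add_smul {d : ℕ} (x : Torus d) (v : Vec d) (s h : ℝ) :
    translate x ((s + h) • v) = translate (translate x (s • v)) (h • v) := by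
  rw [add_smul, translate_add]

theorem continuous_particle {d : ℕ} {I : Type*} [TopologicalSpace I] [DiscreteTopology I]
    (z : I → Torus d) (w : I → Vec d) :
    Continuous fun y : ℝ × (Torus d × I) => translate (z y.2.2) (y.1 • w y.2.2) := by
  have hz : Continuous fun y : ℝ × (Torus d × I) => z y.2.2 :=
    (continuous_of_discreteTopology (f := z)).comp (continuous_snd.comp continuous_snd)
  have hw : Continuous fun y : ℝ × (Torus d × I) => w y.2.2 :=
    (continuous_of_discreteTopology (f := w)).comp (continuous_snd.comp continuous_snd)
  exact hz.translate (continuous_fst.smul hw)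

section FiniteSystem

variable {d : ℕ} {I : Type*} [TopologicalSpace I] [DiscreteTopology I] [MeasurableSpace I]
  [BorelSpace I]

/-- The distribution at time `s` of particles of masses `m i` that leave the points `z i` at time `0`
with constant velocities `w i`. -/
noncomputable def particles (m : ProbabilityMeasure I) (z : I → Torus d) (w : I → Vec d) (s : ℝ) :
    Prob d :=
  law m (fun i => translate (z i) (s • w i)) (continuous_of_discreteTopology.measurable)

/-- The squared distance of `(t, x', γ)` to the configuration at time `s` of a leader with trajectory
`s ↦ translate x (s • v)` and of the particles, measured along the coupling `γ`. -/
noncomputable def penalty (z : I → Torus d) (w : I → Vec d) (x : Torus d) (v : Vec d)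
    (t : ℝ) (x' : Torus d) (s : ℝ) (γ : ProbabilityMeasure (Torus d × I)) : ℝ :=
  (t - s) ^ 2 + torusDist x' (translate x (s • v)) ^ 2 +
    ∫ y, torusDist y.1 (translate (z y.2) (s • w y.2)) ^ 2 ∂(γ : Measure (Torus d × I))

theorem measurable_particle (z : I → Torus d) (w : I → Vec d) (s : ℝ) :
    Measurable fun i => translate (z i) (s • w i) :=
  continuous_of_discreteTopology.measurable

variable {T K : ℝ} {V : ℝ → Torus d → Prob d → ℝ}

/-- The doubled functional attains its maximum over `t ∈ [0, T]`, `s ∈ [a, b]` and couplings. -/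
theorem exists_max_penalized [Finite I] (hV : LipWith T K V) (hT : 0 ≤ T) {a b : ℝ} (hab : a ≤ b)
    (m : ProbabilityMeasure I) (z : I → Torus d) (w : I → Vec d) (x : Torus d) (v : Vec d)
    (M A : ℝ) :
    ∃ t ∈ Set.Icc (0 : ℝ) T, ∃ x', ∃ s ∈ Set.Icc a b, ∃ γ : ProbabilityMeasure (Torus d × I),
      (γ : Measure (Torus d × I)).map Prod.snd = m ∧
      ∀ t₁ ∈ Set.Icc (0 : ℝ) T, ∀ x₁, ∀ s₁ ∈ Set.Icc a b,
        ∀ γ₁ : ProbabilityMeasure (Torus d × I), (γ₁ : Measure (Torus d × I)).map Prod.snd = m →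
        V t₁ x₁ (law γ₁ Prod.fst measurable_fst) + M * s₁ - A / 2 * penalty z w x v t₁ x₁ s₁ γ₁ ≤
          V t x' (law γ Prod.fst measurable_fst) + M * s - A / 2 * penalty z w x v t x' s γ := by
  let S := ℝ × Torus d × ℝ × ProbabilityMeasure (Torus d × I)
  let k : Set (ProbabilityMeasure (Torus d × I)) :=
    {γ | γ.map measurable_snd.aemeasurable = m}
  have hk : IsCompact k := IsClosed.isCompact
    (isClosed_eq (ProbabilityMeasure.continuous_map continuous_snd) continuous_const)
  let D : Set S := Set.Icc (0 : ℝ) T ×ˢ (Set.univ ×ˢ (Set.Icc a b ×ˢ k))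
  have hD : IsCompact D := isCompact_Icc.prod (isCompact_univ.prod (isCompact_Icc.prod hk))
  have hmem : ∀ γ : ProbabilityMeasure (Torus d × I),
      γ ∈ k ↔ (γ : Measure (Torus d × I)).map Prod.snd = m := fun γ =>
    ⟨fun h => congrArg Subtype.val h, fun h => Subtype.ext h⟩
  have h1 : ContinuousOn (fun p : S => V p.1 p.2.1 (law p.2.2.2 Prod.fst measurable_fst)) D :=
    hV.continuousOn continuous_fst (continuous_fst.comp continuous_snd)
      ((continuous_law (d := d) (X := Torus d × I) continuous_fst).comp
        (continuous_snd.comp (continuous_snd.comp continuous_snd))) fun p hp => hp.1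
  have h2 : Continuous fun p : S => penalty z w x v p.1 p.2.1 p.2.2.1 p.2.2.2 := by
    unfold penalty
    have e1 : Continuous fun p : S => (p.1 - p.2.2.1) ^ 2 := by fun_prop
    have e2 : Continuous fun p : S => translate x (p.2.2.1 • v) :=
      continuous_const.translate (by fun_prop)
    have e3 : Continuous fun p : S => torusDist p.2.1 (translate x (p.2.2.1 • v)) ^ 2 :=
      ((continuous_fst.comp continuous_snd).torusDist e2).pow 2
    have e4 : Continuous fun y : ℝ × (Torus d × I) =>
        torusDist y.2.1 (translate (z y.2.2) (y.1 • w y.2.2)) ^ 2 :=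
      ((continuous_fst.comp continuous_snd).torusDist (continuous_particle z w)).pow 2
    have e5 := (continuous_integral_param (X := Torus d × I) (S := ℝ)
      (c := fun s y => torusDist y.1 (translate (z y.2) (s • w y.2)) ^ 2) e4).comp
      (f := fun p : S => (p.2.2.1, p.2.2.2)) (by fun_prop)
    exact (e1.add e3).add e5
  have hΦ : ContinuousOn (fun p : S => V p.1 p.2.1 (law p.2.2.2 Prod.fst measurable_fst) +
      M * p.2.2.1 - A / 2 * penalty z w x v p.1 p.2.1 p.2.2.1 p.2.2.2) D := by
    refine (h1.add ?_).sub (continuous_const.mul h2).continuousOn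
    exact (Continuous.continuousOn (by fun_prop))
  have hpm : Measurable fun i : I => ((0 : Torus d), i) := measurable_const.prodMk measurable_id
  let γ₀ : ProbabilityMeasure (Torus d × I) := m.map hpm.aemeasurable
  have hne : D.Nonempty := by
    refine ⟨(0, 0, a, γ₀), ⟨le_rfl, hT⟩, trivial, ⟨le_rfl, hab⟩, (hmem _).2 ?_⟩
    change ((m : Measure I).map _).map Prod.snd = (m : Measure I)
    rw [Measure.map_map measurable_snd hpm]
    exact Measure.map_id
  obtain ⟨⟨t, x', s, γ⟩, ⟨ht, -, hs, hγ⟩, hmax⟩ := hD.exists_isMaxOn hne hΦ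
  refine ⟨t, ht, x', s, hs, γ, (hmem γ).1 hγ, fun t₁ ht₁ x₁ s₁ hs₁ γ₁ hγ₁ => ?_⟩
  exact hmax (a := (t₁, x₁, s₁, γ₁)) ⟨ht₁, trivial, hs₁, (hmem γ₁).2 hγ₁⟩

/-- First-order condition of the doubled functional with respect to `s`, for forward variations. -/
theorem penalized_first_order {z : I → Torus d} {w : I → Vec d}
    {x : Torus d} {v : Vec d} {M A R : ℝ} (hA : 0 ≤ A) (hv : ‖v‖ ≤ R) (hw : ∀ i, ‖w i‖ ≤ R)
    {t : ℝ} {x' : Torus d} {s b : ℝ} (hsb : s < b) {γ : ProbabilityMeasure (Torus d × I)}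
    (hmax : ∀ s₁, s < s₁ → s₁ < b → M * s₁ - A / 2 * penalty z w x v t x' s₁ γ ≤
      M * s - A / 2 * penalty z w x v t x' s γ) :
    M + A * (t - s) - A * inner ℝ (disp x' (translate x (s • v))) v -
      A * ∫ y, inner ℝ (disp y.1 (translate (z y.2) (s • w y.2))) (w y.2)
        ∂(γ : Measure (Torus d × I)) ≤ 0 := by
  set E := M + A * (t - s) - A * inner ℝ (disp x' (translate x (s • v))) v -
      A * ∫ y, inner ℝ (disp y.1 (translate (z y.2) (s • w y.2))) (w y.2)
        ∂(γ : Measure (Torus d × I)) with hE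
  have hw' : Measurable fun y : Torus d × I => w y.2 :=
    (continuous_of_discreteTopology (f := w)).measurable.comp measurable_snd
  have hZ : Measurable fun y : Torus d × I => translate (z y.2) (s • w y.2) :=
    (measurable_particle z w s).comp measurable_snd
  have i1 : Integrable (fun y : Torus d × I => torusDist y.1 (translate (z y.2) (s • w y.2)) ^ 2)
      (γ : Measure (Torus d × I)) := integrable_torusDist_sq γ measurable_fst hZ
  have i2 : Integrable (fun y : Torus d × I =>
      inner ℝ (disp y.1 (translate (z y.2) (s • w y.2))) (w y.2))
      (γ : Measure (Torus d × I)) := by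
    refine Integrable.of_bound (C := torusDiam d * R)
      ((measurable_disp.comp (measurable_fst.prodMk hZ)).inner hw').aestronglyMeasurable
      (ae_of_all _ fun y => ?_)
    exact (norm_inner_le_norm _ _).trans (mul_le_mul (norm_disp_le _ _) (hw _) (norm_nonneg _)
      (torusDiam_nonneg d))
  have key : ∀ h, 0 < h → h < b - s → E ≤ A / 2 * (1 + 2 * R ^ 2) * h := by
    intro h h0 hb
    have hm := hmax (s + h) (by linarith) (by linarith)
    have p1 := torusDist_translate_right_sq x' (translate x (s • v)) (h • v)
    rw [← translate_add_smul, real_inner_smul_right, norm_smul, Real.norm_of_nonneg h0.le] at p1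
    have p2 : ∫ y, torusDist y.1 (translate (z y.2) ((s + h) • w y.2)) ^ 2
        ∂(γ : Measure (Torus d × I)) ≤
        (∫ y, torusDist y.1 (translate (z y.2) (s • w y.2)) ^ 2 ∂(γ : Measure (Torus d × I))) +
        2 * h * (∫ y, inner ℝ (disp y.1 (translate (z y.2) (s • w y.2))) (w y.2)
          ∂(γ : Measure (Torus d × I))) + h ^ 2 * R ^ 2 := by
      have : h ^ 2 * R ^ 2 = ∫ _, h ^ 2 * R ^ 2 ∂(γ : Measure (Torus d × I)) := by simp
      have i3 : Integrable (fun y : Torus d × I =>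
          torusDist y.1 (translate (z y.2) (s • w y.2)) ^ 2 +
            2 * h * inner ℝ (disp y.1 (translate (z y.2) (s • w y.2))) (w y.2))
          (γ : Measure (Torus d × I)) := i1.add (i2.const_mul _)
      rw [this, ← integral_const_mul, ← integral_add i1 (i2.const_mul _),
        ← integral_add i3 (integrable_const _)]
      refine integral_mono (integrable_torusDist_sq γ measurable_fst
        ((measurable_particle z w _).comp measurable_snd))
        (i3.add (integrable_const _)) fun y => ?_
      have q := torusDist_translate_right_sq y.1 (translate (z y.2) (s • w y.2)) (h • w y.2)
      rw [← translate_add_smul, real_inner_smul_right, norm_smul, Real.norm_of_nonneg h0.le,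
        mul_pow] at q
      have q2 : h ^ 2 * ‖w y.2‖ ^ 2 ≤ h ^ 2 * R ^ 2 := by
        gcongr
        exact hw _
      beta_reduce
      linarith
    have p3 : (h * ‖v‖) ^ 2 ≤ h ^ 2 * R ^ 2 := by
      rw [mul_pow]
      gcongr
    simp only [penalty] at hm
    have p4 : penalty z w x v t x' (s + h) γ - penalty z w x v t x' s γ ≤
        -2 * h * (t - s) + h ^ 2 + 2 * h * inner ℝ (disp x' (translate x (s • v))) v +
        2 * h * (∫ y, inner ℝ (disp y.1 (translate (z y.2) (s • w y.2))) (w y.2)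
          ∂(γ : Measure (Torus d × I))) + 2 * (h ^ 2 * R ^ 2) := by
      simp only [penalty]
      nlinarith
    have p5 := mul_le_mul_of_nonneg_left p4 (show 0 ≤ A / 2 by positivity)
    simp only [penalty] at p5
    refine le_of_mul_le_mul_right (a := h) ?_ h0
    rw [hE]
    linarith
  by_contra! hpos
  have hc : 0 ≤ A / 2 * (1 + 2 * R ^ 2) := by positivity
  obtain ⟨h, h0, h1, h2⟩ : ∃ h, 0 < h ∧ h < b - s ∧ A / 2 * (1 + 2 * R ^ 2) * h < E := by
    have hlim : Tendsto (fun h => A / 2 * (1 + 2 * R ^ 2) * h) (𝓝[>] 0) (𝓝 0) := by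
      have : Continuous fun h : ℝ => A / 2 * (1 + 2 * R ^ 2) * h := by fun_prop
      simpa using (this.tendsto 0).mono_left nhdsWithin_le_nhds
    have e1 := hlim.eventually (gt_mem_nhds hpos)
    have e2 : ∀ᶠ h : ℝ in 𝓝[>] 0, h < b - s :=
      nhdsWithin_le_nhds (gt_mem_nhds (sub_pos.2 hsb))
    obtain ⟨h, ⟨e1, e2⟩, e3⟩ := ((e1.and e2).and self_mem_nhdsWithin).exists
    exact ⟨h, e3, e2, e1⟩
  linarith [key h h0 h1]

/-- The doubled functional touches `V` from above. -/
theorem penalized_superdifferential [Finite I] [Nonempty I] {m : ProbabilityMeasure I}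
    {z : I → Torus d} {w : I → Vec d} {x : Torus d} {v : Vec d} {A : ℝ} (hA : 0 ≤ A)
    {t : ℝ} (ht : 0 ≤ t) (htT : t < T) {x' : Torus d} {s : ℝ}
    {γ : ProbabilityMeasure (Torus d × I)} (hγ : (γ : Measure (Torus d × I)).map Prod.snd = m)
    (hmax : ∀ t₁ ∈ Set.Icc (0 : ℝ) T, ∀ x₁, ∀ γ₁ : ProbabilityMeasure (Torus d × I),
      (γ₁ : Measure (Torus d × I)).map Prod.snd = m →
      V t₁ x₁ (law γ₁ Prod.fst measurable_fst) - A / 2 * penalty z w x v t₁ x₁ s γ₁ ≤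
        V t x' (law γ Prod.fst measurable_fst) - A / 2 * penalty z w x v t x' s γ) :
    IsSuperdifferential V t x' (law γ Prod.fst measurable_fst) (A * (t - s))
      (-(A • disp x' (translate x (s • v)))) fun ζ =>
        -(A • bary γ (fun y => disp y.1 (translate (z y.2) (s • w y.2))) ζ) := by
  have hZ : Measurable fun y : Torus d × I => translate (z y.2) (s • w y.2) :=
    (measurable_particle z w s).comp measurable_snd
  have hD : Measurable fun y : Torus d × I => disp y.1 (translate (z y.2) (s • w y.2)) :=
    (measurable_disp (d := d)).comp (measurable_fst.prodMk hZ)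
  refine isSuperdifferential_of_touching V t x' γ hD (B := torusDiam d)
    (fun y => norm_disp_le _ _)
    (c := fun y => torusDist y.1 (translate (z y.2) (s • w y.2)) ^ 2)
    ((measurable_fst.torusDist hZ).pow_const 2) (Bc := torusDiam d ^ 2) (fun y => ?_)
    (fun ζ y u => torusDist_translate_left_sq _ _ _) (C := A / 2) (h₀ := T - t) hA
    (by positivity) (sub_pos.2 htT) fun h h0 hh u γ' hγ' => ?_
  · rw [Real.norm_of_nonneg (by positivity)]
    exact pow_le_pow_left₀ (torusDist_nonneg _ _) (torusDist_le_torusDiam _ _) 2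
  have hm := hmax (t + h) ⟨by linarith, by linarith⟩ (translate x' u) γ' (hγ'.trans hγ)
  have p1 := mul_le_mul_of_nonneg_left
    (torusDist_translate_left_sq x' (translate x (s • v)) u) (show 0 ≤ A / 2 by positivity)
  simp only [penalty] at hm
  rw [inner_neg_left, real_inner_smul_left]
  nlinarith

end FiniteSystem

/-! ### Monotonicity along particle systems without collisions -/

section FiniteSystem

variable {d : ℕ} {I : Type*} [TopologicalSpace I] [DiscreteTopology I] [MeasurableSpace I]
  [BorelSpace I]

theorem law_comp {Ω Ω' : Type*} [MeasurableSpace Ω] [MeasurableSpace Ω'] (P : ProbabilityMeasure Ω)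
    (Q : ProbabilityMeasure Ω') {g : Ω → Ω'} (hg : Measurable g) (h : (P : Measure Ω).map g = Q)
    {f : Ω' → Torus d} (hf : Measurable f) :
    law P (fun ω => f (g ω)) (hf.comp hg) = law Q f hf := by
  apply Subtype.ext
  change (P : Measure Ω).map (f ∘ g) = (Q : Measure Ω').map f
  rw [← h, Measure.map_map hf hg]

/-- The coupling of the particles at time `s` with their own indices. -/
noncomputable def selfCoupling (m : ProbabilityMeasure I) (z : I → Torus d) (w : I → Vec d)
    (s : ℝ) : ProbabilityMeasure (Torus d × I) :=
  m.map (f := fun i => (translate (z i) (s • w i), i))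
    ((measurable_particle z w s).prodMk measurable_id).aemeasurable

theorem selfCoupling_snd (m : ProbabilityMeasure I) (z : I → Torus d) (w : I → Vec d) (s : ℝ) :
    (selfCoupling m z w s : Measure (Torus d × I)).map Prod.snd = m := by
  change ((m : Measure I).map _).map Prod.snd = (m : Measure I)
  have hp : Measurable fun i : I => (translate (z i) (s • w i), i) :=
    (measurable_particle z w s).prodMk measurable_id
  rw [Measure.map_map measurable_snd hp]
  exact Measure.map_id

theorem law_selfCoupling (m : ProbabilityMeasure I) (z : I → Torus d) (w : I → Vec d) (s : ℝ) :
    law (selfCoupling m z w s) Prod.fst measurable_fst = particles m z w s := by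
  apply Subtype.ext
  change ((m : Measure I).map _).map Prod.fst = (m : Measure I).map _
  have hp : Measurable fun i : I => (translate (z i) (s • w i), i) :=
    (measurable_particle z w s).prodMk measurable_id
  rw [Measure.map_map measurable_fst hp]
  rfl

theorem penalty_selfCoupling (m : ProbabilityMeasure I) (z : I → Torus d) (w : I → Vec d)
    (x : Torus d) (v : Vec d) (s : ℝ) :
    penalty z w x v s (translate x (s • v)) s (selfCoupling m z w s) = 0 := by
  have h : ∫ y, torusDist y.1 (translate (z y.2) (s • w y.2)) ^ 2
      ∂(selfCoupling m z w s : Measure (Torus d × I)) = 0 := by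
    have h1 := (measurable_particle z w s).prodMk (measurable_id (α := I))
    refine (integral_map h1.aemeasurable ?_).trans ?_
    · exact ((measurable_fst.torusDist
        ((measurable_particle z w s).comp measurable_snd)).pow_const 2).aestronglyMeasurable
    · simp [torusDist_self]
  rw [penalty, h, torusDist_self]
  simp

/-- All distances between the two configurations are controlled by the square root `q` of the
penalty. -/
theorem penalty_bounds {m : ProbabilityMeasure I} (z : I → Torus d) (w : I → Vec d)
    (x : Torus d) (v : Vec d) (t : ℝ) (x' : Torus d) (s : ℝ)
    {γ : ProbabilityMeasure (Torus d × I)} (hγ : (γ : Measure (Torus d × I)).map Prod.snd = m) :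
    ∃ q, 0 ≤ q ∧ penalty z w x v t x' s γ = q ^ 2 ∧ |t - s| ≤ q ∧
      torusDist x' (translate x (s • v)) ≤ q ∧
      wassersteinDist 2 (law γ Prod.fst measurable_fst) (particles m z w s) ≤ q ∧
      ∫ y, torusDist y.1 (translate (z y.2) (s • w y.2)) ^ 2 ∂(γ : Measure (Torus d × I)) ≤
        q ^ 2 := by
  have h1 : 0 ≤ (t - s) ^ 2 := sq_nonneg _
  have h2 : 0 ≤ torusDist x' (translate x (s • v)) ^ 2 := sq_nonneg _
  have h3 : 0 ≤ ∫ y, torusDist y.1 (translate (z y.2) (s • w y.2)) ^ 2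
      ∂(γ : Measure (Torus d × I)) := integral_nonneg fun y => sq_nonneg _
  have h0 : 0 ≤ penalty z w x v t x' s γ := add_nonneg (add_nonneg h1 h2) h3
  have hm : Measurable fun y : Torus d × I => translate (z y.2) (s • w y.2) :=
    (measurable_particle z w s).comp measurable_snd
  refine ⟨Real.sqrt (penalty z w x v t x' s γ), Real.sqrt_nonneg _, (Real.sq_sqrt h0).symm, ?_, ?_,
    ?_, ?_⟩
  · refine Real.le_sqrt_of_sq_le ?_
    rw [sq_abs, penalty]
    linarith
  · refine Real.le_sqrt_of_sq_le ?_
    rw [penalty]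
    linarith
  · have h4 : law γ (fun y => translate (z y.2) (s • w y.2)) hm = particles m z w s :=
      law_comp γ m measurable_snd hγ (measurable_particle z w s)
    rw [← h4]
    refine (wassersteinDist_law_le γ measurable_fst hm).trans (Real.sqrt_le_sqrt ?_)
    rw [penalty]
    linarith
  · rw [Real.sq_sqrt h0, penalty]
    linarith

variable {T K R : ℝ} {V : ℝ → Torus d → Prob d → ℝ} {F : ℝ → Torus d → Prob d → Set (Vec d)}
  {G : ℝ → Torus d → Torus d → Prob d → Set (Vec d)} {L : Torus d → Prob d → ℝ}

/-- Away from collisions the velocity of a particle is a function of its position, up to a small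
error, and this function can be chosen as a selection of `G`: near the position `Z i` of the `i`-th
particle one projects its velocity `w i` onto `G`. -/
theorem exists_selection {J : Type*} [Finite J] (hG : RegularField T R G) {t : ℝ}
    (ht : t ∈ Set.Icc (0 : ℝ) T) (x : Torus d) (μ : Prob d) (Z : J → Torus d) (w : J → Vec d)
    (hw : ∀ i, ‖w i‖ ≤ R) {r ε : ℝ} (hr : 0 < r)
    (hZ : ∀ i j, i ≠ j → 2 * r ≤ torusDist (Z i) (Z j))
    (hε : ∀ ζ i, torusDist ζ (Z i) < r → ∃ a ∈ G t x ζ μ, ‖w i - a‖ ≤ ε) :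
    ∃ u : Torus d → Vec d, Measurable u ∧ (∀ ζ, u ζ ∈ G t x ζ μ) ∧
      ∀ ζ i, ‖u ζ - w i‖ ^ 2 ≤ ε ^ 2 + (2 * R / r) ^ 2 * torusDist ζ (Z i) ^ 2 := by
  classical
  have := Fintype.ofFinite J
  let u₀ : Torus d → Vec d := fun ζ => ∑ i, if torusDist ζ (Z i) < r then w i else 0
  have hu₀ : Measurable u₀ := Finset.measurable_sum _ fun i _ =>
    Measurable.ite (measurableSet_lt (measurable_id.torusDist measurable_const) measurable_const)
      measurable_const measurable_const
  have hu₀' : ∀ ζ i, torusDist ζ (Z i) < r → u₀ ζ = w i := fun ζ i hi => by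
    simp only [u₀]
    rw [Finset.sum_eq_single i, if_pos hi]
    · intro j _ hj
      refine if_neg fun hlt => ?_
      have h1 := hZ i j hj.symm
      have h2 := torusDist_triangle (Z i) ζ (Z j)
      rw [torusDist_comm (Z i) ζ] at h2
      linarith
    · simp
  refine ⟨fun ζ => metricProj (G t x ζ μ) (u₀ ζ), hG.measurable_proj ht x μ measurable_id hu₀,
    fun ζ => hG.proj_mem ht x ζ μ _, fun ζ i => ?_⟩
  have hp := hG.proj_mem ht x ζ μ (u₀ ζ)
  by_cases hi : torusDist ζ (Z i) < r
  · obtain ⟨a, ha, hwa⟩ := hε ζ i hi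
    have h1 := hG.norm_sub_proj_le ht x ζ μ (u₀ ζ) ha
    rw [hu₀' ζ i hi, norm_sub_rev] at h1
    have h2 : ‖metricProj (G t x ζ μ) (u₀ ζ) - w i‖ ^ 2 ≤ ε ^ 2 := by
      rw [hu₀' ζ i hi]
      exact pow_le_pow_left₀ (norm_nonneg _) (h1.trans hwa) 2
    have h3 : 0 ≤ (2 * R / r) ^ 2 * torusDist ζ (Z i) ^ 2 := by positivity
    linarith
  · have h1 : ‖metricProj (G t x ζ μ) (u₀ ζ) - w i‖ ≤ 2 * R := by
      have := norm_sub_le (metricProj (G t x ζ μ) (u₀ ζ)) (w i)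
      linarith [hG.bound t ht x ζ μ _ hp, hw i]
    have h2 : (2 * R) ^ 2 ≤ (2 * R / r) ^ 2 * torusDist ζ (Z i) ^ 2 := by
      rw [← mul_pow]
      have hR : 0 ≤ 2 * R := (norm_nonneg _).trans h1
      refine pow_le_pow_left₀ hR ?_ 2
      rw [div_mul_eq_mul_div, le_div_iff₀ hr]
      exact mul_le_mul_of_nonneg_left (not_lt.1 hi) hR
    have h3 := pow_le_pow_left₀ (norm_nonneg _) h1 2
    have h4 := sq_nonneg ε
    linarith

/-- The subsolution inequality at a maximum of the doubled functional, combined with the first-order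
condition in `s`. -/
theorem le_of_penalized_max [Finite I] [Nonempty I] (hR : 0 ≤ R)
    (hF : RegularField T R fun t x _ θ => F t x θ) (hG : RegularField T R G)
    (hsub : IsSubsolution T (hamiltonian F G L) V) {z : I → Torus d} {w : I → Vec d}
    {x : Torus d} {v : Vec d} {A M : ℝ} (hA : 0 ≤ A) {t : ℝ} (ht : t ∈ Set.Ico (0 : ℝ) T)
    {x' : Torus d} {s : ℝ} {γ : ProbabilityMeasure (Torus d × I)} (hw : ∀ i, ‖w i‖ ≤ R)
    (hsuper : IsSuperdifferential V t x' (law γ Prod.fst measurable_fst) (A * (t - s))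
      (-(A • disp x' (translate x (s • v)))) fun ζ =>
        -(A • bary γ (fun y => disp y.1 (translate (z y.2) (s • w y.2))) ζ))
    (hs : M + A * (t - s) - A * inner ℝ (disp x' (translate x (s • v))) v -
      A * ∫ y, inner ℝ (disp y.1 (translate (z y.2) (s • w y.2))) (w y.2)
        ∂(γ : Measure (Torus d × I)) ≤ 0)
    {q ε r : ℝ} (hq : 0 ≤ q) (hε : 0 ≤ ε) (hr : 0 < r) (hAq : A * q ≤ 6 * K)
    (hqx : torusDist x' (translate x (s • v)) ≤ q)
    (hqγ : ∫ y, torusDist y.1 (translate (z y.2) (s • w y.2)) ^ 2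
      ∂(γ : Measure (Torus d × I)) ≤ q ^ 2)
    (hsep : ∀ i j, i ≠ j →
      2 * r ≤ torusDist (translate (z i) (s • w i)) (translate (z j) (s • w j)))
    (hvε : ∃ a ∈ F t x' (law γ Prod.fst measurable_fst), ‖v - a‖ ≤ ε)
    (hwε : ∀ ζ i, torusDist ζ (translate (z i) (s • w i)) < r →
      ∃ a ∈ G t x' ζ (law γ Prod.fst measurable_fst), ‖w i - a‖ ≤ ε) :
    M ≤ L x' (law γ Prod.fst measurable_fst) + 12 * K * ε + 12 * K * R / r * q := by
  set μ := law γ Prod.fst measurable_fst with hμ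
  have ht' : t ∈ Set.Icc (0 : ℝ) T := ⟨ht.1, ht.2.le⟩
  obtain ⟨u, hum, huG, hu⟩ := exists_selection hG ht' x' μ
    (fun i => translate (z i) (s • w i)) w hw hr hsep hwε
  obtain ⟨a, ha, hva⟩ := hvε
  have hZ : Measurable fun y : Torus d × I => translate (z y.2) (s • w y.2) :=
    (measurable_particle z w s).comp measurable_snd
  have hD : Measurable fun y : Torus d × I => disp y.1 (translate (z y.2) (s • w y.2)) :=
    (measurable_disp (d := d)).comp (measurable_fst.prodMk hZ)
  have hwm : Measurable fun y : Torus d × I => w y.2 :=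
    (continuous_of_discreteTopology (f := w)).measurable.comp measurable_snd
  have huR : ∀ ζ, ‖u ζ‖ ≤ R := fun ζ => hG.bound t ht' x' ζ μ _ (huG ζ)
  have h1 := hsub t ht x' μ _ _ _ hsuper
  have h2 := hamiltonian_le (L := L) hF hG ht' (px := -(A • disp x' (translate x (s • v))))
    (pμ := fun ζ => -(A • bary γ (fun y => disp y.1 (translate (z y.2) (s • w y.2))) ζ))
    (B := A * torusDiam d) (fun ζ => by
      rw [norm_neg, norm_smul, Real.norm_of_nonneg hA]
      exact mul_le_mul_of_nonneg_left (norm_bary_le γ (fun y => norm_disp_le _ _) ζ) hA) ha hum huG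
  have h3 : ∫ ζ, inner ℝ
      (-(A • bary γ (fun y => disp y.1 (translate (z y.2) (s • w y.2))) ζ)) (u ζ)
      ∂(μ : Measure (Torus d)) =
      -(A * ∫ y, inner ℝ (disp y.1 (translate (z y.2) (s • w y.2))) (u y.1)
        ∂(γ : Measure (Torus d × I))) := by
    rw [← integral_inner_bary_law γ hD (fun y => norm_disp_le _ _) hum huR, ← integral_const_mul,
      ← integral_neg]
    simp_rw [inner_neg_left, real_inner_smul_left]
    rfl
  rw [h3, inner_neg_right, real_inner_smul_right] at h2
  -- The two pairings with the displacement differ by Cauchy-Schwarz.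
  have hint : ∀ {f : Torus d × I → Vec d}, Measurable f → (∀ y, ‖f y‖ ≤ R) →
      Integrable (fun y : Torus d × I =>
        inner ℝ (disp y.1 (translate (z y.2) (s • w y.2))) (f y)) (γ : Measure (Torus d × I)) :=
    fun {f} hf hfR => Integrable.of_bound (C := torusDiam d * R) (hD.inner hf).aestronglyMeasurable
      (ae_of_all _ fun y => (norm_inner_le_norm _ _).trans
        (mul_le_mul (norm_disp_le _ _) (hfR y) (norm_nonneg _) (torusDiam_nonneg d)))
  have h4 : |∫ y, inner ℝ (disp y.1 (translate (z y.2) (s • w y.2))) (u y.1 - w y.2)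
      ∂(γ : Measure (Torus d × I))| ≤ q * (ε + 2 * R / r * q) := by
    have hsum : ∀ y : Torus d × I, ‖u y.1 - w y.2‖ ≤ 2 * R := fun y =>
      (norm_sub_le _ _).trans (by linarith [huR y.1, hw y.2])
    refine abs_integral_inner_le γ hD ((hum.comp measurable_fst).sub hwm)
      (fun y => norm_disp_le _ _) hsum hq (by positivity) ?_ ?_
    · simp_rw [norm_disp]
      exact hqγ
    · have i1 := integrable_torusDist_sq γ measurable_fst hZ
      calc ∫ y, ‖u y.1 - w y.2‖ ^ 2 ∂(γ : Measure (Torus d × I))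
          ≤ ∫ y, (ε ^ 2 + (2 * R / r) ^ 2 * torusDist y.1 (translate (z y.2) (s • w y.2)) ^ 2)
              ∂(γ : Measure (Torus d × I)) := by
            refine integral_mono ?_ ((integrable_const _).add (i1.const_mul _))
              fun y => hu y.1 y.2
            refine Integrable.of_bound (C := (2 * R) ^ 2)
              (((hum.comp measurable_fst).sub hwm).norm.pow_const 2).aestronglyMeasurable
              (ae_of_all _ fun y => ?_)
            rw [Real.norm_of_nonneg (by positivity)]
            exact pow_le_pow_left₀ (norm_nonneg _) (hsum y) 2
        _ = ε ^ 2 + (2 * R / r) ^ 2 * ∫ y, torusDist y.1 (translate (z y.2) (s • w y.2)) ^ 2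
              ∂(γ : Measure (Torus d × I)) := by
            rw [integral_add (integrable_const _) (i1.const_mul _), integral_const_mul]
            simp
        _ ≤ ε ^ 2 + (2 * R / r) ^ 2 * q ^ 2 := by gcongr
        _ ≤ (ε + 2 * R / r * q) ^ 2 := by
            have : 0 ≤ ε * (2 * R / r * q) := by positivity
            nlinarith
  have h5 : ∫ y, inner ℝ (disp y.1 (translate (z y.2) (s • w y.2))) (u y.1 - w y.2)
      ∂(γ : Measure (Torus d × I)) =
      ∫ y, inner ℝ (disp y.1 (translate (z y.2) (s • w y.2))) (u y.1)
        ∂(γ : Measure (Torus d × I)) -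
      ∫ y, inner ℝ (disp y.1 (translate (z y.2) (s • w y.2))) (w y.2)
        ∂(γ : Measure (Torus d × I)) := by
    simp_rw [inner_sub_right]
    exact integral_sub (hint (hum.comp measurable_fst) fun y => huR y.1) (hint hwm fun y => hw y.2)
  rw [h5] at h4
  have h6 : inner ℝ (disp x' (translate x (s • v))) v -
      inner ℝ a (disp x' (translate x (s • v))) ≤ q * ε := by
    rw [real_inner_comm, ← inner_sub_left]
    refine (real_inner_le_norm _ _).trans ?_
    rw [mul_comm, norm_disp]
    exact mul_le_mul hqx hva (norm_nonneg _) hq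
  have h7 := mul_le_mul_of_nonneg_left (abs_le.1 h4).1 hA
  have h8 := mul_le_mul_of_nonneg_left h6 hA
  have h9 : A * q * (ε + 2 * R / r * q) ≤ 6 * K * (ε + 2 * R / r * q) :=
    mul_le_mul_of_nonneg_right hAq (by positivity)
  have h10 : A * q * ε ≤ 6 * K * ε := mul_le_mul_of_nonneg_right hAq hε
  have h11 : 12 * K * R / r * q = 6 * K * (2 * R / r * q) := by ring
  rw [h11]
  linarith

/-- **Suboptimality along particle systems without collisions.** A subsolution does not decrease
faster than the running cost along the motion of finitely many particles whose velocities nearly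
belong to the admissible sets. -/
theorem particles_monotone [Finite I] [Nonempty I] (hV : LipWith T K V) (hK : 0 ≤ K) (hR : 0 ≤ R)
    (hF : RegularField T R fun t x _ θ => F t x θ) (hG : RegularField T R G) {KL : ℝ}
    (hKL : 0 ≤ KL) (hL : ∀ x₁ x₂ θ₁ θ₂,
      |L x₁ θ₁ - L x₂ θ₂| ≤ KL * (torusDist x₁ x₂ + wassersteinDist 2 θ₁ θ₂))
    (hsub : IsSubsolution T (hamiltonian F G L) V) {a b : ℝ} (ha : 0 ≤ a) (hab : a ≤ b)
    (hbT : b < T) (m : ProbabilityMeasure I) (z : I → Torus d) (w : I → Vec d) (x : Torus d)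
    (v : Vec d) (hv : ‖v‖ ≤ R) (hw : ∀ i, ‖w i‖ ≤ R) {c : ℝ} (hc : 0 < c)
    (hsep : ∀ s ∈ Set.Icc a b, ∀ i j, i ≠ j →
      c ≤ torusDist (translate (z i) (s • w i)) (translate (z j) (s • w j)))
    {ℓ η M : ℝ} (hη : 0 < η)
    (hℓ : ∀ s ∈ Set.Icc a b, L (translate x (s • v)) (particles m z w s) ≤ ℓ)
    (hvF : ∀ s ∈ Set.Icc a b,
      ∃ v' ∈ F s (translate x (s • v)) (particles m z w s), ‖v - v'‖ ≤ η)
    (hwG : ∀ s ∈ Set.Icc a b, ∀ i, ∃ w' ∈ G s (translate x (s • v)) (translate (z i) (s • w i))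
      (particles m z w s), ‖w i - w'‖ ≤ η)
    (hM : ℓ + 24 * K * η < M) :
    V a (translate x (a • v)) (particles m z w a) - (b - a) * M ≤
      V b (translate x (b • v)) (particles m z w b) := by
  by_contra! hlt
  set Δ := V a (translate x (a • v)) (particles m z w a) + M * a -
    (V b (translate x (b • v)) (particles m z w b) + M * b) with hΔ
  have hΔ0 : 0 < Δ := by rw [hΔ]; linarith
  obtain ⟨ρ₁, hρ₁, hFu⟩ := hF.unif η hη
  obtain ⟨ρ₂, hρ₂, hGu⟩ := hG.unif η hη
  obtain ⟨r, hr, hrρ, hrc⟩ : ∃ r, 0 < r ∧ r ≤ ρ₂ ∧ 2 * r ≤ c :=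
    ⟨min ρ₂ (c / 2), lt_min hρ₂ (half_pos hc), min_le_left _ _, by
      linarith [min_le_right ρ₂ (c / 2)]⟩
  set κ := M - (ℓ + 24 * K * η) with hκ
  have hκ0 : 0 < κ := sub_pos.2 hM
  set B := 2 * KL + 12 * K * R / r + 3 * K with hB
  have hB0 : 0 ≤ B := by positivity
  obtain ⟨q₀, hq₀, hq₁, hq₂, hq₃, hq₄, hq₅⟩ : ∃ q₀ : ℝ, 0 < q₀ ∧ q₀ < ρ₁ ∧ q₀ < ρ₂ ∧
      q₀ < T - b ∧ B * q₀ < Δ ∧ B * q₀ < κ := by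
    have e : ∀ {y : ℝ}, 0 < y → ∀ᶠ q : ℝ in 𝓝[>] 0, q < y := fun hy =>
      nhdsWithin_le_nhds (gt_mem_nhds hy)
    have e' : ∀ {y : ℝ}, 0 < y → ∀ᶠ q : ℝ in 𝓝[>] 0, B * q < y := fun {y} hy => by
      have hc : Continuous fun q : ℝ => B * q := by fun_prop
      exact ((hc.tendsto 0).mono_left nhdsWithin_le_nhds).eventually
        (gt_mem_nhds (by simpa using hy))
    obtain ⟨q, hq, h⟩ := (eventually_mem_nhdsWithin.and ((e hρ₁).and ((e hρ₂).and
      ((e (sub_pos.2 hbT)).and ((e' hΔ0).and (e' hκ0)))))).exists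
    exact ⟨q, hq, h⟩
  -- The bound `A * q ≤ 6 * K` forces `q ≤ q₀`; the summand `1` keeps `A` positive if `K = 0`.
  set A := 6 * K / q₀ + 1 with hA
  have hA0 : 0 < A := by positivity
  obtain ⟨t, ht, x', s, hs, γ, hγ, hmax⟩ := exists_max_penalized hV (ha.trans (hab.trans hbT.le))
    hab m z w x v M A
  obtain ⟨q, hq, hpen, hqt, hqx, hqW, hqγ⟩ := penalty_bounds z w x v t x' s hγ
  have hsT : s ∈ Set.Icc (0 : ℝ) T := ⟨ha.trans hs.1, hs.2.trans hbT.le⟩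
  have hVs : V t x' (law γ Prod.fst measurable_fst) -
      V s (translate x (s • v)) (particles m z w s) ≤ 3 * K * q := by
    have h1 := (abs_le.1 (hV t ht s hsT x' (translate x (s • v))
      (law γ Prod.fst measurable_fst) (particles m z w s))).2
    have h2 : K * (|t - s| + torusDist x' (translate x (s • v)) +
        wassersteinDist 2 (law γ Prod.fst measurable_fst) (particles m z w s)) ≤ K * (3 * q) :=
      mul_le_mul_of_nonneg_left (by linarith) hK
    linarith
  have hself := hmax s hsT (translate x (s • v)) s hs (selfCoupling m z w s)
    (selfCoupling_snd m z w s)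
  rw [law_selfCoupling, penalty_selfCoupling, hpen] at hself
  have hAq : A * q ≤ 6 * K := by
    rcases hq.eq_or_lt with h0 | h0
    · rw [← h0]; simpa using hK
    · refine le_of_mul_le_mul_right (a := q) ?_ h0
      nlinarith
  have hqq : q ≤ q₀ := by
    by_contra! h
    have h1 : A * q₀ = 6 * K + q₀ := by rw [hA]; field_simp
    have h2 := mul_lt_mul_of_pos_left h hA0
    linarith
  have hBq : B * q ≤ B * q₀ := mul_le_mul_of_nonneg_left hqq hB0
  have hKq : 3 * K * q ≤ B * q := by
    refine mul_le_mul_of_nonneg_right ?_ hq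
    have : 0 ≤ 2 * KL + 12 * K * R / r := by positivity
    rw [hB]; linarith
  -- The penalized gain from `a` to `b` is negative, so the maximum is not attained at `s = b`.
  have hsb : s < b := by
    refine lt_of_le_of_ne hs.2 fun h => ?_
    have h1 := hmax a ⟨ha, hab.trans hbT.le⟩ (translate x (a • v)) a ⟨le_rfl, hab⟩
      (selfCoupling m z w a) (selfCoupling_snd m z w a)
    rw [law_selfCoupling, penalty_selfCoupling, hpen] at h1
    have h2 : 0 ≤ A / 2 * q ^ 2 := by positivity
    rw [h] at hVs h1
    linarith
  have htT : t < T := by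
    have := (abs_le.1 hqt).2
    linarith [hs.2]
  have hsuper := penalized_superdifferential (V := V) (T := T) (z := z) (w := w) (x := x) (v := v)
    (x' := x') (s := s) hA0.le ht.1 htT hγ
    fun t₁ ht₁ x₁ γ₁ hγ₁ => by
      have := hmax t₁ ht₁ x₁ s hs γ₁ hγ₁
      linarith
  have hfirst := penalized_first_order (M := M) (z := z) (w := w) (x := x) (v := v) (t := t)
    (x' := x') (γ := γ) hA0.le hv hw hsb fun s₁ h1 h2 => by
    have := hmax t ht x' s₁ ⟨hs.1.trans h1.le, h2.le⟩ γ hγ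
    linarith
  have hle := le_of_penalized_max hR hF hG hsub hA0.le ⟨ht.1, htT⟩ hw hsuper hfirst hq
    (by positivity : 0 ≤ 2 * η) hr hAq hqx hqγ (fun i j hij => hrc.trans (hsep s hs i j hij)) ?_ ?_
  · have h1 := (abs_le.1 (hL x' (translate x (s • v)) (law γ Prod.fst measurable_fst)
      (particles m z w s))).2
    have h2 : KL * (torusDist x' (translate x (s • v)) +
        wassersteinDist 2 (law γ Prod.fst measurable_fst) (particles m z w s)) ≤ KL * (2 * q) :=
      mul_le_mul_of_nonneg_left (by linarith) hKL
    have h3 := hℓ s hs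
    have h4 : B * q = 2 * KL * q + 12 * K * R / r * q + 3 * K * q := by rw [hB]; ring
    have h5 : 0 ≤ 3 * K * q := by positivity
    linarith
  · obtain ⟨v', hv', hvv⟩ := hvF s hs
    obtain ⟨v'', hv'', hvv'⟩ := hFu s hsT t ht _ x' x x _ (law γ Prod.fst measurable_fst)
      (by rw [abs_sub_comm]; linarith) (by rw [torusDist_comm]; linarith)
      (by rwa [torusDist_self]) (by rw [wassersteinDist_comm]; linarith) v' hv'
    exact ⟨v'', hv'', by linarith [norm_sub_le_norm_sub_add_norm_sub v v' v'']⟩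
  · intro ζ i hζ
    obtain ⟨w', hw', hww⟩ := hwG s hs i
    obtain ⟨w'', hw'', hww'⟩ := hGu s hsT t ht _ x' _ ζ _ (law γ Prod.fst measurable_fst)
      (by rw [abs_sub_comm]; linarith) (by rw [torusDist_comm]; linarith)
      (by rw [torusDist_comm]; linarith) (by rw [wassersteinDist_comm]; linarith) w' hw'
    exact ⟨w'', hw'', by linarith [norm_sub_le_norm_sub_add_norm_sub (w i) w' w'']⟩

end FiniteSystem

/-! ### Particle systems with collisions -/

/-- A continuous function on an interval which increases on every subinterval that avoids a finite
set is larger at the right end point. -/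
theorem le_of_le_off_finite {g : ℝ → ℝ} {S : Set ℝ} (hS : S.Finite) {a b : ℝ} (hab : a ≤ b)
    (hg : ContinuousOn g (Set.Icc a b))
    (h : ∀ a' b', a ≤ a' → a' ≤ b' → b' ≤ b → (∀ s ∈ Set.Icc a' b', s ∉ S) → g a' ≤ g b') :
    g a ≤ g b := by
  induction S, hS using Set.Finite.induction_on generalizing a b with
  | empty => exact h a b le_rfl hab le_rfl fun s _ hs => hs
  | @insert c S _ _ ih =>
    -- It suffices to treat the subintervals that avoid the point `c`.
    have key : ∀ a' b', a ≤ a' → a' ≤ b' → b' ≤ b → c ∉ Set.Icc a' b' → g a' ≤ g b' :=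
      fun a' b' h1 h2 h3 hc => ih h2 (hg.mono (Set.Icc_subset_Icc h1 h3))
        fun a'' b'' e1 e2 e3 e4 => h a'' b'' (h1.trans e1) e2 (e3.trans h3) fun s hs hs' => by
          rcases hs' with rfl | hs'
          · exact hc ⟨e1.trans hs.1, hs.2.trans e3⟩
          · exact e4 s hs hs'
    by_cases hc : c ∈ Set.Icc a b
    · have h1 : g a ≤ g c := by
        rcases hc.1.eq_or_lt with rfl | hac
        · exact le_rfl
        have hlim : Tendsto g (𝓝[<] c) (𝓝 (g c)) :=
          ((hg c hc).mono_of_mem_nhdsWithin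
            (mem_of_superset (Ico_mem_nhdsLT hac) fun s hs => ⟨hs.1, hs.2.le.trans hc.2⟩))
        refine ge_of_tendsto hlim ?_
        filter_upwards [Ico_mem_nhdsLT hac] with s hs
        exact key a s le_rfl hs.1 (hs.2.le.trans hc.2) fun hcs => (hcs.2.trans_lt hs.2).false
      have h2 : g c ≤ g b := by
        rcases hc.2.eq_or_lt with rfl | hcb
        · exact le_rfl
        have hlim : Tendsto g (𝓝[>] c) (𝓝 (g c)) :=
          ((hg c hc).mono_of_mem_nhdsWithin
            (mem_of_superset (Ioc_mem_nhdsGT hcb) fun s hs => ⟨hc.1.trans hs.1.le, hs.2⟩))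
        refine le_of_tendsto hlim ?_
        filter_upwards [Ioc_mem_nhdsGT hcb] with s hs
        exact key s b (hc.1.trans hs.1.le) hs.2 le_rfl fun hcs => (hs.1.trans_le hcs.1).false
      exact h1.trans h2
    · exact key a b le_rfl hab le_rfl hc

/-- Two distinct particles in uniform motion meet at most once during a time interval in which their
relative displacement stays below the period of the torus. -/
theorem subsingleton_collision {d : ℕ} {ζ ζ' : Torus d} {w w' : Vec d} (hne : (ζ, w) ≠ (ζ', w'))
    {R τ a : ℝ} (hw : ‖w‖ ≤ R) (hw' : ‖w'‖ ≤ R) (hτ : 2 * R * τ < 1) :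
    {s | s ∈ Set.Icc a (a + τ) ∧ translate ζ (s • w) = translate ζ' (s • w')}.Subsingleton := by
  rintro s ⟨hs, h1⟩ s' ⟨hs', h2⟩
  by_contra hss
  have hww : w = w' := by
    ext i
    have e1 := congrFun h1 i
    have e2 := congrFun h2 i
    simp only [translate, PiLp.smul_apply, smul_eq_mul] at e1 e2
    have e3 : (((s - s') * (w i - w' i) : ℝ) : UnitAddCircle) = 0 := by
      have h3 : (s - s') * (w i - w' i) = (s * w i - s * w' i) - (s' * w i - s' * w' i) := by ring
      have e4 : ((s * w i : ℝ) : UnitAddCircle) - ((s * w' i : ℝ) : UnitAddCircle) =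
          ζ' i - ζ i := by rw [sub_eq_sub_iff_add_eq_add, add_comm, e1]
      have e5 : ((s' * w i : ℝ) : UnitAddCircle) - ((s' * w' i : ℝ) : UnitAddCircle) =
          ζ' i - ζ i := by rw [sub_eq_sub_iff_add_eq_add, add_comm, e2]
      rw [h3, AddCircle.coe_sub, AddCircle.coe_sub, AddCircle.coe_sub, e4, e5, sub_self]
    obtain ⟨n, hn⟩ := (AddCircle.coe_eq_zero_iff (1 : ℝ)).1 e3
    simp only [zsmul_eq_mul, mul_one] at hn
    have hlt : |(n : ℝ)| < 1 := by
      rw [hn, abs_mul]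
      have b1 : |s - s'| ≤ τ := by
        rw [abs_le]; constructor <;> linarith [hs.1, hs.2, hs'.1, hs'.2]
      have b2 : |w i - w' i| ≤ 2 * R := by
        have := (PiLp.norm_apply_le (w - w') i).trans (norm_sub_le w w')
        rw [PiLp.sub_apply, Real.norm_eq_abs] at this
        linarith
      calc |s - s'| * |w i - w' i| ≤ τ * (2 * R) :=
            mul_le_mul b1 b2 (abs_nonneg _) ((abs_nonneg _).trans b1)
        _ < 1 := by linarith
    have hn0 : n = 0 := by
      rw [← Int.cast_abs, ← Int.cast_one, Int.cast_lt] at hlt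
      exact Int.abs_lt_one_iff.1 hlt
    rw [hn0, Int.cast_zero] at hn
    rcases mul_eq_zero.1 hn.symm with h | h
    · exact absurd (sub_eq_zero.1 h) hss
    · exact sub_eq_zero.1 h
  refine hne (Prod.ext ?_ hww)
  rw [hww] at h1
  funext i
  exact add_right_cancel (congrFun h1 i)

section FiniteSystem

variable {d : ℕ} {I : Type*} [TopologicalSpace I] [DiscreteTopology I] [MeasurableSpace I]
  [BorelSpace I]

theorem wassersteinDist_particles_le {R : ℝ} (m : ProbabilityMeasure I) (z : I → Torus d)
    {w : I → Vec d} (hw : ∀ i, ‖w i‖ ≤ R) (s s' : ℝ) :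
    wassersteinDist 2 (particles m z w s) (particles m z w s') ≤ R * |s - s'| := by
  obtain ⟨i₀⟩ := m.nonempty
  have hR : 0 ≤ R := (norm_nonneg _).trans (hw i₀)
  refine wassersteinDist_law_le_of_forall m _ _ (by positivity) fun i => ?_
  have h : translate (z i) (s' • w i) = translate (translate (z i) (s • w i)) ((s' - s) • w i) := by
    rw [← translate_add_smul, add_sub_cancel]
  rw [h]
  refine (torusDist_translate_le _ _).trans ?_
  rw [norm_smul, Real.norm_eq_abs, abs_sub_comm, mul_comm]
  exact mul_le_mul_of_nonneg_right (hw i) (abs_nonneg _)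

theorem torusDist_translate_smul_le {R : ℝ} (x : Torus d) {v : Vec d} (hv : ‖v‖ ≤ R) (s s' : ℝ) :
    torusDist (translate x (s • v)) (translate x (s' • v)) ≤ R * |s - s'| := by
  have h : translate x (s' • v) = translate (translate x (s • v)) ((s' - s) • v) := by
    rw [← translate_add_smul, add_sub_cancel]
  rw [h]
  refine (torusDist_translate_le _ _).trans ?_
  rw [norm_smul, Real.norm_eq_abs, abs_sub_comm, mul_comm]
  exact mul_le_mul_of_nonneg_right hv (abs_nonneg _)

variable {T K R : ℝ} {V : ℝ → Torus d → Prob d → ℝ} {F : ℝ → Torus d → Prob d → Set (Vec d)}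
  {G : ℝ → Torus d → Torus d → Prob d → Set (Vec d)} {L : Torus d → Prob d → ℝ}

/-- Suboptimality along particle systems, collisions allowed: during a short time there are only
finitely many of them. -/
theorem particles_suboptimal [Finite I] [Nonempty I] (hV : LipWith T K V) (hK : 0 ≤ K) (hR : 0 ≤ R)
    (hF : RegularField T R fun t x _ θ => F t x θ) (hG : RegularField T R G) {KL : ℝ}
    (hKL : 0 ≤ KL) (hL : ∀ x₁ x₂ θ₁ θ₂,
      |L x₁ θ₁ - L x₂ θ₂| ≤ KL * (torusDist x₁ x₂ + wassersteinDist 2 θ₁ θ₂))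
    (hsub : IsSubsolution T (hamiltonian F G L) V) {a τ : ℝ} (ha : 0 ≤ a) (hτ : 0 ≤ τ)
    (haT : a + τ < T) (hRτ : 2 * R * τ < 1) (m : ProbabilityMeasure I) (z : I → Torus d)
    (w : I → Vec d) (x : Torus d) (v : Vec d) (hv : ‖v‖ ≤ R) (hw : ∀ i, ‖w i‖ ≤ R)
    (hinj : Function.Injective fun i => (z i, w i)) {ℓ η M : ℝ} (hη : 0 < η)
    (hℓ : ∀ s ∈ Set.Icc a (a + τ), L (translate x (s • v)) (particles m z w s) ≤ ℓ)
    (hvF : ∀ s ∈ Set.Icc a (a + τ),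
      ∃ v' ∈ F s (translate x (s • v)) (particles m z w s), ‖v - v'‖ ≤ η)
    (hwG : ∀ s ∈ Set.Icc a (a + τ), ∀ i, ∃ w' ∈ G s (translate x (s • v))
      (translate (z i) (s • w i)) (particles m z w s), ‖w i - w'‖ ≤ η)
    (hM : ℓ + 24 * K * η < M) :
    V a (translate x (a • v)) (particles m z w a) - τ * M ≤
      V (a + τ) (translate x ((a + τ) • v)) (particles m z w (a + τ)) := by
  let S : Set ℝ := ⋃ p : I × I, {s | p.1 ≠ p.2 ∧ s ∈ Set.Icc a (a + τ) ∧
    translate (z p.1) (s • w p.1) = translate (z p.2) (s • w p.2)}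
  have hS : S.Finite := Set.finite_iUnion fun p => by
    by_cases hp : p.1 = p.2
    · simp [hp]
    · exact (subsingleton_collision (fun h => hp (hinj h)) (hw p.1) (hw p.2) hRτ).finite.subset
        fun s hs => hs.2
  let g : ℝ → ℝ := fun s => V s (translate x (s • v)) (particles m z w s) + M * s
  have hg : ContinuousOn g (Set.Icc a (a + τ)) := by
    refine ContinuousOn.add ?_ (by fun_prop)
    refine (LipschitzOnWith.of_dist_le' (K := K * (1 + R + R)) fun s hs s' hs' => ?_).continuousOn
    rw [Real.dist_eq, Real.dist_eq]
    refine (hV s ⟨ha.trans hs.1, hs.2.trans haT.le⟩ s' ⟨ha.trans hs'.1, hs'.2.trans haT.le⟩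
      _ _ _ _).trans ?_
    rw [mul_assoc]
    refine mul_le_mul_of_nonneg_left ?_ hK
    linarith [torusDist_translate_smul_le x hv s s', wassersteinDist_particles_le m z hw s s']
  have hmain : g a ≤ g (a + τ) := by
    refine le_of_le_off_finite hS (by linarith) hg fun a' b' h1 h2 h3 hoff => ?_
    have hsub' : Set.Icc a' b' ⊆ Set.Icc a (a + τ) := Set.Icc_subset_Icc h1 h3
    obtain ⟨c, hc, hsep⟩ : ∃ c > 0, ∀ s ∈ Set.Icc a' b', ∀ i j, i ≠ j →
        c ≤ torusDist (translate (z i) (s • w i)) (translate (z j) (s • w j)) := by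
      let D : Set (ℝ × I × I) := Set.Icc a' b' ×ˢ {p | p.1 ≠ p.2}
      have hD : IsCompact D := isCompact_Icc.prod (Set.toFinite _).isCompact
      rcases D.eq_empty_or_nonempty with hemp | hne
      · refine ⟨1, one_pos, fun s hs i j hij => ?_⟩
        have : (s, i, j) ∈ D := ⟨hs, hij⟩
        rw [hemp] at this
        exact this.elim
      · have e1 : Continuous fun p : ℝ × I × I => translate (z p.2.1) (p.1 • w p.2.1) :=
          ((continuous_of_discreteTopology (f := z)).comp
            (continuous_fst.comp continuous_snd)).translate (continuous_fst.smul
            ((continuous_of_discreteTopology (f := w)).comp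
              (continuous_fst.comp continuous_snd)))
        have e2 : Continuous fun p : ℝ × I × I => translate (z p.2.2) (p.1 • w p.2.2) :=
          ((continuous_of_discreteTopology (f := z)).comp
            (continuous_snd.comp continuous_snd)).translate (continuous_fst.smul
            ((continuous_of_discreteTopology (f := w)).comp
              (continuous_snd.comp continuous_snd)))
        obtain ⟨p, hp, hmin⟩ := hD.exists_isMinOn hne (e1.torusDist e2).continuousOn
        refine ⟨_, lt_of_le_of_ne (torusDist_nonneg _ _) fun h0 => ?_,
          fun s hs i j hij => hmin (a := (s, i, j)) ⟨hs, hij⟩⟩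
        exact hoff p.1 hp.1 (Set.mem_iUnion.2
          ⟨p.2, hp.2, hsub' hp.1, eq_of_torusDist_eq_zero h0.symm⟩)
    have := particles_monotone hV hK hR hF hG hKL hL hsub (ha.trans h1) h2 (h3.trans_lt haT)
      m z w x v hv hw hc hsep hη (fun s hs => hℓ s (hsub' hs)) (fun s hs => hvF s (hsub' hs))
      (fun s hs => hwG s (hsub' hs)) hM
    simp only [g]
    linarith
  simp only [g] at hmain
  linarith

end FiniteSystem

/-! ### The suboptimality principle -/

section Suboptimality

variable {d : ℕ} {T K R : ℝ} {V : ℝ → Torus d → Prob d → ℝ} {F : ℝ → Torus d → Prob d → Set (Vec d)}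
  {G : ℝ → Torus d → Torus d → Prob d → Set (Vec d)} {L : Torus d → Prob d → ℝ}

/-- Suboptimality over a short time along a particle system whose velocities are admissible for a
nearby frozen configuration `(t₀, x₀, μ₀)`. -/
theorem suboptimal_of_frozen {I : Type*} [TopologicalSpace I] [DiscreteTopology I]
    [MeasurableSpace I] [BorelSpace I] [Finite I] [Nonempty I] (hV : LipWith T K V) (hK : 0 ≤ K)
    (hR : 0 ≤ R) (hF : RegularField T R fun t x _ θ => F t x θ) (hG : RegularField T R G) {KL : ℝ}
    (hKL : 0 ≤ KL) (hL : ∀ x₁ x₂ θ₁ θ₂,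
      |L x₁ θ₁ - L x₂ θ₂| ≤ KL * (torusDist x₁ x₂ + wassersteinDist 2 θ₁ θ₂))
    (hsub : IsSubsolution T (hamiltonian F G L) V) {η ρ : ℝ} (hη : 0 < η)
    (hFρ : ∀ t ∈ Set.Icc (0 : ℝ) T, ∀ s ∈ Set.Icc (0 : ℝ) T, ∀ x x' θ θ', |t - s| < ρ →
      torusDist x x' < ρ → wassersteinDist 2 θ θ' < ρ →
      ∀ a ∈ F t x θ, ∃ b ∈ F s x' θ', ‖a - b‖ ≤ η / 2)
    (hGρ : ∀ t ∈ Set.Icc (0 : ℝ) T, ∀ s ∈ Set.Icc (0 : ℝ) T, ∀ x x' y y' θ θ', |t - s| < ρ →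
      torusDist x x' < ρ → torusDist y y' < ρ → wassersteinDist 2 θ θ' < ρ →
      ∀ a ∈ G t x y θ, ∃ b ∈ G s x' y' θ', ‖a - b‖ ≤ η / 2)
    {t₀ τ : ℝ} (ht₀ : 0 ≤ t₀) (hτ : 0 ≤ τ) (htT : t₀ + τ < T) (hRτ : 2 * R * τ < 1) (hτρ : τ < ρ)
    (hRρ : R * τ < ρ) {x₀ : Torus d} {μ₀ : Prob d} {v : Vec d} (hv : v ∈ F t₀ x₀ μ₀)
    (m : ProbabilityMeasure I) {ζ : I → Torus d} (hζ : Measurable ζ) {w : I → Vec d}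
    (hw : Measurable w) (hwG : ∀ i, w i ∈ G t₀ x₀ (ζ i) μ₀)
    (hinj : Function.Injective fun i => (ζ i, w i)) {δ M : ℝ} (hδρ : δ < ρ)
    (hδ : wassersteinDist 2 μ₀ (law m ζ hζ) ≤ δ)
    (hM : L x₀ μ₀ + KL * (δ + 2 * (R * τ)) + 24 * K * η < M) :
    V t₀ x₀ (law m ζ hζ) - τ * M ≤ V (t₀ + τ) (translate x₀ (τ • v))
      (law m (fun i => translate (ζ i) (τ • w i)) (hζ.translate (hw.const_smul τ))) := by
  have hT0 : t₀ ∈ Set.Icc (0 : ℝ) T := ⟨ht₀, by linarith⟩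
  -- The motion is extended backwards, so that it starts at time `0` and passes through the given
  -- configuration at time `t₀`.
  set x : Torus d := translate x₀ ((-t₀) • v) with hx
  set z : I → Torus d := fun i => translate (ζ i) ((-t₀) • w i) with hz
  have hxs : ∀ s, translate x (s • v) = translate x₀ ((s - t₀) • v) := fun s => by
    rw [hx, ← translate_add_smul, neg_add_eq_sub]
  have hzs : ∀ s i, translate (z i) (s • w i) = translate (ζ i) ((s - t₀) • w i) := fun s i => by
    rw [hz]
    beta_reduce
    rw [← translate_add_smul, neg_add_eq_sub]
  have hvR : ‖v‖ ≤ R := hF.bound t₀ hT0 x₀ x₀ μ₀ v hv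
  have hwR : ∀ i, ‖w i‖ ≤ R := fun i => hG.bound t₀ hT0 x₀ (ζ i) μ₀ _ (hwG i)
  have hp0 : particles m z w t₀ = law m ζ hζ := by
    unfold particles
    congr 1
    funext i
    rw [hzs, sub_self, zero_smul, translate_zero]
  have hpτ : particles m z w (t₀ + τ) =
      law m (fun i => translate (ζ i) (τ • w i)) (hζ.translate (hw.const_smul τ)) := by
    unfold particles
    congr 1
    funext i
    rw [hzs, add_sub_cancel_left]
  have hx0 : translate x (t₀ • v) = x₀ := by rw [hxs, sub_self, zero_smul, translate_zero]
  have hxτ : translate x ((t₀ + τ) • v) = translate x₀ (τ • v) := by rw [hxs, add_sub_cancel_left]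
  -- All distances travelled up to time `s` are at most `R τ`.
  have hsR : ∀ s ∈ Set.Icc t₀ (t₀ + τ), R * |t₀ - s| ≤ R * τ := fun s hs => by
    refine mul_le_mul_of_nonneg_left ?_ hR
    rw [abs_le]; constructor <;> linarith [hs.1, hs.2]
  have hdx : ∀ s ∈ Set.Icc t₀ (t₀ + τ), torusDist x₀ (translate x (s • v)) ≤ R * τ :=
    fun s hs => by
      have := torusDist_translate_smul_le x hvR t₀ s
      rw [hx0] at this
      exact this.trans (hsR s hs)
  have hdz : ∀ s ∈ Set.Icc t₀ (t₀ + τ), ∀ i,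
      torusDist (ζ i) (translate (z i) (s • w i)) ≤ R * τ := fun s hs i => by
    have := torusDist_translate_smul_le (z i) (hwR i) t₀ s
    rw [hzs t₀, sub_self, zero_smul, translate_zero] at this
    exact this.trans (hsR s hs)
  have hdp : ∀ s ∈ Set.Icc t₀ (t₀ + τ),
      wassersteinDist 2 (law m ζ hζ) (particles m z w s) ≤ R * τ := fun s hs => by
    have := wassersteinDist_particles_le m z hwR t₀ s
    rw [hp0] at this
    exact this.trans (hsR s hs)
  have hρ : 0 < ρ := (wassersteinDist_nonneg _ _).trans_lt (hδ.trans_lt hδρ)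
  have htt : |t₀ - t₀| < ρ := by simpa using hρ
  have hself : ∀ y : Torus d, torusDist y y < ρ := fun y => by rwa [torusDist_self]
  have hts : ∀ s ∈ Set.Icc t₀ (t₀ + τ), |t₀ - s| < ρ := fun s hs => by
    rw [abs_lt]; constructor <;> linarith [hs.1, hs.2]
  have hsT : ∀ s ∈ Set.Icc t₀ (t₀ + τ), s ∈ Set.Icc (0 : ℝ) T := fun s hs =>
    ⟨ht₀.trans hs.1, hs.2.trans htT.le⟩
  have main := particles_suboptimal hV hK hR hF hG hKL hL hsub ht₀ hτ htT hRτ m z w x v hvR hwR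
    (M := M) (η := η) (ℓ := L x₀ μ₀ + KL * (δ + 2 * (R * τ))) ?_ hη ?_ ?_ ?_ hM
  · rwa [hp0, hpτ, hx0, hxτ] at main
  · intro i j hij
    obtain ⟨h1, h2⟩ := Prod.ext_iff.1 hij
    refine hinj (Prod.ext ?_ h2)
    have h3 := congrArg (fun y => translate y (t₀ • w i)) h1
    simp only at h3 h2
    rw [hzs] at h3
    rw [h2, hzs] at h3
    simpa [translate_zero] using h3
  · intro s hs
    have h1 := (abs_le.1 (hL x₀ x₀ (law m ζ hζ) μ₀)).2
    have h2 := (abs_le.1 (hL (translate x (s • v)) x₀ (particles m z w s) (law m ζ hζ))).2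
    rw [torusDist_self, zero_add, wassersteinDist_comm] at h1
    rw [torusDist_comm, wassersteinDist_comm] at h2
    have h3 : KL * wassersteinDist 2 μ₀ (law m ζ hζ) ≤ KL * δ := mul_le_mul_of_nonneg_left hδ hKL
    have h4 : KL * (torusDist x₀ (translate x (s • v)) +
        wassersteinDist 2 (law m ζ hζ) (particles m z w s)) ≤ KL * (R * τ + R * τ) :=
      mul_le_mul_of_nonneg_left (add_le_add (hdx s hs) (hdp s hs)) hKL
    linarith
  · intro s hs
    obtain ⟨v₁, hv₁, h1⟩ := hFρ t₀ hT0 t₀ hT0 x₀ x₀ μ₀ (law m ζ hζ) htt (hself _)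
      (hδ.trans_lt hδρ) v hv
    obtain ⟨v₂, hv₂, h2⟩ := hFρ t₀ hT0 s (hsT s hs) x₀ _ (law m ζ hζ) (particles m z w s)
      (hts s hs) ((hdx s hs).trans_lt hRρ) ((hdp s hs).trans_lt hRρ) v₁ hv₁
    exact ⟨v₂, hv₂, by linarith [norm_sub_le_norm_sub_add_norm_sub v v₁ v₂]⟩
  · intro s hs i
    obtain ⟨v₁, hv₁, h1⟩ := hGρ t₀ hT0 t₀ hT0 x₀ x₀ (ζ i) (ζ i) μ₀ (law m ζ hζ) htt (hself _)
      (hself _) (hδ.trans_lt hδρ) (w i) (hwG i)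
    obtain ⟨v₂, hv₂, h2⟩ := hGρ t₀ hT0 s (hsT s hs) x₀ _ (ζ i) _ (law m ζ hζ)
      (particles m z w s) (hts s hs) ((hdx s hs).trans_lt hRρ) ((hdz s hs i).trans_lt hRρ)
      ((hdp s hs).trans_lt hRρ) v₁ hv₁
    exact ⟨v₂, hv₂, by linarith [norm_sub_le_norm_sub_add_norm_sub (w i) v₁ v₂]⟩

/-- Random positions and velocities `(f, w)` with values in a set `S` can be approximated by random
variables with finitely many values in `S`, with respect to the Wasserstein distances of the laws at
the initial and at a later time. -/
theorem exists_simpleFunc_approx {Ω : Type*} [MeasurableSpace Ω] (P : ProbabilityMeasure Ω)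
    {f : Ω → Torus d} (hf : Measurable f) {w : Ω → Vec d} (hw : Measurable w)
    {S : Set (Torus d × Vec d)} (hS : ∀ ω, (f ω, w ω) ∈ S) (τ : ℝ) {δ : ℝ} (hδ : 0 < δ) :
    ∃ g : SimpleFunc Ω (Torus d × Vec d), (∀ ω, g ω ∈ S) ∧
      Real.sqrt (∫ ω, torusDist (f ω) (g ω).1 ^ 2 ∂(P : Measure Ω)) < δ ∧
      Real.sqrt (∫ ω, torusDist (translate (f ω) (τ • w ω)) (translate (g ω).1 (τ • (g ω).2)) ^ 2
        ∂(P : Measure Ω)) < δ := by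
  obtain ⟨ω₀⟩ := P.nonempty
  have hfw : Measurable fun ω => (f ω, w ω) := hf.prodMk hw
  let g : ℕ → SimpleFunc Ω (Torus d × Vec d) := SimpleFunc.approxOn _ hfw S _ (hS ω₀)
  have hg : ∀ ω, Tendsto (fun n => g n ω) atTop (𝓝 (f ω, w ω)) := fun ω =>
    SimpleFunc.tendsto_approxOn hfw (hS ω₀) (subset_closure (hS ω))
  have key : ∀ (c : Torus d × Vec d → Torus d), Continuous c →
      Tendsto (fun n => Real.sqrt (∫ ω, torusDist (c (f ω, w ω)) (c (g n ω)) ^ 2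
        ∂(P : Measure Ω))) atTop (𝓝 0) := fun c hc => by
    have h1 : Tendsto (fun n => ∫ ω, torusDist (c (f ω, w ω)) (c (g n ω)) ^ 2 ∂(P : Measure Ω))
        atTop (𝓝 (∫ _, (0 : ℝ) ∂(P : Measure Ω))) := by
      refine tendsto_integral_of_dominated_convergence (fun _ => torusDiam d ^ 2) (fun n => ?_)
        (integrable_const _) (fun n => ae_of_all _ fun ω => ?_) (ae_of_all _ fun ω => ?_)
      · exact (((hc.measurable.comp hfw).torusDist
          (hc.measurable.comp (g n).measurable)).pow_const 2).aestronglyMeasurable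
      · rw [Real.norm_of_nonneg (by positivity)]
        exact pow_le_pow_left₀ (torusDist_nonneg _ _) (torusDist_le_torusDiam _ _) 2
      · have hcont : Continuous fun y => torusDist (c (f ω, w ω)) (c y) ^ 2 :=
          (continuous_const.torusDist hc).pow 2
        have h2 : Tendsto (fun n => torusDist (c (f ω, w ω)) (c (g n ω)) ^ 2) atTop
            (𝓝 (torusDist (c (f ω, w ω)) (c (f ω, w ω)) ^ 2)) :=
          (hcont.tendsto (f ω, w ω)).comp (hg ω)
        simpa [torusDist_self] using h2
    have h2 : Tendsto (fun n => Real.sqrt (∫ ω, torusDist (c (f ω, w ω)) (c (g n ω)) ^ 2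
        ∂(P : Measure Ω))) atTop (𝓝 (Real.sqrt (∫ _, (0 : ℝ) ∂(P : Measure Ω)))) :=
      (Real.continuous_sqrt.tendsto _).comp h1
    simpa using h2
  have hc2 : Continuous fun y : Torus d × Vec d => translate y.1 (τ • y.2) :=
    continuous_fst.translate (continuous_snd.const_smul τ)
  obtain ⟨n, h1, h2⟩ := (((key Prod.fst continuous_fst).eventually (gt_mem_nhds hδ)).and
    ((key _ hc2).eventually (gt_mem_nhds hδ))).exists
  exact ⟨g n, fun ω => SimpleFunc.approxOn_mem hfw (hS ω₀) n ω, h1, h2⟩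

/-- **Suboptimality principle.** Let the mass of `μ₀` be moved along straight lines, the velocity of
a portion of mass at `ζ` being any element of `G(t₀, x₀, ζ, μ₀)`; different portions of the mass at
`ζ` may have different velocities. To first order in time, a subsolution does not decrease faster
than the running cost. -/
theorem suboptimality_principle (hV : LipWith T K V) (hK : 0 ≤ K) (hR : 0 ≤ R)
    (hF : RegularField T R fun t x _ θ => F t x θ) (hG : RegularField T R G) {KL : ℝ}
    (hKL : 0 ≤ KL) (hL : ∀ x₁ x₂ θ₁ θ₂,
      |L x₁ θ₁ - L x₂ θ₂| ≤ KL * (torusDist x₁ x₂ + wassersteinDist 2 θ₁ θ₂))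
    (hsub : IsSubsolution T (hamiltonian F G L) V) {Ω : Type*} [MeasurableSpace Ω]
    (P : ProbabilityMeasure Ω) {f : Ω → Torus d} (hf : Measurable f) {w : Ω → Vec d}
    (hw : Measurable w) {t₀ : ℝ} (ht₀ : t₀ ∈ Set.Ico (0 : ℝ) T) {x₀ : Torus d} {v : Vec d}
    (hv : v ∈ F t₀ x₀ (law P f hf)) (hwG : ∀ ω, w ω ∈ G t₀ x₀ (f ω) (law P f hf)) {M : ℝ}
    (hM : L x₀ (law P f hf) < M) :
    ∀ᶠ τ in 𝓝[>] (0 : ℝ), V t₀ x₀ (law P f hf) - τ * M ≤ V (t₀ + τ) (translate x₀ (τ • v))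
      (law P (fun ω => translate (f ω) (τ • w ω)) (hf.translate (hw.const_smul τ))) := by
  set μ₀ := law P f hf with hμ₀
  have hT0 : t₀ ∈ Set.Icc (0 : ℝ) T := ⟨ht₀.1, ht₀.2.le⟩
  set σ := M - L x₀ μ₀ with hσ
  have hσ0 : 0 < σ := sub_pos.2 hM
  -- One quarter of the margin `σ` pays for the error `24 K η` in the velocities.
  set η := σ / (96 * (K + 1)) with hη
  have hη0 : 0 < η := by positivity
  have hKη : 24 * K * η ≤ σ / 4 := by
    have : η * (96 * (K + 1)) = σ := by rw [hη]; field_simp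
    nlinarith
  obtain ⟨ρ₁, hρ₁, hFu⟩ := hF.unif (η / 2) (half_pos hη0)
  obtain ⟨ρ₂, hρ₂, hGu⟩ := hG.unif (η / 2) (half_pos hη0)
  set ρ := min ρ₁ ρ₂ with hρ
  have hρ0 : 0 < ρ := lt_min hρ₁ hρ₂
  have e : ∀ (c y : ℝ), 0 < y → ∀ᶠ τ : ℝ in 𝓝[>] 0, c * τ < y := fun c y hy => by
    have hc : Continuous fun τ : ℝ => c * τ := by fun_prop
    exact ((hc.tendsto 0).mono_left nhdsWithin_le_nhds).eventually
      (gt_mem_nhds (by simpa using hy))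
  filter_upwards [eventually_mem_nhdsWithin, e 1 (T - t₀) (sub_pos.2 ht₀.2), e (2 * R) 1 one_pos,
    e 1 ρ hρ0, e R ρ hρ0, e (KL * (2 * R)) (σ / 4) (by positivity)] with τ hτ h1 h2 h3 h4 h5
  have hτ0 : 0 < τ := hτ
  refine le_of_forall_pos_le_add fun ε hε => ?_
  obtain ⟨δ, hδ0, hδρ, hδL, hδK⟩ : ∃ δ : ℝ, 0 < δ ∧ δ < ρ ∧ KL * δ < σ / 4 ∧ 2 * K * δ < ε := by
    obtain ⟨δ, ⟨⟨h1, h2⟩, h3⟩, h4⟩ := (((eventually_mem_nhdsWithin.and (e 1 ρ hρ0)).and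
      (e KL (σ / 4) (by positivity))).and (e (2 * K) ε hε)).exists
    exact ⟨δ, h1, by linarith, h3, h4⟩
  obtain ⟨g, hgS, hg0, hgτ⟩ := exists_simpleFunc_approx P hf hw
    (S := {y | y.2 ∈ G t₀ x₀ y.1 μ₀}) hwG τ hδ0
  -- The finitely many pairs (position, velocity) index a particle system.
  let I := ↥(g.range)
  have hgI : ∀ ω, g ω ∈ g.range := fun ω => g.mem_range_self ω
  let gI : Ω → I := fun ω => ⟨g ω, hgI ω⟩
  have hgIm : Measurable gI := g.measurable.subtype_mk
  obtain ⟨ω₀⟩ := P.nonempty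
  have : Nonempty I := ⟨gI ω₀⟩
  let m : ProbabilityMeasure I := P.map hgIm.aemeasurable
  have hζ : Measurable fun i : I => i.1.1 := measurable_fst.comp measurable_subtype_coe
  have hwI : Measurable fun i : I => i.1.2 := measurable_snd.comp measurable_subtype_coe
  have hlaw0 : law m (fun i : I => i.1.1) hζ =
      law P (fun ω => (g ω).1) (measurable_fst.comp g.measurable) :=
    (law_comp P m hgIm rfl hζ).symm
  have hlawτ : law m (fun i : I => translate i.1.1 (τ • i.1.2)) (hζ.translate (hwI.const_smul τ)) =
      law P (fun ω => translate (g ω).1 (τ • (g ω).2))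
        ((measurable_fst.comp g.measurable).translate
          ((measurable_snd.comp g.measurable).const_smul τ)) :=
    (law_comp P m hgIm rfl (hζ.translate (hwI.const_smul τ))).symm
  have hW0 : wassersteinDist 2 μ₀ (law m (fun i : I => i.1.1) hζ) ≤ δ := by
    rw [hlaw0]
    exact (wassersteinDist_law_le P hf _).trans hg0.le
  have hWτ : wassersteinDist 2
      (law P (fun ω => translate (f ω) (τ • w ω)) (hf.translate (hw.const_smul τ)))
      (law m (fun i : I => translate i.1.1 (τ • i.1.2)) (hζ.translate (hwI.const_smul τ))) ≤ δ := by
    rw [hlawτ]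
    exact (wassersteinDist_law_le P _ _).trans hgτ.le
  have hfrozen := suboptimal_of_frozen hV hK hR hF hG hKL hL hsub hη0 (ρ := ρ)
    (fun t ht s hs x x' θ θ' a1 a2 a3 => hFu t ht s hs x x' x x θ θ'
      (a1.trans_le (min_le_left _ _)) (a2.trans_le (min_le_left _ _)) (by rwa [torusDist_self])
      (a3.trans_le (min_le_left _ _)))
    (fun t ht s hs x x' y y' θ θ' a1 a2 a3 a4 => hGu t ht s hs x x' y y' θ θ'
      (a1.trans_le (min_le_right _ _)) (a2.trans_le (min_le_right _ _))
      (a3.trans_le (min_le_right _ _)) (a4.trans_le (min_le_right _ _)))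
    ht₀.1 hτ0.le (by linarith) h2 (by linarith) h4 hv m hζ hwI
    (fun i => by
      obtain ⟨ω, hω⟩ := SimpleFunc.mem_range.1 i.2
      rw [← hω]
      exact hgS ω) (fun i j hij => Subtype.ext hij) hδρ hW0 (M := M) (by linarith)
  have hτT : t₀ + τ ∈ Set.Icc (0 : ℝ) T := ⟨by linarith [ht₀.1], by linarith⟩
  have c1 := (abs_le.1 (hV t₀ hT0 t₀ hT0 x₀ x₀ μ₀ (law m (fun i : I => i.1.1) hζ))).2
  have c2 := (abs_le.1 (hV (t₀ + τ) hτT (t₀ + τ) hτT (translate x₀ (τ • v))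
    (translate x₀ (τ • v))
    (law P (fun ω => translate (f ω) (τ • w ω)) (hf.translate (hw.const_smul τ)))
    (law m (fun i : I => translate i.1.1 (τ • i.1.2)) (hζ.translate (hwI.const_smul τ))))).1
  rw [sub_self, abs_zero, torusDist_self, zero_add, zero_add] at c1 c2
  have c3 := mul_le_mul_of_nonneg_left hW0 hK
  have c4 := mul_le_mul_of_nonneg_left hWτ hK
  linarith

end Suboptimality

/-! ### Doubling of variables and the comparison principle -/

-- Shortcuts without which the topology and the compactness of `Plan d` are not synthesized inside
-- larger products.
instance (d : ℕ) : OpensMeasurableSpace (Torus d × Torus d) := inferInstance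

instance (d : ℕ) : BorelSpace (Torus d × Torus d) := borelSpace_torus_prod d

section Doubling

variable {d : ℕ} {T K R : ℝ} {V V₁ V₂ : ℝ → Torus d → Prob d → ℝ}
  {F : ℝ → Torus d → Prob d → Set (Vec d)}
  {G : ℝ → Torus d → Torus d → Prob d → Set (Vec d)} {L : Torus d → Prob d → ℝ}

/-- The squared distance of `(s, y, pr₁♯γ)` and `(t, x, pr₂♯γ)`, measured along the coupling `γ`. -/
noncomputable def doublePenalty (s : ℝ) (y : Torus d) (t : ℝ) (x : Torus d) (γ : Plan d) : ℝ :=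
  (t - s) ^ 2 + torusDist y x ^ 2 + ∫ z, torusDist z.1 z.2 ^ 2 ∂(γ : Measure (Torus d × Torus d))

/-- All distances between the two configurations are controlled by the square root `q` of the
penalty. -/
theorem doublePenalty_bounds (s : ℝ) (y : Torus d) (t : ℝ) (x : Torus d) (γ : Plan d) :
    ∃ q, 0 ≤ q ∧ doublePenalty s y t x γ = q ^ 2 ∧ |t - s| ≤ q ∧ torusDist y x ≤ q ∧
      wassersteinDist 2 (law γ Prod.fst measurable_fst) (law γ Prod.snd measurable_snd) ≤ q ∧
      ∫ z, torusDist z.1 z.2 ^ 2 ∂(γ : Measure (Torus d × Torus d)) ≤ q ^ 2 := by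
  have h1 : 0 ≤ (t - s) ^ 2 := sq_nonneg _
  have h2 : 0 ≤ torusDist y x ^ 2 := sq_nonneg _
  have h3 : 0 ≤ ∫ z, torusDist z.1 z.2 ^ 2 ∂(γ : Measure (Torus d × Torus d)) :=
    integral_nonneg fun z => sq_nonneg _
  have h0 : 0 ≤ doublePenalty s y t x γ := add_nonneg (add_nonneg h1 h2) h3
  refine ⟨Real.sqrt (doublePenalty s y t x γ), Real.sqrt_nonneg _, (Real.sq_sqrt h0).symm, ?_, ?_,
    ?_, ?_⟩
  · refine Real.le_sqrt_of_sq_le ?_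
    rw [sq_abs, doublePenalty]
    linarith
  · refine Real.le_sqrt_of_sq_le ?_
    rw [doublePenalty]
    linarith
  · refine (wassersteinDist_law_le γ measurable_fst measurable_snd).trans (Real.sqrt_le_sqrt ?_)
    rw [doublePenalty]
    linarith
  · rw [Real.sq_sqrt h0, doublePenalty]
    linarith

theorem law_fst_diagPlan (μ : Prob d) : law (diagPlan μ) Prod.fst measurable_fst = μ := by
  have hm : Measurable fun x : Torus d => (x, x) := measurable_id.prodMk measurable_id
  exact Subtype.ext ((Measure.map_map measurable_fst hm).trans Measure.map_id)

theorem law_snd_diagPlan (μ : Prob d) : law (diagPlan μ) Prod.snd measurable_snd = μ := by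
  have hm : Measurable fun x : Torus d => (x, x) := measurable_id.prodMk measurable_id
  exact Subtype.ext ((Measure.map_map measurable_snd hm).trans Measure.map_id)

theorem doublePenalty_diagPlan (t : ℝ) (x : Torus d) (μ : Prob d) :
    doublePenalty t x t x (diagPlan μ) = 0 := by
  have hm : Measurable fun x : Torus d => (x, x) := measurable_id.prodMk measurable_id
  have h : ∫ z, torusDist z.1 z.2 ^ 2 ∂(diagPlan μ : Measure (Torus d × Torus d)) = 0 := by
    refine (integral_map hm.aemeasurable
      ((measurable_fst.torusDist measurable_snd).pow_const 2).aestronglyMeasurable).trans ?_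
    simp [torusDist_self]
  rw [doublePenalty, h, torusDist_self]
  simp

/-- The functional with doubled variables attains its maximum. The maximum is taken over all plans,
so that no optimal plans are needed. -/
theorem exists_max_doubled (hV₁ : LipWith T K V₁) (hV₂ : LipWith T K V₂) (hT : 0 ≤ T) (lam A : ℝ) :
    ∃ s ∈ Set.Icc (0 : ℝ) T, ∃ y, ∃ t ∈ Set.Icc (0 : ℝ) T, ∃ x, ∃ γ : Plan d,
      ∀ s₁ ∈ Set.Icc (0 : ℝ) T, ∀ y₁, ∀ t₁ ∈ Set.Icc (0 : ℝ) T, ∀ x₁, ∀ γ₁ : Plan d,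
        V₁ t₁ x₁ (law γ₁ Prod.snd measurable_snd) - V₂ s₁ y₁ (law γ₁ Prod.fst measurable_fst) +
            lam * t₁ - A / 2 * doublePenalty s₁ y₁ t₁ x₁ γ₁ ≤
          V₁ t x (law γ Prod.snd measurable_snd) - V₂ s y (law γ Prod.fst measurable_fst) +
            lam * t - A / 2 * doublePenalty s y t x γ := by
  let S := ℝ × Torus d × ℝ × Torus d × Plan d
  let D : Set S := Set.Icc (0 : ℝ) T ×ˢ (Set.univ ×ˢ (Set.Icc (0 : ℝ) T ×ˢ (Set.univ ×ˢ Set.univ)))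
  have hD : IsCompact D :=
    isCompact_Icc.prod (isCompact_univ.prod (isCompact_Icc.prod
      (isCompact_univ.prod isCompact_univ)))
  have c1 : Continuous fun p : S => p.2.1 := continuous_fst.comp continuous_snd
  have c2 : Continuous fun p : S => p.2.2.1 := by fun_prop
  have c3 : Continuous fun p : S => p.2.2.2.1 := by fun_prop
  have c4 : Continuous fun p : S => p.2.2.2.2 := by fun_prop
  have h1 : ContinuousOn
      (fun p : S => V₁ p.2.2.1 p.2.2.2.1 (law p.2.2.2.2 Prod.snd measurable_snd)) D :=
    hV₁.continuousOn c2 c3 ((continuous_law (d := d) (X := Torus d × Torus d) continuous_snd).comp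
      c4) fun p hp => hp.2.2.1
  have h2 : ContinuousOn
      (fun p : S => V₂ p.1 p.2.1 (law p.2.2.2.2 Prod.fst measurable_fst)) D :=
    hV₂.continuousOn continuous_fst c1
      ((continuous_law (d := d) (X := Torus d × Torus d) continuous_fst).comp c4) fun p hp => hp.1
  have h3 : Continuous fun p : S => doublePenalty p.1 p.2.1 p.2.2.1 p.2.2.2.1 p.2.2.2.2 := by
    unfold doublePenalty
    have e1 : Continuous fun p : S => (p.2.2.1 - p.1) ^ 2 := by fun_prop
    have e2 : Continuous fun p : S => torusDist p.2.1 p.2.2.2.1 ^ 2 := (c1.torusDist c3).pow 2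
    have e3 : Continuous fun z : Unit × (Torus d × Torus d) => torusDist z.2.1 z.2.2 ^ 2 :=
      ((continuous_fst.comp continuous_snd).torusDist (continuous_snd.comp continuous_snd)).pow 2
    have e4 := (continuous_integral_param (X := Torus d × Torus d) (S := Unit)
      (c := fun _ z => torusDist z.1 z.2 ^ 2) e3).comp
      (f := fun p : S => ((), p.2.2.2.2)) (by fun_prop)
    exact (e1.add e2).add e4
  have hΦ : ContinuousOn (fun p : S =>
      V₁ p.2.2.1 p.2.2.2.1 (law p.2.2.2.2 Prod.snd measurable_snd) -
        V₂ p.1 p.2.1 (law p.2.2.2.2 Prod.fst measurable_fst) + lam * p.2.2.1 -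
        A / 2 * doublePenalty p.1 p.2.1 p.2.2.1 p.2.2.2.1 p.2.2.2.2) D := by
    refine ((h1.sub h2).add ?_).sub (continuous_const.mul h3).continuousOn
    exact (continuous_const.mul c2).continuousOn
  have hne : D.Nonempty :=
    ⟨(0, 0, 0, 0, ⟨Measure.dirac 0, inferInstance⟩), ⟨le_rfl, hT⟩, trivial, ⟨le_rfl, hT⟩, trivial,
      trivial⟩
  obtain ⟨⟨s, y, t, x, γ⟩, ⟨hs, -, ht, -, -⟩, hmax⟩ := hD.exists_isMaxOn hne hΦ
  exact ⟨s, hs, y, t, ht, x, γ, fun s₁ hs₁ y₁ t₁ ht₁ x₁ γ₁ =>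
    hmax (a := (s₁, y₁, t₁, x₁, γ₁)) ⟨hs₁, trivial, ht₁, trivial, trivial⟩⟩

/-- The functional with doubled variables touches the supersolution from below. -/
theorem doubled_subdifferential {A : ℝ} (hA : 0 ≤ A) {s : ℝ} (hs : 0 ≤ s) (hsT : s < T)
    {y : Torus d} {t : ℝ} {x : Torus d} {γ : Plan d}
    (hmax : ∀ s₁ ∈ Set.Icc (0 : ℝ) T, ∀ y₁, ∀ γ₁ : Plan d,
      law γ₁ Prod.snd measurable_snd = law γ Prod.snd measurable_snd →
      -V s₁ y₁ (law γ₁ Prod.fst measurable_fst) - A / 2 * doublePenalty s₁ y₁ t x γ₁ ≤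
        -V s y (law γ Prod.fst measurable_fst) - A / 2 * doublePenalty s y t x γ) :
    IsSubdifferential V s y (law γ Prod.fst measurable_fst) (A * (t - s)) (A • disp y x)
      fun ζ => A • bary γ (fun z => disp z.1 z.2) ζ := by
  refine IsSuperdifferential.isSubdifferential ?_
  refine isSuperdifferential_of_touching (fun t x μ => -V t x μ) s y γ measurable_disp
    (B := torusDiam d) (fun z => norm_disp_le _ _) (c := fun z => torusDist z.1 z.2 ^ 2)
    ((measurable_fst.torusDist measurable_snd).pow_const 2) (Bc := torusDiam d ^ 2) (fun z => ?_)
    (fun ζ z u => torusDist_translate_left_sq _ _ _) (C := A / 2) (h₀ := T - s) hA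
    (by positivity) (sub_pos.2 hsT) fun h h0 hh u γ' hγ' => ?_
  · rw [Real.norm_of_nonneg (by positivity)]
    exact pow_le_pow_left₀ (torusDist_nonneg _ _) (torusDist_le_torusDiam _ _) 2
  have hm := hmax (s + h) ⟨by linarith, by linarith⟩ (translate y u) γ' (Subtype.ext hγ')
  have p1 := mul_le_mul_of_nonneg_left (torusDist_translate_left_sq y x u)
    (show 0 ≤ A / 2 by positivity)
  simp only [doublePenalty] at hm
  rw [inner_neg_left, real_inner_smul_left]
  nlinarith

/-- At a maximum of the functional with doubled variables, the suboptimality principle for the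
subsolution bounds the gain `lam` by the variation of the penalty along any admissible motion of the
leader and of the mass, where the mass at a point may split according to the plan. -/
theorem doubled_suboptimal (hV : LipWith T K V) (hK : 0 ≤ K) (hR : 0 ≤ R)
    (hF : RegularField T R fun t x _ θ => F t x θ) (hG : RegularField T R G) {KL : ℝ}
    (hKL : 0 ≤ KL) (hL : ∀ x₁ x₂ θ₁ θ₂,
      |L x₁ θ₁ - L x₂ θ₂| ≤ KL * (torusDist x₁ x₂ + wassersteinDist 2 θ₁ θ₂))
    (hsub : IsSubsolution T (hamiltonian F G L) V) {A lam : ℝ} (hA : 0 ≤ A) {s : ℝ}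
    {y : Torus d} {t : ℝ} (ht : t ∈ Set.Ico (0 : ℝ) T) {x : Torus d} {γ : Plan d}
    (hmax : ∀ t₁ ∈ Set.Icc (0 : ℝ) T, ∀ x₁, ∀ γ₁ : Plan d,
      law γ₁ Prod.fst measurable_fst = law γ Prod.fst measurable_fst →
      V t₁ x₁ (law γ₁ Prod.snd measurable_snd) + lam * t₁ - A / 2 * doublePenalty s y t₁ x₁ γ₁ ≤
        V t x (law γ Prod.snd measurable_snd) + lam * t - A / 2 * doublePenalty s y t x γ)
    {v : Vec d} (hv : v ∈ F t x (law γ Prod.snd measurable_snd)) {w : Torus d × Torus d → Vec d}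
    (hw : Measurable w) (hwG : ∀ z, w z ∈ G t x z.2 (law γ Prod.snd measurable_snd)) :
    lam ≤ L x (law γ Prod.snd measurable_snd) + A * (t - s) + A * inner ℝ (disp y x) v +
      A * ∫ z, inner ℝ (disp z.1 z.2) (w z) ∂(γ : Measure (Torus d × Torus d)) := by
  set μ := law γ Prod.snd measurable_snd with hμ
  have ht' : t ∈ Set.Icc (0 : ℝ) T := ⟨ht.1, ht.2.le⟩
  have hvR : ‖v‖ ≤ R := hF.bound t ht' x x μ v hv
  have hwR : ∀ z, ‖w z‖ ≤ R := fun z => hG.bound t ht' x z.2 μ _ (hwG z)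
  set J := ∫ z, inner ℝ (disp z.1 z.2) (w z) ∂(γ : Measure (Torus d × Torus d)) with hJ
  have i1 : Integrable (fun z : Torus d × Torus d => torusDist z.1 z.2 ^ 2)
      (γ : Measure (Torus d × Torus d)) := integrable_torusDist_sq γ measurable_fst measurable_snd
  have i2 : Integrable (fun z : Torus d × Torus d => inner ℝ (disp z.1 z.2) (w z))
      (γ : Measure (Torus d × Torus d)) := by
    refine Integrable.of_bound (C := torusDiam d * R)
      (measurable_disp.inner hw).aestronglyMeasurable (ae_of_all _ fun z => ?_)
    exact (norm_inner_le_norm _ _).trans (mul_le_mul (norm_disp_le _ _) (hwR _) (norm_nonneg _)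
      (torusDiam_nonneg d))
  refine le_of_forall_pos_le_add fun ε hε => ?_
  have hsubopt := suboptimality_principle hV hK hR hF hG hKL hL hsub γ measurable_snd hw ht hv hwG
    (M := L x μ + ε / 2) (by linarith)
  have e : ∀ (c b : ℝ), 0 < b → ∀ᶠ τ : ℝ in 𝓝[>] 0, c * τ < b := fun c b hb => by
    have hc : Continuous fun τ : ℝ => c * τ := by fun_prop
    exact ((hc.tendsto 0).mono_left nhdsWithin_le_nhds).eventually
      (gt_mem_nhds (by simpa using hb))
  obtain ⟨τ, hτs, hτ, hτT, hτε⟩ := (hsubopt.and (eventually_mem_nhdsWithin.and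
    ((e 1 (T - t) (sub_pos.2 ht.2)).and
      (e (A / 2 * (1 + 2 * R ^ 2)) (ε / 2) (by positivity))))).exists
  have hτ0 : 0 < τ := hτ
  have hmot : Measurable fun z : Torus d × Torus d => translate z.2 (τ • w z) :=
    measurable_snd.translate (hw.const_smul τ)
  have hpair : Measurable fun z : Torus d × Torus d => (z.1, translate z.2 (τ • w z)) :=
    measurable_fst.prodMk hmot
  let γ' : Plan d := γ.map hpair.aemeasurable
  have hγ'1 : law γ' Prod.fst measurable_fst = law γ Prod.fst measurable_fst :=
    Subtype.ext (Measure.map_map measurable_fst hpair)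
  have hγ'2 : law γ' Prod.snd measurable_snd = law γ (fun z => translate z.2 (τ • w z)) hmot :=
    Subtype.ext (Measure.map_map measurable_snd hpair)
  have hm := hmax (t + τ) ⟨by linarith [ht.1], by linarith⟩ (translate x (τ • v)) γ' hγ'1
  rw [hγ'2] at hm
  have p1 := torusDist_translate_right_sq y x (τ • v)
  rw [real_inner_smul_right, norm_smul, Real.norm_of_nonneg hτ0.le] at p1
  have p2 : ∫ z, torusDist z.1 z.2 ^ 2 ∂(γ' : Measure (Torus d × Torus d)) ≤
      (∫ z, torusDist z.1 z.2 ^ 2 ∂(γ : Measure (Torus d × Torus d))) + 2 * τ * J +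
        τ ^ 2 * R ^ 2 := by
    have hmap : ∫ z, torusDist z.1 z.2 ^ 2 ∂(γ' : Measure (Torus d × Torus d)) =
        ∫ z, torusDist z.1 (translate z.2 (τ • w z)) ^ 2 ∂(γ : Measure (Torus d × Torus d)) :=
      integral_map hpair.aemeasurable
        ((measurable_fst.torusDist measurable_snd).pow_const 2).aestronglyMeasurable
    have hconst : τ ^ 2 * R ^ 2 = ∫ _, τ ^ 2 * R ^ 2 ∂(γ : Measure (Torus d × Torus d)) := by simp
    have i3 : Integrable (fun z : Torus d × Torus d =>
        torusDist z.1 z.2 ^ 2 + 2 * τ * inner ℝ (disp z.1 z.2) (w z))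
        (γ : Measure (Torus d × Torus d)) := i1.add (i2.const_mul _)
    rw [hmap, hconst, hJ, ← integral_const_mul, ← integral_add i1 (i2.const_mul _),
      ← integral_add i3 (integrable_const _)]
    refine integral_mono (integrable_torusDist_sq γ measurable_fst hmot)
      (i3.add (integrable_const _)) fun z => ?_
    have q := torusDist_translate_right_sq z.1 z.2 (τ • w z)
    rw [real_inner_smul_right, norm_smul, Real.norm_of_nonneg hτ0.le, mul_pow] at q
    have q2 : τ ^ 2 * ‖w z‖ ^ 2 ≤ τ ^ 2 * R ^ 2 := by
      gcongr
      exact hwR z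
    beta_reduce
    linarith
  have p3 : (τ * ‖v‖) ^ 2 ≤ τ ^ 2 * R ^ 2 := by
    rw [mul_pow]
    gcongr
  have p4 : doublePenalty s y (t + τ) (translate x (τ • v)) γ' - doublePenalty s y t x γ ≤
      2 * τ * (t - s) + τ ^ 2 + 2 * τ * inner ℝ (disp y x) v + 2 * τ * J + 2 * (τ ^ 2 * R ^ 2) := by
    simp only [doublePenalty]
    nlinarith
  have p5 := mul_le_mul_of_nonneg_left p4 (show 0 ≤ A / 2 by positivity)
  have p6 := mul_lt_mul_of_pos_right hτε hτ0
  refine le_of_mul_le_mul_right (a := τ) ?_ hτ0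
  linarith

/-- A velocity field on the first marginal of a plan can be transported to the second marginal and
projected onto the admissible sets there; the price in `L²` of the plan is small when the plan is
concentrated near the diagonal. -/
theorem exists_transported_selection (hR : 0 ≤ R) (hG : RegularField T R G) {s t : ℝ}
    (hs : s ∈ Set.Icc (0 : ℝ) T) (ht : t ∈ Set.Icc (0 : ℝ) T) {y x : Torus d} {ν μ : Prob d}
    {w : Torus d → Vec d} (hw : Measurable w) (hwG : ∀ ζ, w ζ ∈ G s y ζ ν) {ε r : ℝ}
    (hε : 0 ≤ ε) (hr : 0 < r)
    (hunif : ∀ ζ ζ', torusDist ζ ζ' < r → ∀ a ∈ G s y ζ ν, ∃ b ∈ G t x ζ' μ, ‖a - b‖ ≤ ε)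
    (γ : Plan d) {q : ℝ} (hq : 0 ≤ q)
    (hqγ : ∫ z, torusDist z.1 z.2 ^ 2 ∂(γ : Measure (Torus d × Torus d)) ≤ q ^ 2) :
    ∃ u : Torus d × Torus d → Vec d, Measurable u ∧ (∀ z, u z ∈ G t x z.2 μ) ∧
      ∫ z, ‖u z - w z.1‖ ^ 2 ∂(γ : Measure (Torus d × Torus d)) ≤ (ε + 2 * R / r * q) ^ 2 := by
  have hum : Measurable fun z : Torus d × Torus d => metricProj (G t x z.2 μ) (w z.1) :=
    hG.measurable_proj ht x μ measurable_snd (hw.comp measurable_fst)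
  have huG : ∀ z : Torus d × Torus d, metricProj (G t x z.2 μ) (w z.1) ∈ G t x z.2 μ :=
    fun z => hG.proj_mem ht x z.2 μ _
  refine ⟨fun z => metricProj (G t x z.2 μ) (w z.1), hum, huG, ?_⟩
  have h2R : ∀ z : Torus d × Torus d, ‖metricProj (G t x z.2 μ) (w z.1) - w z.1‖ ≤ 2 * R :=
    fun z => (norm_sub_le _ _).trans
      (by linarith [hG.bound t ht x z.2 μ _ (huG z), hG.bound s hs y z.1 ν _ (hwG z.1)])
  have hpt : ∀ z : Torus d × Torus d, ‖metricProj (G t x z.2 μ) (w z.1) - w z.1‖ ^ 2 ≤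
      ε ^ 2 + (2 * R / r) ^ 2 * torusDist z.1 z.2 ^ 2 := fun z => by
    by_cases hz : torusDist z.1 z.2 < r
    · obtain ⟨b, hb, hab⟩ := hunif z.1 z.2 hz _ (hwG z.1)
      have h1 := (hG.norm_sub_proj_le ht x z.2 μ (w z.1) hb).trans hab
      rw [norm_sub_rev] at h1
      have h2 := pow_le_pow_left₀ (norm_nonneg _) h1 2
      have h3 : 0 ≤ (2 * R / r) ^ 2 * torusDist z.1 z.2 ^ 2 := by positivity
      linarith
    · have h2 : (2 * R) ^ 2 ≤ (2 * R / r) ^ 2 * torusDist z.1 z.2 ^ 2 := by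
        rw [← mul_pow]
        refine pow_le_pow_left₀ (by positivity) ?_ 2
        rw [div_mul_eq_mul_div, le_div_iff₀ hr]
        exact mul_le_mul_of_nonneg_left (not_lt.1 hz) (by positivity)
      have h3 := pow_le_pow_left₀ (norm_nonneg _) (h2R z) 2
      have h4 := sq_nonneg ε
      linarith
  have i1 : Integrable (fun z : Torus d × Torus d => torusDist z.1 z.2 ^ 2)
      (γ : Measure (Torus d × Torus d)) := integrable_torusDist_sq γ measurable_fst measurable_snd
  calc ∫ z, ‖metricProj (G t x z.2 μ) (w z.1) - w z.1‖ ^ 2 ∂(γ : Measure (Torus d × Torus d))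
      ≤ ∫ z, (ε ^ 2 + (2 * R / r) ^ 2 * torusDist z.1 z.2 ^ 2)
          ∂(γ : Measure (Torus d × Torus d)) := by
        refine integral_mono ?_ ((integrable_const _).add (i1.const_mul _)) hpt
        refine Integrable.of_bound (C := (2 * R) ^ 2)
          ((hum.sub (hw.comp measurable_fst)).norm.pow_const 2).aestronglyMeasurable
          (ae_of_all _ fun z => ?_)
        rw [Real.norm_of_nonneg (by positivity)]
        exact pow_le_pow_left₀ (norm_nonneg _) (h2R z) 2
    _ = ε ^ 2 + (2 * R / r) ^ 2 * ∫ z, torusDist z.1 z.2 ^ 2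
          ∂(γ : Measure (Torus d × Torus d)) := by
        rw [integral_add (integrable_const _) (i1.const_mul _), integral_const_mul]
        simp
    _ ≤ ε ^ 2 + (2 * R / r) ^ 2 * q ^ 2 := by gcongr
    _ ≤ (ε + 2 * R / r * q) ^ 2 := by
        have : 0 ≤ ε * (2 * R / r * q) := by positivity
        nlinarith

/-- The inequalities for the sub- and the supersolution at a maximum of the functional with doubled
variables, put together. -/
theorem gain_le_of_doubled_max (hV₁ : LipWith T K V₁) (hK : 0 ≤ K) (hR : 0 ≤ R)
    (hF : RegularField T R fun t x _ θ => F t x θ) (hG : RegularField T R G) {KL : ℝ}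
    (hKL : 0 ≤ KL) (hL : ∀ x₁ x₂ θ₁ θ₂,
      |L x₁ θ₁ - L x₂ θ₂| ≤ KL * (torusDist x₁ x₂ + wassersteinDist 2 θ₁ θ₂))
    (hsub : IsSubsolution T (hamiltonian F G L) V₁)
    (hsuper : IsSupersolution T (hamiltonian F G L) V₂) {A lam : ℝ} (hA : 0 ≤ A)
    {s : ℝ} (hs : s ∈ Set.Ico (0 : ℝ) T) {y : Torus d} {t : ℝ} (ht : t ∈ Set.Ico (0 : ℝ) T)
    {x : Torus d} {γ : Plan d}
    (hmax : ∀ s₁ ∈ Set.Icc (0 : ℝ) T, ∀ y₁, ∀ t₁ ∈ Set.Icc (0 : ℝ) T, ∀ x₁, ∀ γ₁ : Plan d,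
      V₁ t₁ x₁ (law γ₁ Prod.snd measurable_snd) - V₂ s₁ y₁ (law γ₁ Prod.fst measurable_fst) +
          lam * t₁ - A / 2 * doublePenalty s₁ y₁ t₁ x₁ γ₁ ≤
        V₁ t x (law γ Prod.snd measurable_snd) - V₂ s y (law γ Prod.fst measurable_fst) +
          lam * t - A / 2 * doublePenalty s y t x γ)
    {q ε r N : ℝ} (hq : 0 ≤ q) (hε : 0 ≤ ε) (hr : 0 < r) (hAq : A * q ≤ N)
    (hqx : torusDist y x ≤ q)
    (hqW : wassersteinDist 2 (law γ Prod.fst measurable_fst) (law γ Prod.snd measurable_snd) ≤ q)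
    (hqγ : ∫ z, torusDist z.1 z.2 ^ 2 ∂(γ : Measure (Torus d × Torus d)) ≤ q ^ 2)
    (hFε : ∀ a ∈ F s y (law γ Prod.fst measurable_fst),
      ∃ b ∈ F t x (law γ Prod.snd measurable_snd), ‖a - b‖ ≤ ε)
    (hGε : ∀ ζ ζ', torusDist ζ ζ' < r → ∀ a ∈ G s y ζ (law γ Prod.fst measurable_fst),
      ∃ b ∈ G t x ζ' (law γ Prod.snd measurable_snd), ‖a - b‖ ≤ ε) :
    lam ≤ 2 * KL * q + 2 * N * ε + N * (2 * R / r) * q := by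
  have hsT : s ∈ Set.Icc (0 : ℝ) T := ⟨hs.1, hs.2.le⟩
  have htT : t ∈ Set.Icc (0 : ℝ) T := ⟨ht.1, ht.2.le⟩
  set μ := law γ Prod.snd measurable_snd with hμ
  set ν := law γ Prod.fst measurable_fst with hν
  have hdiff := doubled_subdifferential (V := V₂) (γ := γ) (y := y) (x := x) (t := t) hA hs.1 hs.2
    fun s₁ hs₁ y₁ γ₁ hγ₁ => by
      have := hmax s₁ hs₁ y₁ t htT x γ₁
      rw [hγ₁] at this
      linarith
  have hH := hsuper s hs y _ _ _ _ hdiff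
  refine le_of_forall_pos_le_add fun κ hκ => ?_
  obtain ⟨v', hv', w', hw', hwG', hlt⟩ := exists_of_hamiltonian_lt (L := L) hF hG hsT
    (r := -(A * (t - s)) + κ) (by linarith)
  obtain ⟨v, hv, hvv⟩ := hFε v' hv'
  obtain ⟨u, hu, huG, huw⟩ := exists_transported_selection hR hG hsT htT hw' hwG' hε hr hGε γ hq hqγ
  have hgain := doubled_suboptimal hV₁ hK hR hF hG hKL hL hsub hA (s := s) (y := y) (lam := lam) ht
    (fun t₁ ht₁ x₁ γ₁ hγ₁ => by
      have := hmax s hsT y t₁ ht₁ x₁ γ₁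
      rw [hγ₁] at this
      linarith) hv hu huG
  have huR : ∀ z, ‖u z‖ ≤ R := fun z => hG.bound t htT x z.2 μ _ (huG z)
  have hwR : ∀ ζ, ‖w' ζ‖ ≤ R := fun ζ => hG.bound s hsT y ζ ν _ (hwG' ζ)
  have hbary : ∫ ζ, inner ℝ (A • bary γ (fun z => disp z.1 z.2) ζ) (w' ζ)
      ∂(ν : Measure (Torus d)) =
      A * ∫ z, inner ℝ (disp z.1 z.2) (w' z.1) ∂(γ : Measure (Torus d × Torus d)) := by
    rw [← integral_inner_bary_law γ measurable_disp (fun z => norm_disp_le _ _) hw' hwR,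
      ← integral_const_mul]
    simp_rw [real_inner_smul_left]
    rfl
  rw [hbary, real_inner_smul_right] at hlt
  have hint : ∀ {f : Torus d × Torus d → Vec d}, Measurable f → (∀ z, ‖f z‖ ≤ R) →
      Integrable (fun z : Torus d × Torus d => inner ℝ (disp z.1 z.2) (f z))
        (γ : Measure (Torus d × Torus d)) :=
    fun {f} hf hfR => Integrable.of_bound (C := torusDiam d * R)
      (measurable_disp.inner hf).aestronglyMeasurable
      (ae_of_all _ fun z => (norm_inner_le_norm _ _).trans
        (mul_le_mul (norm_disp_le _ _) (hfR z) (norm_nonneg _) (torusDiam_nonneg d)))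
  have h4 : |∫ z, inner ℝ (disp z.1 z.2) (u z - w' z.1) ∂(γ : Measure (Torus d × Torus d))| ≤
      q * (ε + 2 * R / r * q) := by
    refine abs_integral_inner_le γ measurable_disp (hu.sub (hw'.comp measurable_fst))
      (fun z => norm_disp_le _ _) (B' := 2 * R)
      (fun z => (norm_sub_le _ _).trans ((add_le_add (huR z) (hwR z.1)).trans_eq (by ring))) hq
      (by positivity) ?_ huw
    simp_rw [norm_disp]
    exact hqγ
  have h5 : ∫ z, inner ℝ (disp z.1 z.2) (u z - w' z.1) ∂(γ : Measure (Torus d × Torus d)) =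
      (∫ z, inner ℝ (disp z.1 z.2) (u z) ∂(γ : Measure (Torus d × Torus d))) -
      ∫ z, inner ℝ (disp z.1 z.2) (w' z.1) ∂(γ : Measure (Torus d × Torus d)) := by
    simp_rw [inner_sub_right]
    exact integral_sub (hint hu huR) (hint (hw'.comp measurable_fst) fun z => hwR z.1)
  rw [h5] at h4
  have h6 : inner ℝ (disp y x) v - inner ℝ v' (disp y x) ≤ q * ε := by
    rw [real_inner_comm (disp y x) v', ← inner_sub_right]
    refine (real_inner_le_norm _ _).trans ?_
    rw [norm_disp, norm_sub_rev]
    exact mul_le_mul hqx hvv (norm_nonneg _) hq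
  have h7 := mul_le_mul_of_nonneg_left (abs_le.1 h4).2 hA
  have h8 := mul_le_mul_of_nonneg_left h6 hA
  have h9 : A * q * (ε + 2 * R / r * q) ≤ N * (ε + 2 * R / r * q) :=
    mul_le_mul_of_nonneg_right hAq (by positivity)
  have h10 : A * q * ε ≤ N * ε := mul_le_mul_of_nonneg_right hAq hε
  have h11 := (abs_le.1 (hL x y μ ν)).2
  have h12 : KL * (torusDist x y + wassersteinDist 2 μ ν) ≤ KL * (2 * q) :=
    mul_le_mul_of_nonneg_left (by rw [torusDist_comm, wassersteinDist_comm]; linarith) hKL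
  linarith

/-- The comparison principle for regular velocity fields. -/
theorem comparison_of_regularField (hT : 0 < T) (hV₁ : LipWith T K V₁) (hV₂ : LipWith T K V₂)
    (hK : 0 ≤ K) (hR : 0 ≤ R)
    (hF : RegularField T R fun t x _ θ => F t x θ) (hG : RegularField T R G) {KL : ℝ}
    (hKL : 0 ≤ KL) (hL : ∀ x₁ x₂ θ₁ θ₂,
      |L x₁ θ₁ - L x₂ θ₂| ≤ KL * (torusDist x₁ x₂ + wassersteinDist 2 θ₁ θ₂))
    (hsub : IsSubsolution T (hamiltonian F G L) V₁)
    (hsuper : IsSupersolution T (hamiltonian F G L) V₂)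
    (hterm : ∀ x μ, V₁ T x μ = V₂ T x μ) {t₀ : ℝ} (ht₀ : t₀ ∈ Set.Icc (0 : ℝ) T) (x₀ : Torus d)
    (μ₀ : Prob d) : V₁ t₀ x₀ μ₀ ≤ V₂ t₀ x₀ μ₀ := by
  by_contra! hlt
  set δ := V₁ t₀ x₀ μ₀ - V₂ t₀ x₀ μ₀ with hδ
  have hδ0 : 0 < δ := sub_pos.2 hlt
  -- With this slope the term `lam * t` costs at most half of the gap `δ`.
  set lam := δ / (2 * T) with hlam
  have hlam0 : 0 < lam := by positivity
  have hlamT : lam * T = δ / 2 := by rw [hlam]; field_simp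
  set N := 6 * K + 2 * lam with hN
  have hN0 : 0 < N := by positivity
  -- `N` bounds `A` times the distance of the two configurations, so that the errors in the
  -- velocities cost at most `2 N ε = lam / 2`.
  set ε := lam / (4 * N) with hε
  have hε0 : 0 < ε := by positivity
  have hNε : 2 * N * ε = lam / 2 := by rw [hε]; field_simp; norm_num
  obtain ⟨ρ₁, hρ₁, hFu⟩ := hF.unif ε hε0
  obtain ⟨ρ₂, hρ₂, hGu⟩ := hG.unif ε hε0
  set B := 2 * KL + N * (2 * R / ρ₂) + 3 * K with hB
  have hB0 : 0 ≤ B := by positivity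
  obtain ⟨q₀, hq₀, hq₁, hq₂, hq₃, hq₄⟩ : ∃ q₀ : ℝ, 0 < q₀ ∧ q₀ < ρ₁ ∧ q₀ < ρ₂ ∧
      B * q₀ < δ / 2 ∧ B * q₀ < lam / 2 := by
    have e : ∀ {b : ℝ}, 0 < b → ∀ᶠ q : ℝ in 𝓝[>] 0, q < b := fun hb =>
      nhdsWithin_le_nhds (gt_mem_nhds hb)
    have e' : ∀ {b : ℝ}, 0 < b → ∀ᶠ q : ℝ in 𝓝[>] 0, B * q < b := fun {b} hb => by
      have hc : Continuous fun q : ℝ => B * q := by fun_prop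
      exact ((hc.tendsto 0).mono_left nhdsWithin_le_nhds).eventually
        (gt_mem_nhds (by simpa using hb))
    obtain ⟨q, hq, h⟩ := (eventually_mem_nhdsWithin.and ((e hρ₁).and ((e hρ₂).and
      ((e' (half_pos hδ0)).and (e' (half_pos hlam0)))))).exists
    exact ⟨q, hq, h⟩
  -- With this choice of `A`, the bound `A * q ≤ N` forces `q ≤ q₀`.
  set A := N / q₀ with hA
  have hA0 : 0 < A := by positivity
  obtain ⟨s, hs, y, t, ht, x, γ, hmax⟩ := exists_max_doubled hV₁ hV₂ hT.le lam A
  obtain ⟨q, hq, hpen, hqt, hqx, hqW, hqγ⟩ := doublePenalty_bounds s y t x γ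
  set μ := law γ Prod.snd measurable_snd with hμ
  set ν := law γ Prod.fst measurable_fst with hν
  have hlip : ∀ {V : ℝ → Torus d → Prob d → ℝ}, LipWith T K V →
      V t x μ - V s y ν ≤ 3 * K * q := fun {V} hV => by
    have h1 := (abs_le.1 (hV t ht s hs x y μ ν)).2
    have h2 : K * (|t - s| + torusDist x y + wassersteinDist 2 μ ν) ≤ K * (3 * q) :=
      mul_le_mul_of_nonneg_left (by rw [torusDist_comm, wassersteinDist_comm]; linarith) hK
    linarith
  have hAq : A * q ≤ N := by
    -- Comparison with two equal configurations shows that the penalty is small.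
    have h1 := hmax s hs y s hs y (diagPlan ν)
    rw [law_fst_diagPlan, law_snd_diagPlan, doublePenalty_diagPlan, hpen] at h1
    have h2 := hlip hV₁
    have h3 : lam * (t - s) ≤ lam * q :=
      mul_le_mul_of_nonneg_left ((le_abs_self _).trans hqt) hlam0.le
    rcases hq.eq_or_lt with h0 | h0
    · rw [← h0]; simpa using hN0.le
    · refine le_of_mul_le_mul_right (a := q) ?_ h0
      rw [hN]
      nlinarith
  have hqq : q ≤ q₀ := by
    refine le_of_mul_le_mul_left (a := A) (hAq.trans_eq ?_) hA0
    rw [hA]; field_simp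
  have hBq : B * q ≤ B * q₀ := mul_le_mul_of_nonneg_left hqq hB0
  have hBq' : B * q = 2 * KL * q + N * (2 * R / ρ₂) * q + 3 * K * q := by rw [hB]; ring
  have hq5 : 0 ≤ 2 * KL * q := by positivity
  have hq6 : 0 ≤ N * (2 * R / ρ₂) * q := by positivity
  have hq7 : 0 ≤ 3 * K * q := by positivity
  -- The gap excludes the terminal time for both configurations, where `V₁ = V₂`.
  have hgap : δ / 2 ≤ V₁ t x μ - V₂ s y ν := by
    have h1 := hmax t₀ ht₀ x₀ t₀ ht₀ x₀ (diagPlan μ₀)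
    rw [law_fst_diagPlan, law_snd_diagPlan, doublePenalty_diagPlan, hpen] at h1
    have h2 : 0 ≤ A / 2 * q ^ 2 := by positivity
    have h3 : lam * t ≤ lam * T := mul_le_mul_of_nonneg_left ht.2 hlam0.le
    have h4 : 0 ≤ lam * t₀ := mul_nonneg hlam0.le ht₀.1
    linarith
  have htT : t < T := by
    refine lt_of_le_of_ne ht.2 fun h => ?_
    have h1 := hlip hV₂
    have h2 : V₁ t x μ = V₂ t x μ := by rw [h]; exact hterm x μ
    linarith
  have hsT : s < T := by
    refine lt_of_le_of_ne hs.2 fun h => ?_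
    have h1 := hlip hV₁
    have h2 : V₁ s y ν = V₂ s y ν := by rw [h]; exact hterm y ν
    linarith
  have hgain := gain_le_of_doubled_max hV₁ hK hR hF hG hKL hL hsub hsuper hA0.le ⟨hs.1, hsT⟩
    ⟨ht.1, htT⟩ hmax hq hε0.le hρ₂ hAq hqx hqW hqγ
    (fun a ha => hFu s hs t ht y x y x ν μ (by rw [abs_sub_comm]; linarith) (by linarith)
      (by linarith) (by linarith) a ha)
    (fun ζ ζ' hζ a ha => hGu s hs t ht y x ζ ζ' ν μ (by rw [abs_sub_comm]; linarith) (by linarith)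
      hζ (by linarith) a ha)
  linarith

end Doubling

end WassersteinHJB


open WassersteinHJB in
theorem mainTheorem2 (d : ℕ) (T : ℝ) (hT : 0 < T) (k : ℝ → ℝ)
    (hk : MeasureTheory.IntegrableOn k (Set.Icc 0 T))
    (F : ℝ → WassersteinHJB.Torus d → WassersteinHJB.Prob d → Set (WassersteinHJB.Vec d))
    (G : ℝ → WassersteinHJB.Torus d → WassersteinHJB.Torus d → WassersteinHJB.Prob d →
      Set (WassersteinHJB.Vec d))
    (L : WassersteinHJB.Torus d → WassersteinHJB.Prob d → ℝ)
    (hF : WassersteinHJB.LeaderAssumption T k F)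
    (hG : WassersteinHJB.FollowerAssumption T k G)
    (hL : WassersteinHJB.CostAssumption L)
    (V₁ V₂ : ℝ → WassersteinHJB.Torus d → WassersteinHJB.Prob d → ℝ)
    (hV₁ : WassersteinHJB.BoundedLipschitz T V₁)
    (hV₂ : WassersteinHJB.BoundedLipschitz T V₂)
    (hsub : WassersteinHJB.IsSubsolution T (WassersteinHJB.hamiltonian F G L) V₁)
    (hsuper : WassersteinHJB.IsSupersolution T (WassersteinHJB.hamiltonian F G L) V₂)
    (hterm : ∀ (x : WassersteinHJB.Torus d) (μ : WassersteinHJB.Prob d), V₁ T x μ = V₂ T x μ) :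
    ∀ t ∈ Set.Icc (0 : ℝ) T, ∀ (x : WassersteinHJB.Torus d) (μ : WassersteinHJB.Prob d),
      V₁ t x μ ≤ V₂ t x μ := by
  intro t ht x μ
  -- Only the absolute value of `k` matters, since it multiplies nonnegative distances.
  have hk' : ∀ {t b : ℝ}, 0 ≤ b → k t * b ≤ |k t| * b := fun hb =>
    mul_le_mul_of_nonneg_right (le_abs_self _) hb
  have hF' : LeaderAssumption T (fun t => |k t|) F := ⟨hF.nonempty, hF.isCompact, hF.convex,
    fun t ht s hs x₁ x₂ θ₁ θ₂ => (hF.lipschitz t ht s hs x₁ x₂ θ₁ θ₂).trans (hk' (add_nonneg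
      (add_nonneg (abs_nonneg _) (torusDist_nonneg _ _)) (wassersteinDist_nonneg _ _)))⟩
  have hG' : FollowerAssumption T (fun t => |k t|) G := ⟨hG.nonempty, hG.isCompact, hG.convex,
    fun t ht s hs x₁ x₂ y₁ y₂ θ₁ θ₂ => (hG.lipschitz t ht s hs x₁ x₂ y₁ y₂ θ₁ θ₂).trans
      (hk' (add_nonneg (add_nonneg (add_nonneg (abs_nonneg _) (torusDist_nonneg _ _))
        (torusDist_nonneg _ _)) (wassersteinDist_nonneg _ _)))⟩
  obtain ⟨R₁, hR₁, hF₁⟩ := hF'.regularField hT fun t => abs_nonneg _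
  obtain ⟨R₂, hR₂, hG₁⟩ := hG'.regularField hT fun t => abs_nonneg _
  obtain ⟨KL, hKL⟩ := hL.lipschitz
  obtain ⟨K₁, hK₁, hLip₁⟩ := hV₁.exists_lipWith
  obtain ⟨K₂, hK₂, hLip₂⟩ := hV₂.exists_lipWith
  exact comparison_of_regularField hT (hLip₁.mono (le_max_left K₁ K₂))
    (hLip₂.mono (le_max_right K₁ K₂)) (hK₁.trans (le_max_left _ _)) (hR₁.trans (le_max_left R₁ R₂))
    (hF₁.mono (le_max_left _ _)) (hG₁.mono (le_max_right _ _)) (le_max_right KL 0)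
    (fun x₁ x₂ θ₁ θ₂ => (hKL x₁ x₂ θ₁ θ₂).trans (mul_le_mul_of_nonneg_right (le_max_left _ _)
      (add_nonneg (torusDist_nonneg _ _) (wassersteinDist_nonneg _ _))))
    hsub hsuper hterm ht x μ
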